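/- **Notation.** $\Gamma=\mathrm{SL}_2(\mathbb Z)$, $\mathfrak H$ is the upper half-plane, $\zeta_M=e^{2\pi i/M}$, and $q^x=e^{2\pi i\tau x}$ for $x\in\mathbb Q$. For $\gamma=\begin{pmatrix}A&B\\C&D\end{pmatrix}\in\Gamma$, $(f|_k\gamma)(\tau)=(C\tau+D)^{-k}f\left(\frac{A\tau+B}{C\tau+D}\right)$. For a Dirichlet character $\chi$ modulo $M$, $\mathfrak g(\chi)=\sum_{a\bmod M}\chi(a)e^{2\pi i a/M}$, and $B_k(\chi)=M^{k-1}\sum_{a=1}^{M}\chi(a)B_k(a/M)$ is the $\chi$-Bernoulli number ($B_k(x)$ the Bernoulli polynomial). If $\chi$ has conductor $f$ and $\chi_f$ is the associated primitive character modulo $f$, set $$S_k(\chi)=(M/f)^k\,\mathfrak g(\chi_f)\,\frac{\overline{B_k(\chi_f)}}{k}\prod_{p\mid M}\left(1-\frac{\chi_f(p)}{p^k}\right).$$ Let $k\ge1$ and $e\ge1$ be integers and let $\chi_1,\chi_2$ be primitive Dirichlet characters modulo $N_1,N_2\ge1$ with $\chi_1\chi_2(-1)=(-1)^k$. For $\tau\in\mathfrak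 H$ put $$F_k(\chi_1,\chi_2)(\tau)=\delta_{N_2,1}\frac{L(\chi_1,1-k)}{2}+\delta_{k,1}\delta_{N_1,1}\frac{L(\chi_2,0)}{2}+\sum_{n\ge1}\Big(\sum_{d\mid n,\,d>0}d^{k-1}\chi_1(d)\chi_2(n/d)\Big)q^n,$$ and $F_k(\chi_1,\chi_2,e)(\tau)=F_k(\chi_1,\chi_2)(e\tau)$. **Theorem.** Set $N=eN_1N_2$, and let $\gamma=\begin{pmatrix}A&B\\C&D\end{pmatrix}\in\Gamma$ be such that $C\mid N$, $C>0$, and $N\mid B$. Set $g=\gcd(e,C)$, $g_1=\gcd(N_1g,C)$, and $g_2=\gcd(N_2g,C)$. If $(k,\chi_1,\chi_2)\ne(2,1,1)$, then for all $\tau\in\mathfrak H$ $$F_k(\chi_1,\chi_2,e)|_k\gamma\,(\tau)=\frac{1}{z_k(\chi_1,\chi_2,C)}\sum_{n\ge0}a_\gamma(n)q^{g_1g_2n/N},$$ where the series converges absolutely, $z_k(\chi_1,\chi_2,C)\ne0$, and: 1. $z_k(\chi_1,\chi_2,C)=2(N_2e/g_2)^{k-1}(e/g)\,\mathfrak g(\overline{\chi_1})\,\mathfrak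 g(\overline{\chi_2})$. 2. For $n\ge1$, $$a_\gamma(n)=\zeta_N^{A^{-1}(g_1g_2/C)n}\sum_{m\mid n,\ m\in\mathbb Z}\operatorname{sign}(m)\,m^{k-1}c(n,m),$$ where $m$ runs over the positive and negative divisors of $n$, $A^{-1}$ is an inverse of $A$ modulo $N$, $C\mid g_1g_2$, and $$c(n,m)=\sum_{\substack{s_1\bmod C/g\\(N_1g/g_1)s_1\equiv n/m\ (\mathrm{mod}\ C/g_1)}}\overline{\chi_1}\left(\frac{n/m-(N_1g/g_1)s_1}{C/g_1}\right)\sum_{\substack{s_2\bmod C/g\\(N_2g/g_2)s_2\equiv m\ (\mathrm{mod}\ C/g_2)}}\overline{\chi_2}\left(\frac{m-(N_2g/g_2)s_2}{C/g_2}\right)\zeta_{C/g}^{-(Ae/g)^{-1}s_1s_2},$$ with $(Ae/g)^{-1}$ an inverse of $Ae/g$ modulo $C/g$. 3. Set $$T_k(\chi_1,\chi_2)=\begin{cases}(-1)^{k-1}\dfrac{\mathfrak g(\overline{\chi_2})}{N_2(g_2/g)^{k-1}}\,\overline{\chi_1}(-Ae/g)\,S_k(\overline{\chi_1}\chi_2)&\text{if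 }C/g=N_1,\\0&\text{if }C/g\ne N_1,\end{cases}$$ where $\overline{\chi_1}\chi_2$ is regarded as a character modulo $M=N_1N_2$, and let $T_k(\chi_2,\chi_1)$ be the same quantity with the roles of $(\chi_1,N_1,g_1)$ and $(\chi_2,N_2,g_2)$ exchanged. Then $$a_\gamma(0)=\begin{cases}T_k(\chi_1,\chi_2)&\text{if }k>1,\\T_1(\chi_1,\chi_2)+T_1(\chi_2,\chi_1)&\text{if }k=1.\end{cases}$$ -/

import Mathlib

open scoped ModularForm MatrixGroups

noncomputable section

namespace CuspEisenstein

/-- The primitive character attached to a character of nonzero level has nonzero level. -/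
instance neZeroConductor {M : ℕ} [NeZero M] (χ : DirichletCharacter ℂ M) :
    NeZero χ.conductor :=
  ⟨χ.conductor_ne_zero⟩

/-- `ζ_M = exp (2πi / M)`. -/
def zeta (M : ℕ) : ℂ := Complex.exp (2 * Real.pi * Complex.I / M)

/-- The inverse of `a` modulo `M`, as the representative in `{0, …, M - 1}`
(meaningful when `a` is prime to `M`). -/
def invMod (a : ℤ) (M : ℕ) : ℕ := ((a : ZMod M)⁻¹).val

/-- `q ^ x = exp (2πi τ x)` for a rational number `x`. -/
def qPow (τ : ℂ) (x : ℚ) : ℂ := Complex.exp (2 * Real.pi * Complex.I * τ * (x : ℂ))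

/-- The Gauss sum `𝔤(χ) = ∑_{a mod M} χ(a) exp (2πi a / M)`. -/
def gauss {M : ℕ} [NeZero M] (χ : DirichletCharacter ℂ M) : ℂ :=
  gaussSum χ ZMod.stdAddChar

/-- The `χ`-Bernoulli number `B_k(χ) = M ^ (k - 1) ∑_{a = 1}^{M} χ(a) B_k(a / M)`, for a character
`χ` modulo `M` and `k ≥ 1`, where `B_k(x)` is the Bernoulli polynomial. -/
def chiBernoulli (k : ℕ) {M : ℕ} (χ : DirichletCharacter ℂ M) : ℂ :=
  (M : ℂ) ^ (k - 1) * ∑ a ∈ Finset.Icc 1 M,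
    χ (a : ZMod M) * (((Polynomial.bernoulli k).eval ((a : ℚ) / (M : ℚ)) : ℚ) : ℂ)

/-- The twisted divisor sum `σ_{k-1}(χ₁, χ₂, n) = ∑_{d ∣ n} d ^ (k - 1) χ₁(d) χ₂(n / d)`. -/
def sigma (k : ℕ) {N₁ N₂ : ℕ} (χ₁ : DirichletCharacter ℂ N₁) (χ₂ : DirichletCharacter ℂ N₂)
    (n : ℕ) : ℂ :=
  ∑ d ∈ n.divisors, (d : ℂ) ^ (k - 1) * χ₁ (d : ZMod N₁) * χ₂ ((n / d : ℕ) : ZMod N₂)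

/-- The constant term of `F_k(χ₁, χ₂)` at infinity: `L(χ₁, 1 - k) / 2` if `N₂ = 1`, and, in weight
`1` only, a further term `L(χ₂, 0) / 2` if `N₁ = 1`. -/
def constTerm (k : ℕ) {N₁ N₂ : ℕ} [NeZero N₁] [NeZero N₂]
    (χ₁ : DirichletCharacter ℂ N₁) (χ₂ : DirichletCharacter ℂ N₂) : ℂ :=
  (if N₂ = 1 then χ₁.LFunction (1 - (k : ℂ)) / 2 else 0) +
    (if k = 1 ∧ N₁ = 1 then χ₂.LFunction 0 / 2 else 0)

/-- The Eisenstein series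
`F_k(χ₁, χ₂)(τ) = (constant term) + ∑_{n ≥ 1} σ_{k-1}(χ₁, χ₂, n) q ^ n`. -/
def F (k : ℕ) {N₁ N₂ : ℕ} [NeZero N₁] [NeZero N₂]
    (χ₁ : DirichletCharacter ℂ N₁) (χ₂ : DirichletCharacter ℂ N₂) (τ : ℂ) : ℂ :=
  constTerm k χ₁ χ₂ + ∑' n : ℕ+, sigma k χ₁ χ₂ n * qPow τ (n : ℕ)

/-- `F_k(χ₁, χ₂, e)(τ) = F_k(χ₁, χ₂)(e τ)` on the upper half-plane. -/
def Fe (k : ℕ) {N₁ N₂ : ℕ} [NeZero N₁] [NeZero N₂]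
    (χ₁ : DirichletCharacter ℂ N₁) (χ₂ : DirichletCharacter ℂ N₂) (e : ℕ)
    (τ : UpperHalfPlane) : ℂ :=
  F k χ₁ χ₂ ((e : ℂ) * (τ : ℂ))

/-- For a character `χ` modulo `M` of conductor `f` with associated primitive character `χ_f`,
`S_k(χ) = (M / f) ^ k 𝔤(χ_f) (conj B_k(χ_f) / k) ∏_{p ∣ M} (1 - χ_f(p) / p ^ k)`. -/
def S (k : ℕ) {M : ℕ} [NeZero M] (χ : DirichletCharacter ℂ M) : ℂ :=
  ((M : ℂ) / (χ.conductor : ℂ)) ^ k * gauss χ.primitiveCharacter *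
    (starRingEnd ℂ (chiBernoulli k χ.primitiveCharacter) / (k : ℂ)) *
    ∏ p ∈ M.primeFactors, (1 - χ.primitiveCharacter (p : ZMod χ.conductor) / (p : ℂ) ^ k)

/-- The character `χ̄₁ χ₂`, as a character modulo `N₁ N₂`. -/
def conjMul {N₁ N₂ : ℕ} (χ₁ : DirichletCharacter ℂ N₁) (χ₂ : DirichletCharacter ℂ N₂) :
    DirichletCharacter ℂ (N₁ * N₂) :=
  DirichletCharacter.changeLevel (Nat.dvd_mul_right N₁ N₂) (star χ₁) *
    DirichletCharacter.changeLevel (Nat.dvd_mul_left N₂ N₁) χ₂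

/-- `gᵢ = gcd(Nᵢ g, C)` where `g = gcd(e, C)`. -/
def gi (Ni e C : ℕ) : ℕ := Nat.gcd (Ni * Nat.gcd e C) C

/-- The normalizing constant
`z_k(χ₁, χ₂, C) = 2 (N₂ e / g₂) ^ (k - 1) (e / g) 𝔤(χ̄₁) 𝔤(χ̄₂)`. -/
def z (k : ℕ) {N₁ N₂ : ℕ} [NeZero N₁] [NeZero N₂]
    (χ₁ : DirichletCharacter ℂ N₁) (χ₂ : DirichletCharacter ℂ N₂) (e C : ℕ) : ℂ :=
  2 * ((N₂ : ℂ) * (e : ℂ) / (gi N₂ e C : ℂ)) ^ (k - 1) * ((e : ℂ) / (Nat.gcd e C : ℂ)) *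
    gauss (star χ₁) * gauss (star χ₂)

/-- The double sum `c(n, m)`, for a divisor `m` of `n`; here `r` stands for `n / m`.  The residue
classes `s₁`, `s₂` modulo `C / g` are represented by `0, …, C / g - 1`; all the divisions of
integers are exact. -/
def c {N₁ N₂ : ℕ} (χ₁ : DirichletCharacter ℂ N₁) (χ₂ : DirichletCharacter ℂ N₂)
    (e : ℕ) (A : ℤ) (C : ℕ) (r m : ℤ) : ℂ :=
  let g : ℕ := Nat.gcd e C
  let g₁ : ℕ := gi N₁ e C
  let g₂ : ℕ := gi N₂ e C
  ∑ s₁ ∈ (Finset.range (C / g)).filter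
      (fun s₁ : ℕ => ((N₁ * g / g₁ : ℕ) : ℤ) * (s₁ : ℤ) ≡ r [ZMOD ((C / g₁ : ℕ) : ℤ)]),
    star χ₁ (((r - ((N₁ * g / g₁ : ℕ) : ℤ) * (s₁ : ℤ)) / ((C / g₁ : ℕ) : ℤ) : ℤ) : ZMod N₁) *
    ∑ s₂ ∈ (Finset.range (C / g)).filter
        (fun s₂ : ℕ => ((N₂ * g / g₂ : ℕ) : ℤ) * (s₂ : ℤ) ≡ m [ZMOD ((C / g₂ : ℕ) : ℤ)]),
      star χ₂ (((m - ((N₂ * g / g₂ : ℕ) : ℤ) * (s₂ : ℤ)) / ((C / g₂ : ℕ) : ℤ) : ℤ) : ZMod N₂) *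
      zeta (C / g) ^ (-((invMod (A * ((e / g : ℕ) : ℤ)) (C / g) * s₁ * s₂ : ℕ) : ℤ))

/-- The quantity `T_k(χ₁, χ₂)`:
`(-1) ^ (k - 1) 𝔤(χ̄₂) / (N₂ (g₂ / g) ^ (k - 1)) χ̄₁(-A e / g) S_k(χ̄₁ χ₂)` if `C / g = N₁`,
and `0` otherwise. -/
def T (k : ℕ) {N₁ N₂ : ℕ} [NeZero N₁] [NeZero N₂]
    (χ₁ : DirichletCharacter ℂ N₁) (χ₂ : DirichletCharacter ℂ N₂)
    (e : ℕ) (A : ℤ) (C : ℕ) : ℂ :=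
  let g : ℕ := Nat.gcd e C
  if C / g = N₁ then
    (-1) ^ (k - 1) * (gauss (star χ₂) / ((N₂ : ℂ) * ((gi N₂ e C : ℂ) / (g : ℂ)) ^ (k - 1))) *
      star χ₁ ((-(A * ((e / g : ℕ) : ℤ)) : ℤ) : ZMod N₁) * S k (conjMul χ₁ χ₂)
  else 0

/-- The coefficients `a_γ(n)`.  For `n ≥ 1` the sum is over all the divisors `m` of `n`, positive
and negative; `C` divides `g₁ g₂`.  The constant term is `T_k(χ₁, χ₂)` for `k > 1` and
`T_1(χ₁, χ₂) + T_1(χ₂, χ₁)` for `k = 1`. -/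
def a (k : ℕ) {N₁ N₂ : ℕ} [NeZero N₁] [NeZero N₂]
    (χ₁ : DirichletCharacter ℂ N₁) (χ₂ : DirichletCharacter ℂ N₂)
    (e : ℕ) (A : ℤ) (C : ℕ) (n : ℕ) : ℂ :=
  if n = 0 then
    (if k = 1 then T 1 χ₁ χ₂ e A C + T 1 χ₂ χ₁ e A C else T k χ₁ χ₂ e A C)
  else
    zeta (e * N₁ * N₂) ^ (invMod A (e * N₁ * N₂) * (gi N₁ e C * gi N₂ e C / C) * n) *
      ∑ m ∈ Int.divisors (n : ℤ),
        (Int.sign m : ℂ) * (m : ℂ) ^ (k - 1) * c χ₁ χ₂ e A C ((n : ℤ) / m) m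

end CuspEisenstein

end

/-! Once `g` is divided out of `e` and `C` (the new `e`, `C` being coprime), one has `e g · γτ₀ =
Ae/C - 1/(Lτ)` with `L = N₁N₂C` and `τ = (C g τ₀ + D)/(e N₁ N₂)`. So the expansion at `γ∞` amounts
to applying `τ ↦ -1/τ` to `F` translated by `Ae/C`, a series whose coefficients `χ₁(d) χ₂(m)
e(Ae·dm/C)` are periodic modulo `L` in both `d` and `m`.

Such series are handled as Hecke handled division values. For `θ` on `(ℤ/L)²`, the sum of `θ(r, s)`
times the lattice sum of `(w + (rτ + s)/L)^(-k)` is computed row by row with the Lipschitz formula;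
this gives the series `eis` whose coefficients are a partial Fourier transform of `θ`
(`sum_rowSumReg`). Summing by columns instead of rows replaces `τ` by `-1/τ` and moves the Fourier
transform to the other variable (`rowSumReg_S`, `eis_neg_inv`). For `θ = kernel`, one transform
gives the twisted coefficients of `F` and the other gives `dualKernel`, which is the double sum
`c(n, m)` (`fourierSum_kernel_left`, `fourierSum_kernel_right`, `c_eq_dualKernel`). Its support is
what produces `g₁` and `g₂`.

In weights 1 and 2 the lattice sum is not absolutely convergent. Subtracting the first Taylor terms
makes it so, and the cost is measured by `G2` and its transformation law. In weight 2 the defect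
does not depend on `(r, s)` and disappears because `θ` has total sum 0, which is where `(2, 1, 1)`
is excluded. In weight 1 the defect is linear in `(r, s)`; it is absorbed in `rowSumReg` and yields
the second constant term.

The constant term is the value at `1 - k` of the L-function of a Fourier transform of the row
`kernel 0`. This row vanishes unless `C = N₁`, and is then a multiple of `χ̄₁χ₂` raised to level `L`
(`kernel_zero_eq_zero`, `kernel_zero_eq`). Two functional equations, for this character and for its
primitive version, turn the value into `S_k` (`LFunction_fourierSum_changeLevel`). -/

noncomputable section
namespace CuspEisenstein

open Filter Topology EisensteinSeries Asymptotics
open UpperHalfPlane hiding I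
open Complex (I exp integerComplement)
open scoped Real Nat

/-! ### Sums over one row of a lattice and the Lipschitz formula -/

/-- The Lipschitz series `(-2πi)^k / (k-1)! ∑_{d ≥ 1} d^(k-1) e(dz)`. -/
def lip (k : ℕ) (z : ℂ) : ℂ :=
  (-2 * π * I) ^ k / (k - 1)! * ∑' d : ℕ+, (d : ℂ) ^ (k - 1) * exp (2 * π * I * z) ^ (d : ℕ)

/-- The sum `∑_n (x + n)^(-k)` over the integers with `x + n ≠ 0`, symmetric if `k = 1`. -/
def lsum (k : ℕ) (x : ℂ) : ℂ :=
  if k = 1 then π * Complex.cot (π * x) else ∑' n : ℤ, 1 / (x + n) ^ k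

lemma lsum_one (x : ℂ) : lsum 1 x = π * Complex.cot (π * x) := by simp [lsum]

lemma lsum_of_ne_one {k : ℕ} (hk : k ≠ 1) (x : ℂ) : lsum k x = ∑' n : ℤ, 1 / (x + n) ^ k := by
  simp [lsum, hk]

lemma summable_lsum {k : ℕ} (hk : 2 ≤ k) (x : ℂ) : Summable fun n : ℤ => 1 / (x + n) ^ k := by
  simpa using linear_right_summable x 1 (k := k) (by exact_mod_cast hk)

lemma hasSum_lsum {k : ℕ} (hk : 2 ≤ k) (x : ℂ) :
    HasSum (fun n : ℤ => 1 / (x + n) ^ k) (lsum k x) := by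
  rw [lsum_of_ne_one (by omega)]
  exact (summable_lsum hk x).hasSum

lemma lsum_neg {k : ℕ} (x : ℂ) : lsum k (-x) = (-1) ^ k * lsum k x := by
  by_cases hk : k = 1
  · subst hk
    simp [lsum_one, Complex.cot, div_neg]
  · rw [lsum_of_ne_one hk, lsum_of_ne_one hk, ← tsum_mul_left, ← (Equiv.neg ℤ).tsum_eq]
    refine tsum_congr fun n => ?_
    have : (-x + ((Equiv.neg ℤ n : ℤ) : ℂ)) = (-1) * (x + n) := by simp; ring
    rw [this, mul_pow, one_div, mul_inv, ← inv_pow]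
    norm_num

lemma lsum_add_int (k : ℕ) (x : ℂ) (m : ℤ) : lsum k (x + m) = lsum k x := by
  by_cases hk : k = 1
  · subst hk
    simp only [lsum_one, mul_add, mul_comm (π : ℂ) (m : ℂ)]
    congr 1
    rw [mul_comm (m : ℂ), ← mul_add, Complex.cot_pi_eq_exp_ratio,
      Complex.cot_pi_eq_exp_ratio, mul_add, Complex.exp_add,
      mul_comm (2 * π * I) (m : ℂ), Complex.exp_int_mul_two_pi_mul_I, mul_one]
  · rw [lsum_of_ne_one hk, lsum_of_ne_one hk, ← (Equiv.addLeft m).tsum_eq fun n : ℤ => 1 / (x + n) ^ k]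
    refine tsum_congr fun n => ?_
    simp [add_assoc]

/-- This is the Lipschitz formula. In weight 1 it is the `q`-expansion of the cotangent, whose
constant term `-πi` is not part of `lip`. -/
lemma lsum_eq_lip {k : ℕ} (hk : 1 ≤ k) {z : ℂ} (hz : 0 < z.im) :
    lsum k z = lip k z - if k = 1 then π * I else 0 := by
  by_cases h1 : k = 1
  · subst h1
    have h := pi_mul_cot_pi_q_exp ⟨z, hz⟩
    have hs : Summable fun n : ℕ => exp (2 * π * I * z) ^ n :=
      summable_geometric_iff_norm_lt_one.mpr (UpperHalfPlane.norm_exp_two_pi_I_lt_one ⟨z, hz⟩)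
    rw [lsum_one]
    change (π : ℂ) * Complex.cot (π * z) = _ at h
    rw [h, lip]
    change π * I - 2 * π * I * ∑' n : ℕ, exp (2 * π * I * z) ^ n = _
    rw [← tsum_zero_pnat_eq_tsum_nat hs]
    simp
    ring
  · obtain ⟨k, rfl⟩ : ∃ l, k = l + 1 := ⟨k - 1, by omega⟩
    simp only [lsum_of_ne_one h1, if_neg h1, sub_zero, lip]
    exact qExpansion_identity_pnat (by omega) ⟨z, hz⟩

lemma lsum_eq_lip_neg {k : ℕ} (hk : 1 ≤ k) {z : ℂ} (hz : z.im < 0) :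
    lsum k z = (-1) ^ k * lip k (-z) + if k = 1 then π * I else 0 := by
  have h := lsum_neg (k := k) (-z)
  rw [neg_neg] at h
  rw [h, lsum_eq_lip hk (by simpa using hz)]
  by_cases h1 : k = 1
  · simp [h1]; ring
  · simp [h1]

/-- Differences of the terms of the cotangent series are absolutely summable. -/
lemma summable_one_div_sub (x y : ℂ) : Summable fun n : ℤ => 1 / (x + n) - 1 / (y + n) := by
  have hx := linear_inv_isBigO_right 1 x
  have hy := linear_inv_isBigO_right 1 y
  have hxy : (fun n : ℤ => 1 / (x + n) - 1 / (y + n)) =ᶠ[cofinite]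
      fun n : ℤ => (y - x) * ((x + n)⁻¹ * (y + n)⁻¹) := by
    have e (w : ℂ) : ∀ᶠ n : ℤ in cofinite, w + n ≠ 0 := by
      refine Set.Finite.subset (Set.Subsingleton.finite (s := {n : ℤ | w + n = 0}) ?_) ?_
      · intro a ha b hb
        have : (a : ℂ) = b := by
          have ha' : w + a = 0 := ha
          have hb' : w + b = 0 := hb
          linear_combination ha' - hb'
        exact_mod_cast this
      · intro n hn
        simpa using hn
    filter_upwards [e x, e y] with n hn hm
    field_simp
    ring
  refine summable_of_isBigO (g := fun n : ℤ => |(n : ℝ)| ^ (-2 : ℝ))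
    (Real.summable_abs_int_rpow (by norm_num)) ?_
  refine hxy.trans_isBigO ?_
  have := (hx.mul hy).const_mul_left (y - x)
  simp only [Int.cast_one, one_mul] at this
  refine this.trans (IsBigO.of_norm_le fun n => ?_)
  rw [Real.rpow_neg (abs_nonneg _), Real.rpow_two, ← mul_inv, ← sq, norm_inv, norm_pow,
    Real.norm_eq_abs]

/-- Absolute convergence of the difference permits pairing `n` with `-n`, and each half becomes the
Mittag-Leffler series of the cotangent. The case `x = 0` fits because `1 / 0 = 0`. -/
lemma hasSum_one_div_sub {x y : ℂ} (hx : x ∈ (integerComplement : Set ℂ) ∨ x = 0)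
    (hy : y ∈ (integerComplement : Set ℂ) ∨ y = 0) :
    HasSum (fun n : ℤ => 1 / (x + n) - 1 / (y + n)) (lsum 1 x - lsum 1 y) := by
  have key {x : ℂ} (hx : x ∈ (integerComplement : Set ℂ) ∨ x = 0) :
      Summable (fun n : ℕ+ => 1 / (x - n) + 1 / (x + n)) ∧
      lsum 1 x = 1 / x + ∑' n : ℕ+, (1 / (x - n) + 1 / (x + n)) := by
    rcases hx with hx | rfl
    · refine ⟨?_, by rw [lsum_one, cot_series_rep hx]⟩
      rw [summable_pnat_iff_summable_succ (f := fun n : ℕ => 1 / (x - n) + 1 / (x + n))]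
      simpa [cotTerm] using summable_cotTerm hx
    · simp [lsum_one, Complex.cot, div_neg, summable_zero]
  have hs := summable_one_div_sub x y
  have h := tsum_int_eq_zero_add_tsum_pnat hs
  have hp : Summable fun n : ℕ+ => 1 / (x + ((n : ℤ) : ℂ)) - 1 / (y + ((n : ℤ) : ℂ)) :=
    hs.comp_injective (i := fun n : ℕ+ => (n : ℤ)) fun a b hab => by simpa using hab
  have hn : Summable fun n : ℕ+ => 1 / (x + ((-(n : ℤ) : ℤ) : ℂ)) - 1 / (y + ((-(n : ℤ) : ℤ) : ℂ)) :=
    hs.comp_injective (i := fun n : ℕ+ => -(n : ℤ)) fun a b hab => by simpa using hab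
  rw [hs.hasSum_iff, h, add_assoc, ← hp.tsum_add hn, (key hx).2, (key hy).2, add_sub_add_comm,
    ← (key hx).1.tsum_sub (key hy).1]
  simp only [Int.cast_zero, add_zero, Int.cast_natCast, Int.cast_neg, ← sub_eq_add_neg]
  congr 1
  exact tsum_congr fun n => by ring


/-! ### Exchanging the order of summation -/

lemma summable_lattice_inv_pow_three (τ : ℍ) :
    Summable fun p : ℤ × ℤ => ‖((p.1 : ℂ) * τ + p.2)‖⁻¹ ^ 3 := by
  have h := (summable_prod_eisSummand (k := 3) le_rfl τ).norm
  refine h.congr fun p => ?_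
  simp [eisSummand]

/-- The terms of the lattice sum shifted by `z`, with its divergent part subtracted if `k ≤ 2`. -/
def latticeTerm (k : ℕ) (z w : ℂ) : ℂ :=
  1 / (w + z) ^ k - if k = 1 then 1 / w - z / w ^ 2 else if k = 2 then 1 / w ^ 2 else 0

lemma eventually_le_norm_lattice (τ : ℍ) {B : ℝ} (hB : 0 < B) :
    ∀ᶠ p : ℤ × ℤ in cofinite, B ≤ ‖(p.1 : ℂ) * τ + p.2‖ := by
  have h := (summable_lattice_inv_pow_three τ).tendsto_cofinite_zero.eventually_lt_const
    (show (0 : ℝ) < B⁻¹ ^ 3 by positivity)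
  filter_upwards [h, eventually_cofinite_ne (0 : ℤ × ℤ)] with p hp hp0
  have hw : (p.1 : ℂ) * τ + p.2 ≠ 0 := by
    have := linear_ne_zero (cd := ![(p.1 : ℝ), p.2]) τ (fun h => hp0 ?_)
    · simpa using this
    · have h0 := congrFun h 0
      have h1 := congrFun h 1
      exact Prod.ext (by simpa using h0) (by simpa using h1)
  have := lt_of_pow_lt_pow_left₀ 3 (by positivity) hp
  exact ((inv_lt_inv₀ (norm_pos_iff.mpr hw) hB).mp this).le

/-- What is subtracted in `latticeTerm` is the Taylor polynomial in `z` of `(w + z)^(-k)`, of just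
the degree that leaves a remainder `O(|w|⁻³)`. The three summands of the constant serve `k ≥ 3`, `k
= 2` and `k = 1` respectively. -/
lemma norm_latticeTerm_le {k : ℕ} (hk : 1 ≤ k) {z w : ℂ} (hw : 2 ≤ ‖w‖) (hz : 2 * ‖z‖ ≤ ‖w‖) :
    ‖latticeTerm k z w‖ ≤ (8 + 6 * ‖z‖ + 2 * ‖z‖ ^ 2) * ‖w‖⁻¹ ^ 3 := by
  have hw0 : 0 < ‖w‖ := by linarith
  have hw0' : w ≠ 0 := norm_pos_iff.mp hw0
  have hwz : ‖w‖ / 2 ≤ ‖w + z‖ := by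
    have := norm_sub_le (w + z) z
    simp only [add_sub_cancel_right] at this
    linarith
  have hwz0 : w + z ≠ 0 := fun h => by rw [h, norm_zero] at hwz; linarith
  set u := ‖w‖⁻¹ with hu
  set v := ‖w + z‖⁻¹ with hv
  have hu0 : 0 ≤ u := by positivity
  have hv0 : 0 ≤ v := by positivity
  have hvu : v ≤ 2 * u := by
    rw [hv, hu, ← inv_inv (2 : ℝ), ← mul_inv]
    exact inv_anti₀ (by positivity) (by linarith)
  have hv1 : v ≤ 1 := hvu.trans (by
    rw [hu]
    have : ‖w‖⁻¹ ≤ 2⁻¹ := inv_anti₀ (by norm_num) hw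
    linarith)
  have hz0 := norm_nonneg z
  have hu3 : 0 ≤ u ^ 3 := by positivity
  have main : ‖latticeTerm k z w‖ ≤ 8 * u ^ 3 ∨ ‖latticeTerm k z w‖ ≤ 6 * ‖z‖ * u ^ 3 ∨
      ‖latticeTerm k z w‖ ≤ 2 * ‖z‖ ^ 2 * u ^ 3 := by
    unfold latticeTerm
    split_ifs with h1 h2
    · subst h1
      right; right
      have : 1 / (w + z) ^ 1 - (1 / w - z / w ^ 2) = z ^ 2 * (w⁻¹ ^ 2 * (w + z)⁻¹) := by
        field_simp
        ring
      rw [this, norm_mul, norm_mul, norm_pow, norm_pow, norm_inv, norm_inv]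
      calc ‖z‖ ^ 2 * (u ^ 2 * v) ≤ ‖z‖ ^ 2 * (u ^ 2 * (2 * u)) := by gcongr
        _ = _ := by ring
    · subst h2
      right; left
      have : 1 / (w + z) ^ 2 - 1 / w ^ 2 = -(z * (w⁻¹ * (w + z)⁻¹ * ((w + z)⁻¹ + w⁻¹))) := by
        field_simp
        ring
      rw [this, norm_neg, norm_mul, norm_mul, norm_mul, norm_inv, norm_inv]
      calc ‖z‖ * (u * v * ‖(w + z)⁻¹ + w⁻¹‖) ≤ ‖z‖ * (u * (2 * u) * (2 * u + u)) := by
            gcongr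
            refine (norm_add_le _ _).trans ?_
            rw [norm_inv, norm_inv]
            gcongr
        _ = _ := by ring
    · left
      rw [sub_zero, norm_div, norm_one, norm_pow, one_div, ← inv_pow]
      calc v ^ k ≤ v ^ 3 := pow_le_pow_of_le_one hv0 hv1 (by omega)
        _ ≤ (2 * u) ^ 3 := by gcongr
        _ = _ := by ring
  have ha : 0 ≤ ‖z‖ * u ^ 3 := by positivity
  have hb : 0 ≤ ‖z‖ ^ 2 * u ^ 3 := by positivity
  rcases main with h | h | h <;> linarith

lemma summable_latticeTerm {k : ℕ} (hk : 1 ≤ k) (τ : ℍ) (z : ℂ) :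
    Summable fun p : ℤ × ℤ => latticeTerm k z ((p.1 : ℂ) * τ + p.2) := by
  refine summable_of_isBigO (summable_lattice_inv_pow_three τ)
    (IsBigO.of_bound (8 + 6 * ‖z‖ + 2 * ‖z‖ ^ 2) ?_)
  filter_upwards [eventually_le_norm_lattice τ (B := 2) (by norm_num),
    eventually_le_norm_lattice τ (B := 2 * ‖z‖ + 1) (by positivity)] with p h1 h2
  refine (norm_latticeTerm_le hk h1 (by linarith)).trans (le_of_eq ?_)
  rw [norm_pow, norm_inv, norm_norm]

lemma hasSum_row {k : ℕ} (hk : 1 ≤ k) {x y : ℂ} (hx : x ∈ (integerComplement : Set ℂ) ∨ x = 0)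
    (hy : y ∈ (integerComplement : Set ℂ) ∨ y = 0) :
    HasSum (fun n : ℤ => latticeTerm k (x - y) (y + n))
      (lsum k x - if k = 1 then lsum 1 y - (x - y) * lsum 2 y else if k = 2 then lsum 2 y
        else 0) := by
  unfold latticeTerm
  have e (n : ℤ) : y + n + (x - y) = x + n := by ring
  simp only [e]
  rcases Nat.lt_or_ge k 2 with h | h
  · obtain rfl : k = 1 := by omega
    simp only [if_true, pow_one]
    have h1 := (hasSum_one_div_sub hx hy).add ((hasSum_lsum le_rfl y).mul_left (x - y))
    convert h1 using 1
    · ext n; ring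
    · ring
  · have hx' := hasSum_lsum h x
    rw [if_neg (by omega)]
    simp only [show k ≠ 1 by omega, if_false]
    split_ifs with h2
    · exact hx'.sub (hasSum_lsum le_rfl y)
    · simpa using hx'


/-- The sum of the row `x` of the lattice, corrected for the constant `∓πi` if `k = 1`. -/
def row (k : ℕ) (τ : ℂ) (x b : ℝ) : ℂ :=
  if 0 < x then lip k (x * τ + b) else if x < 0 then (-1) ^ k * lip k (-(x * τ + b))
    else lsum k b

/-- In weight 1 the constants `∓πi` would prevent summation over the rows; once they are split off,
the rows decay exponentially. -/
lemma lsum_eq_row {k : ℕ} (hk : 1 ≤ k) (τ : ℍ) (x b : ℝ) :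
    lsum k (x * τ + b) = row k τ x b - if k = 1 then π * I * SignType.sign x else 0 := by
  have him : ((x : ℂ) * τ + b).im = x * τ.im := by simp
  unfold row
  split_ifs with h1 h2 h2 h3 h3
  · rw [lsum_eq_lip hk (by rw [him]; exact mul_pos h1 τ.im_pos)]
    simp [h2, h1]
  · rw [lsum_eq_lip hk (by rw [him]; exact mul_pos h1 τ.im_pos)]
    simp [h2]
  · rw [lsum_eq_lip_neg hk (by rw [him]; exact mul_neg_of_neg_of_pos h2 τ.im_pos)]
    simp [h3, h2]
  · rw [lsum_eq_lip_neg hk (by rw [him]; exact mul_neg_of_neg_of_pos h2 τ.im_pos)]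
    simp [h3]
  · obtain rfl : x = 0 := by linarith
    simp
  · obtain rfl : x = 0 := by linarith
    simp

lemma row_add_int (k : ℕ) (τ : ℂ) (x b : ℝ) (m : ℤ) : row k τ x (b + m) = row k τ x b := by
  have hlip (z : ℂ) (m : ℤ) : lip k (z + m) = lip k z := by
    unfold lip
    rw [mul_add, Complex.exp_add, mul_comm (2 * π * I) (m : ℂ), Complex.exp_int_mul_two_pi_mul_I,
      mul_one]
  unfold row
  push_cast
  rw [← add_assoc, hlip, neg_add, ← Int.cast_neg, hlip, lsum_add_int]

end CuspEisenstein
end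

/-! ### Summation over all rows, and exchange of rows and columns -/

noncomputable section
namespace CuspEisenstein
open Filter Topology EisensteinSeries Asymptotics
open UpperHalfPlane hiding I
open Complex (I exp integerComplement)
open scoped Real Nat

/-- The sum of all the rows `a + i` of the shifted lattice. -/
def rowSum (k : ℕ) (τ : ℂ) (a b : ℝ) : ℂ := ∑' i : ℤ, row k τ (a + i) b

/-- A majorant of the Lipschitz series at height `t`. -/
def lipBound (k : ℕ) (t : ℝ) : ℝ :=
  ‖(-2 * π * I : ℂ) ^ k / (k - 1)!‖ * ∑' d : ℕ+, (d : ℝ) ^ (k - 1) * Real.exp (-2 * π * t) ^ (d : ℕ)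

lemma summable_pnat_pow_mul_pow (l : ℕ) {r : ℝ} (hr0 : 0 ≤ r) (hr : r < 1) :
    Summable fun d : ℕ+ => (d : ℝ) ^ l * r ^ (d : ℕ) := by
  have := summable_pow_mul_geometric_of_norm_lt_one l (r := r) (by rwa [Real.norm_of_nonneg hr0])
  exact this.comp_injective PNat.coe_injective

lemma norm_exp_two_pi_I (z : ℂ) : ‖exp (2 * π * I * z)‖ = Real.exp (-2 * π * z.im) := by
  rw [Complex.norm_exp]
  congr 1
  simp

lemma exp_neg_lt_one {t : ℝ} (ht : 0 < t) : Real.exp (-2 * π * t) < 1 := by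
  rw [Real.exp_lt_one_iff]
  have := Real.pi_pos
  nlinarith [mul_pos this ht]

lemma norm_lip_le (k : ℕ) {z : ℂ} {t : ℝ} (ht : 0 < t) (hz : t ≤ z.im) :
    ‖lip k z‖ ≤ lipBound k t := by
  unfold lip lipBound
  rw [norm_mul]
  refine mul_le_mul_of_nonneg_left (tsum_of_norm_bounded
    (summable_pnat_pow_mul_pow _ (Real.exp_nonneg _) (exp_neg_lt_one ht)).hasSum fun d => ?_)
    (norm_nonneg _)
  rw [norm_mul, norm_pow, norm_pow, norm_exp_two_pi_I, Complex.norm_natCast]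
  have : Real.exp (-2 * π * z.im) ≤ Real.exp (-2 * π * t) := by
    apply Real.exp_le_exp.mpr
    have := Real.pi_pos
    nlinarith
  gcongr

lemma norm_row_le (k : ℕ) (τ : ℍ) {x t : ℝ} (b : ℝ) (ht : 0 < t) (hx : t ≤ |x|) :
    ‖row k τ x b‖ ≤ lipBound k (t * τ.im) := by
  have him : ((x : ℂ) * τ + b).im = x * τ.im := by simp
  have ht' : 0 < t * τ.im := mul_pos ht τ.im_pos
  unfold row
  split_ifs with h1 h2
  · refine norm_lip_le k ht' ?_
    rw [him]
    rw [abs_of_pos h1] at hx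
    exact mul_le_mul_of_nonneg_right hx τ.im_pos.le
  · rw [norm_mul, norm_pow, norm_neg, norm_one, one_pow, one_mul]
    refine norm_lip_le k ht' ?_
    rw [Complex.neg_im, him, ← neg_mul]
    rw [abs_of_neg h2] at hx
    exact mul_le_mul_of_nonneg_right hx τ.im_pos.le
  · obtain rfl : x = 0 := by linarith
    simp at hx
    linarith

lemma summable_lipBound (k : ℕ) (τ : ℍ) :
    Summable fun n : ℕ => lipBound k ((n + 1 : ℝ) * τ.im) := by
  have hr := exp_neg_lt_one τ.im_pos
  have hs := summable_prod_mul_pow (𝕜 := ℝ) (k - 1) (r := Real.exp (-2 * π * τ.im))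
    (by rwa [Real.norm_of_nonneg (Real.exp_nonneg _)])
  have h := hs.prod
  rw [summable_pnat_iff_summable_succ
    (f := fun n : ℕ => ∑' d : ℕ+, (d : ℝ) ^ (k - 1) * Real.exp (-2 * π * τ.im) ^ (n * d : ℕ))] at h
  refine (h.mul_left ‖(-2 * π * I : ℂ) ^ k / (k - 1)!‖).congr fun n => ?_
  unfold lipBound
  congr 1
  refine tsum_congr fun d => ?_
  rw [pow_mul, ← Real.exp_nat_mul]
  push_cast
  ring_nf

lemma summable_row (k : ℕ) (τ : ℍ) {a : ℝ} (ha0 : 0 ≤ a) (ha : a < 1) (b : ℝ) :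
    Summable fun i : ℤ => row k τ (a + i) b := by
  have hs := summable_lipBound k τ
  -- One extra row is dropped on each side, as the rows `a` and `a - 1` can be arbitrarily close to
  -- 0. The remaining ones have height at least `n + 1`.
  refine Summable.of_nat_of_neg_add_one ?_ ?_
  · refine (summable_nat_add_iff 1).mp (Summable.of_norm_bounded hs fun n => ?_)
    refine norm_row_le k τ b (by positivity) ?_
    push_cast
    rw [abs_of_nonneg (by positivity)]
    linarith
  · refine (summable_nat_add_iff 1).mp (Summable.of_norm_bounded hs fun n => ?_)
    refine norm_row_le k τ b (by positivity) ?_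
    push_cast
    rw [abs_of_nonpos (by have : (0 : ℝ) ≤ n := by positivity
                          linarith)]
    linarith

lemma lattice_mem {τ : ℍ} {x b : ℝ} (hb : (b : ℂ) ∈ (integerComplement : Set ℂ) ∨ b = 0) :
    (x : ℂ) * τ + b ∈ (integerComplement : Set ℂ) ∨ (x : ℂ) * τ + b = 0 := by
  by_cases hx : x = 0
  · subst hx
    simpa using hb
  · left
    rintro ⟨n, hn⟩
    have := congrArg Complex.im hn
    simp [hx, τ.im_ne_zero] at this

lemma hasSum_rows {k : ℕ} (hk : 1 ≤ k) (τ : ℍ) (a : ℝ) {b : ℝ}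
    (hb : (b : ℂ) ∈ (integerComplement : Set ℂ) ∨ b = 0) :
    HasSum (fun i : ℤ => lsum k (((a + i : ℝ) : ℂ) * τ + b) -
      if k = 1 then lsum 1 (i * τ) - (a * τ + b) * lsum 2 (i * τ)
      else if k = 2 then lsum 2 (i * τ) else 0)
      (∑' p : ℤ × ℤ, latticeTerm k (a * τ + b) ((p.1 : ℂ) * τ + p.2)) := by
  refine (summable_latticeTerm hk τ _).hasSum.prod_fiberwise fun i => ?_
  have h0 := lattice_mem (τ := τ) (x := i) (b := 0) (Or.inr rfl)
  simp only [Complex.ofReal_intCast, Complex.ofReal_zero, add_zero] at h0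
  have h := hasSum_row hk (lattice_mem (τ := τ) (x := a + i) hb) h0
  have e : ((a + i : ℝ) : ℂ) * τ + b - i * τ = a * τ + b := by push_cast; ring
  rw [e] at h
  exact h

lemma hasSum_lsum_two (τ : ℍ) : HasSum (fun i : ℤ => lsum 2 (i * τ)) (G2 τ) := by
  have hs : Summable fun i : ℤ => lsum 2 (i * τ) := by
    have := summable_row 2 τ le_rfl one_pos 0
    refine this.congr fun i => ?_
    have := lsum_eq_row (k := 2) (by norm_num) τ i 0
    simpa using this.symm
  have h2 := hasSum_e2Summand_symmetricIcc τ
  have e : (fun i : ℤ => lsum 2 (i * τ)) = fun i => e2Summand i τ := by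
    ext i
    rw [lsum_of_ne_one (by norm_num), e2Summand]
    refine tsum_congr fun n => ?_
    simp [eisSummand]
  rw [e] at hs ⊢
  convert hs.hasSum
  rw [G2, tsum_eq_of_summable_unconditional hs]

lemma rowSum_one_zero (τ : ℂ) : rowSum 1 τ 0 0 = 0 := by
  have h : rowSum 1 τ 0 0 = -rowSum 1 τ 0 0 := by
    conv_lhs => rw [rowSum, ← (Equiv.neg ℤ).tsum_eq]
    rw [rowSum, ← tsum_neg]
    refine tsum_congr fun i => ?_
    simp only [row, Equiv.neg_apply, Int.cast_neg, zero_add, Left.neg_pos_iff, Left.neg_neg_iff,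
      Complex.ofReal_neg, Complex.ofReal_zero, add_zero, neg_mul, neg_neg]
    rcases lt_trichotomy (i : ℝ) 0 with h | h | h
    · simp [h, h.not_gt]
    · simp [h, lsum_one, Complex.cot]
    · simp [h, h.not_gt]
  linear_combination h / 2

/-- Summing by rows, the subtracted Taylor terms contribute `G2`. In weight 1 the unshifted rows
`row 1 τ i 0` cancel in pairs by oddness (`rowSum_one_zero`), so only the signs and the multiple of
`G2` remain. -/
lemma tsum_latticeTerm {k : ℕ} (hk : 1 ≤ k) (τ : ℍ) {a b : ℝ} (ha0 : 0 ≤ a) (ha : a < 1)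
    (hb : (b : ℂ) ∈ (integerComplement : Set ℂ) ∨ b = 0) :
    ∑' p : ℤ × ℤ, latticeTerm k (a * τ + b) ((p.1 : ℂ) * τ + p.2) =
      rowSum k τ a b - if k = 1 then (if 0 < a then π * I else 0) - (a * τ + b) * G2 τ
        else if k = 2 then G2 τ else 0 := by
  refine (hasSum_rows hk τ a hb).unique ?_
  have hU : HasSum (fun i : ℤ => row k τ (a + i) b) (rowSum k τ a b) :=
    (summable_row k τ ha0 ha b).hasSum
  have hG := hasSum_lsum_two τ
  by_cases h1 : k = 1
  · subst h1
    have hU0 : HasSum (fun i : ℤ => row 1 τ i 0) 0 := by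
      have := (summable_row 1 τ le_rfl one_pos 0).hasSum
      rw [← rowSum, rowSum_one_zero] at this
      simpa using this
    -- Since `0 ≤ a < 1`, the signs of `a + i` and `i` can differ only at `i = 0`.
    have hsgn : HasSum (fun i : ℤ => (π * I : ℂ) * (SignType.sign (a + i : ℝ) : ℂ) -
        π * I * (SignType.sign (i : ℝ) : ℂ)) (if 0 < a then π * I else 0) := by
      have : (if 0 < a then π * I else 0 : ℂ) = (π * I : ℂ) * (SignType.sign (a + (0 : ℤ) : ℝ) : ℂ) -
        π * I * (SignType.sign ((0 : ℤ) : ℝ) : ℂ) := by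
        rcases ha0.eq_or_lt with h | h
        · simp [← h]
        · simp [h]
      rw [this]
      refine hasSum_single 0 fun i hi => ?_
      rcases lt_or_gt_of_ne hi with h | h
      · have h' : (i : ℝ) ≤ -1 := by exact_mod_cast (by omega : i ≤ -1)
        rw [sign_neg (by linarith : a + (i : ℝ) < 0), sign_neg (by linarith)]
        simp
      · have h' : (1 : ℝ) ≤ i := by exact_mod_cast (by omega : 1 ≤ i)
        rw [sign_pos (by linarith : 0 < a + (i : ℝ)), sign_pos (by linarith)]
        simp
    convert ((hU.sub hU0).sub hsgn).add (hG.mul_left ((a : ℂ) * τ + b)) using 1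
    · rfl
    · ext i
      have h2 := lsum_eq_row le_rfl τ i 0
      simp only [Complex.ofReal_intCast, Complex.ofReal_zero, add_zero] at h2
      rw [lsum_eq_row le_rfl τ, if_pos rfl, if_pos rfl, h2, if_pos trivial]
      ring
    · rw [if_pos rfl]
      ring
  · simp only [lsum_eq_row hk τ, h1, if_false]
    split_ifs with h2
    · subst h2
      simpa using hU.sub hG
    · simpa using hU

/-- The modification of `rowSum` which transforms well in weight `1`. -/
def rowSumReg (k : ℕ) (τ : ℂ) (a b : ℝ) : ℂ :=
  rowSum k τ a b + if k = 1 then 2 * π * I * (a - if 0 < a then 1 / 2 else 0) else 0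

/-- Exchanging rows and columns of the shifted lattice. -/
theorem rowSumReg_S {k : ℕ} (hk : 1 ≤ k) (τ : ℍ) {a b : ℝ} (ha0 : 0 ≤ a) (ha : a < 1)
    (hb0 : 0 ≤ b) (hb : b < 1) :
    (-(τ : ℂ)) ^ k * rowSumReg k τ a b - rowSumReg k (-1 / (τ : ℂ)) b (-a) =
      if k = 2 then (τ : ℂ) ^ 2 * G2 τ - G2 (ModularGroup.S • τ) else 0 := by
  have hmem {x : ℝ} (h0 : -1 < x) (h1 : x < 1) :
      (x : ℂ) ∈ (integerComplement : Set ℂ) ∨ x = 0 := by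
    by_cases hx : x = 0
    · exact Or.inr hx
    · left
      rintro ⟨n, hn⟩
      have hn' : (n : ℝ) = x := by exact_mod_cast hn
      rw [← hn'] at h0 h1 hx
      have h0' : -1 < n := by exact_mod_cast h0
      have h1' : n < 1 := by exact_mod_cast h1
      exact hx (by simp [show n = 0 by omega])
  have hτ := UpperHalfPlane.ne_zero τ
  set σ : ℍ := ModularGroup.S • τ with hσ
  have hστ : (σ : ℂ) = -1 / τ := by
    rw [hσ, UpperHalfPlane.modular_S_smul]
    simp [neg_div, inv_neg]
  have h1 := tsum_latticeTerm hk τ ha0 ha (hmem (by linarith) hb)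
  have h2 := tsum_latticeTerm hk σ hb0 hb (hmem (by linarith : -1 < -a) (by linarith))
  have h3 : (-(τ : ℂ)) ^ k * ∑' p : ℤ × ℤ, latticeTerm k (a * τ + b) ((p.1 : ℂ) * τ + p.2) =
      ∑' p : ℤ × ℤ, latticeTerm k (b * σ + (-a : ℝ)) ((p.1 : ℂ) * σ + p.2) := by
    -- With `σ = -1/τ`, the point `xτ + y` equals `-τ (yσ - x)`, both for the shift and for the
    -- lattice points; `latticeTerm` is homogeneous of degree `-k` in the pair.
    rw [← tsum_mul_left, ← ((Equiv.prodComm ℤ ℤ).trans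
      ((Equiv.refl ℤ).prodCongr (Equiv.neg ℤ))).tsum_eq
      fun p : ℤ × ℤ => latticeTerm k (b * σ + (-a : ℝ)) ((p.1 : ℂ) * σ + p.2)]
    refine tsum_congr fun p => ?_
    have e1 : (a : ℂ) * τ + b = -τ * (b * σ + (-a : ℝ)) := by
      rw [hστ]; push_cast; field_simp; ring
    have e2 : (p.1 : ℂ) * τ + p.2 = -τ * (p.2 * σ + (-p.1 : ℤ)) := by
      rw [hστ]; push_cast; field_simp; ring
    simp only [Equiv.trans_apply, Equiv.prodComm_apply, Equiv.prodCongr_apply, Prod.map,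
      Prod.fst_swap, Prod.snd_swap, Equiv.refl_apply, Equiv.neg_apply]
    rw [e1, e2]
    set z := (b : ℂ) * σ + (-a : ℝ)
    set w := (p.2 : ℂ) * σ + (-p.1 : ℤ)
    have hτ' : -(τ : ℂ) ≠ 0 := neg_ne_zero.mpr hτ
    unfold latticeTerm
    rw [← mul_add]
    generalize -(τ : ℂ) = c at hτ'
    split_ifs with h h'
    · subst h
      simp only [mul_pow, pow_one, mul_inv, div_eq_mul_inv]
      field_simp
    · subst h'
      simp only [mul_pow, one_div, mul_inv]
      field_simp
    · simp only [mul_pow, one_div, mul_inv, sub_zero]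
      field_simp
  rw [h1, h2] at h3
  rw [← hστ]
  have hG := G2_S_transform τ
  rw [← hσ] at hG
  unfold rowSumReg
  by_cases k1 : k = 1
  · subst k1
    simp only [if_true, pow_one, show ¬ ((1 : ℕ) = 2) by norm_num, if_false] at h3 ⊢
    -- The anomaly of `G2` contributes `2πi (aτ + b)`. Its part in `a` goes to the side of `τ` and
    -- its part in `b` to the side of `σ`; together with the sign terms this dictates the correction
    -- in `rowSumReg`.
    have hb' : ((b : ℂ) * σ + (-a : ℝ)) * G2 σ =
        -τ * (a * τ + b) * G2 τ + 2 * π * I * (a * τ + b) := by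
      rw [hG, hστ]
      push_cast
      field_simp
      ring
    split_ifs at h3 ⊢ <;> linear_combination h3 + hb'
  · simp only [k1, if_false, add_zero] at h3 ⊢
    by_cases k2 : k = 2
    · subst k2
      simp only [if_true] at h3 ⊢
      linear_combination h3
    · simp only [k2, if_false, sub_zero] at h3 ⊢
      rw [h3, sub_self]

end CuspEisenstein
end

/-! ### The exponential zeta function at 1 -/

noncomputable section
namespace CuspEisenstein
open Filter Topology
open Complex (I exp)
open HurwitzZeta
open scoped Real Nat

/-- Abel summation of `∑ cⁿ uₙ` for `u₀ = 0`. -/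
lemma one_sub_mul_eq_of_hasSum {c S : ℂ} {u : ℕ → ℂ} (h0 : u 0 = 0)
    (h : HasSum (fun n => c ^ n * u n) S) :
    (1 - c) * S = c * u 1 + ∑' n : ℕ, c ^ (n + 2) * (u (n + 2) - u (n + 1)) := by
  have h1 : HasSum (fun n => c ^ (n + 1) * u (n + 1)) S := by
    have := (hasSum_nat_add_iff' 1).mpr h
    simpa [h0] using this
  have h2 : HasSum (fun n => c ^ (n + 2) * u (n + 2)) (S - c * u 1) := by
    have := (hasSum_nat_add_iff' 1).mpr h1
    simpa using this
  have h3 := h2.sub (h1.mul_left c)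
  have h4 : (fun n : ℕ => c ^ (n + 2) * u (n + 2) - c * (c ^ (n + 1) * u (n + 1))) =
      fun n => c ^ (n + 2) * (u (n + 2) - u (n + 1)) := by
    ext n; ring
  rw [h4] at h3
  rw [h3.tsum_eq]
  ring

/-- The difference is of the size of the derivative `s x^(-s-1) ≤ 2 x^(-2)`. The bound is uniform in
`s ∈ [1, 2]` and comes from Bernoulli's inequality; it is the majorant for passing to the limit
after Abel summation. -/
lemma abs_rpow_sub_rpow_le {s : ℝ} (hs1 : 1 ≤ s) (hs2 : s ≤ 2) (n : ℕ) :
    |((n + 2 : ℕ) : ℝ) ^ (-s) - ((n + 1 : ℕ) : ℝ) ^ (-s)| ≤ 2 * (((n + 1 : ℕ) : ℝ) ^ 2)⁻¹ := by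
  set x : ℝ := ((n + 1 : ℕ) : ℝ) with hx
  have hx1 : 1 ≤ x := by rw [hx]; push_cast; have : (0 : ℝ) ≤ n := n.cast_nonneg; linarith
  have hx0 : 0 < x := by linarith
  have e : ((n + 2 : ℕ) : ℝ) = x + 1 := by rw [hx]; push_cast; ring
  rw [e]
  have hle : (x + 1) ^ (-s) ≤ x ^ (-s) :=
    Real.rpow_le_rpow_of_nonpos hx0 (by linarith) (by linarith)
  rw [abs_of_nonpos (by linarith), neg_sub]
  have hb := one_add_mul_self_le_rpow_one_add (s := -(1 / (x + 1))) (p := s)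
    (by rw [neg_le_neg_iff, div_le_one (by linarith)]; linarith) hs1
  have e1 : 1 + -(1 / (x + 1)) = x / (x + 1) := by field_simp; ring
  rw [e1, Real.div_rpow hx0.le (by linarith)] at hb
  have hxs : x ^ (-s) ≤ x⁻¹ := by
    rw [← Real.rpow_neg_one]
    exact Real.rpow_le_rpow_of_exponent_le hx1 (by linarith)
  have hpos : 0 < x ^ (-s) := Real.rpow_pos_of_pos hx0 _
  have e2 : (x + 1) ^ (-s) = x ^ (-s) * (x ^ s / (x + 1) ^ s) := by
    rw [Real.rpow_neg (by linarith), Real.rpow_neg hx0.le]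
    have : 0 < x ^ s := Real.rpow_pos_of_pos hx0 _
    field_simp
  rw [e2]
  have hinv : s * (1 / (x + 1)) ≤ 2 * x⁻¹ := by
    rw [one_div]
    have : (x + 1)⁻¹ ≤ x⁻¹ := inv_anti₀ hx0 (by linarith)
    have h0 : 0 < (x + 1)⁻¹ := by positivity
    nlinarith
  have h0 : 0 < x⁻¹ := by positivity
  calc x ^ (-s) - x ^ (-s) * (x ^ s / (x + 1) ^ s)
      = x ^ (-s) * (1 - x ^ s / (x + 1) ^ s) := by ring
    _ ≤ x ^ (-s) * (2 * x⁻¹) := by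
        refine mul_le_mul_of_nonneg_left ?_ hpos.le
        linarith
    _ ≤ x⁻¹ * (2 * x⁻¹) := by gcongr
    _ = 2 * (x ^ 2)⁻¹ := by rw [sq, mul_inv]; ring

lemma summable_two_mul_inv_sq : Summable fun n : ℕ => 2 * (((n + 1 : ℕ) : ℝ) ^ 2)⁻¹ :=
  ((summable_nat_add_iff 1).mpr (Real.summable_nat_pow_inv.mpr one_lt_two)).mul_left 2

/-- The series `∑ cⁿ/n` converges only conditionally. Multiplied by `1 - c` and summed by parts it
becomes the absolutely convergent `T`, which is reached both from `∑ cⁿ n^(-s)` as `s → 1⁺` and from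
`∑ (rc)ⁿ/n` as `r → 1⁻`. -/
lemma expZeta_one {a : ℝ} (ha0 : 0 < a) (ha1 : a < 1) :
    expZeta a 1 = -Complex.log (1 - exp (2 * π * I * a)) := by
  set c := exp (2 * π * I * a) with hc
  have hcn : ‖c‖ = 1 := by
    have : c = exp ((2 * π * a : ℝ) * I) := by rw [hc]; push_cast; ring_nf
    rw [this, Complex.norm_exp_ofReal_mul_I]
  have hc1 : c ≠ 1 := by
    intro h
    obtain ⟨n, hn⟩ := Complex.exp_eq_one_iff.mp h
    have h2 : (2 * π * I : ℂ) ≠ 0 := Complex.two_pi_I_ne_zero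
    have : (a : ℂ) = n := by
      apply mul_left_cancel₀ h2
      rw [hn]; ring
    have : a = n := by exact_mod_cast this
    rw [this] at ha0 ha1
    have h3 : 0 < n := by exact_mod_cast ha0
    have h4 : n < 1 := by exact_mod_cast ha1
    omega
  have hane : (a : UnitAddCircle) ≠ 0 := by
    intro h
    rw [AddCircle.coe_eq_zero_iff_of_mem_Ico] at h
    · exact ha0.ne' h
    · exact ⟨ha0.le, by simpa using ha1⟩
  set v : ℕ → ℂ := fun n => 1 / (n : ℂ)
  set T := c * v 1 + ∑' n : ℕ, c ^ (n + 2) * (v (n + 2) - v (n + 1)) with hT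
  -- the limit `s → 1` on the side of the exponential zeta function
  have lim1 : (1 - c) * expZeta a 1 = T := by
    have hcont : Tendsto (fun s : ℝ => (1 - c) * expZeta a s) (𝓝[>] 1) (𝓝 ((1 - c) * expZeta a 1)) := by
      have h := ((differentiableAt_expZeta (a : UnitAddCircle) 1 (Or.inr hane)).continuousAt).tendsto
      have h' : Tendsto (fun s : ℝ => (s : ℂ)) (𝓝[>] 1) (𝓝 1) := by
        have := (Complex.continuous_ofReal.tendsto 1).mono_left (nhdsWithin_le_nhds (s := Set.Ioi 1))
        simpa using this
      exact (h.comp h').const_mul _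
    have hlim : Tendsto (fun s : ℝ => c * (((1 : ℕ) : ℝ) ^ (-s) : ℝ) + ∑' n : ℕ, c ^ (n + 2) *
        ((((n + 2 : ℕ) : ℝ) ^ (-s) - ((n + 1 : ℕ) : ℝ) ^ (-s) : ℝ) : ℂ)) (𝓝[>] 1) (𝓝 T) := by
      have hpow (n : ℕ) (hn : n ≠ 0) : Tendsto (fun s : ℝ => (n : ℝ) ^ (-s)) (𝓝[>] 1)
          (𝓝 (1 / (n : ℝ))) := by
        have : ContinuousAt (fun s : ℝ => (n : ℝ) ^ (-s)) 1 := by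
          refine ContinuousAt.rpow continuousAt_const continuousAt_id.neg (Or.inl ?_)
          exact_mod_cast hn
        have := this.tendsto.mono_left (nhdsWithin_le_nhds (s := Set.Ioi 1))
        simpa [Real.rpow_neg_one] using this
      refine Tendsto.add ?_ ?_
      · have := (Complex.continuous_ofReal.tendsto _).comp (hpow 1 one_ne_zero)
        simpa [v, Function.comp_def] using this.const_mul c
      · refine tendsto_tsum_of_dominated_convergence summable_two_mul_inv_sq (fun n => ?_) ?_
        · have := (Complex.continuous_ofReal.tendsto _).comp
            ((hpow (n + 2) (by omega)).sub (hpow (n + 1) (by omega)))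
          simpa [v, Function.comp_def] using this.const_mul (c ^ (n + 2))
        · have : ∀ᶠ s : ℝ in 𝓝[>] 1, s ∈ Set.Ioo (1 : ℝ) 2 := Ioo_mem_nhdsGT (by norm_num)
          filter_upwards [this] with s hs n
          rw [norm_mul, norm_pow, hcn, one_pow, one_mul, Complex.norm_real, Real.norm_eq_abs]
          exact abs_rpow_sub_rpow_le hs.1.le hs.2.le n
    refine tendsto_nhds_unique (hcont.congr' ?_) hlim
    filter_upwards [self_mem_nhdsWithin] with s hs
    have hs1 : 1 < s := hs
    have h := hasSum_expZeta_of_one_lt_re a (s := s) (by simpa using hs1)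
    have h' : HasSum (fun n : ℕ => c ^ n * (((n : ℝ) ^ (-s) : ℝ) : ℂ)) (expZeta a s) := by
      convert h using 1
      ext n
      rw [hc, ← Complex.exp_nat_mul, Complex.ofReal_cpow (by positivity)]
      push_cast
      rw [Complex.cpow_neg, div_eq_mul_inv]
      congr 2
      ring
    rw [one_sub_mul_eq_of_hasSum (u := fun n => (((n : ℝ) ^ (-s) : ℝ) : ℂ)) _ h']
    · push_cast; rfl
    · simp [Real.zero_rpow (by linarith : -s ≠ 0)]
  -- the limit `r → 1` on the side of the logarithm
  have hslit : 1 - c ∈ Complex.slitPlane := by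
    left
    have h1 : c.re ≤ 1 := (Complex.re_le_norm c).trans hcn.le
    have h2 : c.re ≠ 1 := by
      intro h
      apply hc1
      have h3 : c.re ^ 2 + c.im ^ 2 = 1 := by
        have := Complex.sq_norm c
        rw [hcn, Complex.normSq_apply] at this
        linarith
      have h4 : c.im = 0 := by
        rw [h] at h3
        nlinarith
      exact Complex.ext h h4
    simp only [Complex.sub_re, Complex.one_re]
    exact sub_pos.mpr (lt_of_le_of_ne h1 h2)
  have lim2 : (1 - c) * -Complex.log (1 - c) = T := by
    have hcr : Tendsto (fun r : ℝ => (r : ℂ) * c) (𝓝[<] 1) (𝓝 c) := by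
      have := ((Complex.continuous_ofReal.tendsto 1).mono_left
        (nhdsWithin_le_nhds (s := Set.Iio 1))).mul_const c
      simpa using this
    have hcont : Tendsto (fun r : ℝ => (1 - r * c) * -Complex.log (1 - r * c)) (𝓝[<] 1)
        (𝓝 ((1 - c) * -Complex.log (1 - c))) :=
      (hcr.const_sub 1).mul ((hcr.const_sub 1).clog hslit).neg
    have hlim : Tendsto (fun r : ℝ => (r * c) * v 1 + ∑' n : ℕ, (r * c) ^ (n + 2) *
        (v (n + 2) - v (n + 1))) (𝓝[<] 1) (𝓝 T) := by
      refine Tendsto.add (hcr.mul_const _) ?_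
      refine tendsto_tsum_of_dominated_convergence summable_two_mul_inv_sq
        (fun n => (hcr.pow _).mul_const _) ?_
      have : ∀ᶠ r : ℝ in 𝓝[<] 1, r ∈ Set.Ioo (0 : ℝ) 1 := Ioo_mem_nhdsLT (by norm_num)
      filter_upwards [this] with r hr n
      have e : v (n + 2) - v (n + 1) =
          ((((n + 2 : ℕ) : ℝ) ^ (-1 : ℝ) - ((n + 1 : ℕ) : ℝ) ^ (-1 : ℝ) : ℝ) : ℂ) := by
        rw [Real.rpow_neg_one, Real.rpow_neg_one]
        simp [v]
      rw [norm_mul, e, Complex.norm_real, Real.norm_eq_abs, norm_pow, norm_mul, hcn, mul_one,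
        Complex.norm_real, Real.norm_of_nonneg hr.1.le]
      calc r ^ (n + 2) * _ ≤ 1 * _ := by
            gcongr
            exact pow_le_one₀ hr.1.le hr.2.le
        _ ≤ _ := by
          rw [one_mul]
          exact abs_rpow_sub_rpow_le le_rfl one_le_two n
    refine tendsto_nhds_unique (hcont.congr' ?_) hlim
    have : ∀ᶠ r : ℝ in 𝓝[<] 1, r ∈ Set.Ioo (0 : ℝ) 1 := Ioo_mem_nhdsLT (by norm_num)
    filter_upwards [this] with r hr
    refine one_sub_mul_eq_of_hasSum (by simp [v]) ?_
    have hn : ‖(r : ℂ) * c‖ < 1 := by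
      rw [norm_mul, hcn, mul_one, Complex.norm_real, Real.norm_of_nonneg hr.1.le]
      exact hr.2
    simpa [v, div_eq_mul_inv] using Complex.hasSum_taylorSeries_neg_log hn
  exact mul_left_cancel₀ (sub_ne_zero.mpr (Ne.symm hc1)) (lim1.trans lim2.symm)

end CuspEisenstein
end

/-! ### Hurwitz zeta values at `1 - k` and Bernoulli numbers -/

noncomputable section
namespace CuspEisenstein
open Filter Topology
open Complex (I exp)
open HurwitzZeta
open scoped Real Nat ZMod

/-- One has `1 - e^{2iθ} = 2 sin θ · e^{i(θ - π/2)}` with `θ = πa`, and the argument `θ - π/2` is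
within the principal range. -/
lemma log_one_sub_exp {a : ℝ} (ha0 : 0 < a) (ha1 : a < 1) :
    Complex.log (1 - exp (2 * π * I * a)) = Real.log (2 * Real.sin (π * a)) + (π * a - π / 2) * I := by
  have hπ := Real.pi_pos
  have hs : 0 < Real.sin (π * a) := Real.sin_pos_of_pos_of_lt_pi (by positivity) (by nlinarith)
  have h : 1 - exp (2 * π * I * a) =
      exp (Real.log (2 * Real.sin (π * a)) + (π * a - π / 2) * I) := by
    rw [Complex.exp_add, ← Complex.ofReal_exp, Real.exp_log (by positivity), sub_mul,
      Complex.exp_sub, Complex.exp_pi_div_two_mul_I]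
    push_cast
    rw [Complex.sin, show (2 * π * I * a : ℂ) = π * a * I + π * a * I by ring, Complex.exp_add,
      neg_mul, Complex.exp_neg]
    have := Complex.exp_ne_zero (π * a * I)
    field_simp
  have him : ((Real.log (2 * Real.sin (π * a)) : ℂ) + (π * a - π / 2) * I).im = π * a - π / 2 := by
    rw [show ((Real.log (2 * Real.sin (π * a)) : ℂ) + (π * a - π / 2) * I) =
      ((Real.log (2 * Real.sin (π * a)) : ℝ) : ℂ) + ((π * a - π / 2 : ℝ) : ℂ) * I by push_cast; ring]
    simp
  rw [h, Complex.log_exp]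
  · rw [him]; nlinarith
  · rw [him]; nlinarith

/-- The value at `0` of the Hurwitz zeta function. -/
lemma hurwitzZeta_apply_zero {a : ℝ} (ha0 : 0 < a) (ha1 : a < 1) :
    hurwitzZeta a 0 = 1 / 2 - a := by
  have hane : (a : UnitAddCircle) ≠ 0 := by
    intro h
    rw [AddCircle.coe_eq_zero_iff_of_mem_Ico] at h
    · exact ha0.ne' h
    · exact ⟨ha0.le, by simpa using ha1⟩
  have hneg : -(a : UnitAddCircle) = ((1 - a : ℝ) : UnitAddCircle) := by
    rw [AddCircle.coe_sub, AddCircle.coe_period, zero_sub]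
  have h := hurwitzZeta_one_sub (a : UnitAddCircle) (s := 1)
    (fun n => by
      intro h
      have : (1 : ℝ) = -n := by exact_mod_cast h
      have hn : (0 : ℝ) ≤ n := n.cast_nonneg
      linarith) (Or.inl hane)
  rw [sub_self] at h
  -- The real parts of the two logarithms are equal, so they cancel in the functional equation and
  -- only the arguments survive.
  have hsin : Real.sin (π * (1 - a)) = Real.sin (π * a) := by
    rw [mul_sub, mul_one, Real.sin_pi_sub]
  rw [h, hneg, expZeta_one ha0 ha1, expZeta_one (by linarith : 0 < 1 - a) (by linarith),
    log_one_sub_exp ha0 ha1, log_one_sub_exp (by linarith : 0 < 1 - a) (by linarith), hsin,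
    Complex.Gamma_one, mul_one, mul_one, mul_one, Complex.cpow_neg_one,
    show (π * I / 2 : ℂ) = π / 2 * I by ring, show (-π * I / 2 : ℂ) = -(π / 2 * I) by ring,
    Complex.exp_neg, Complex.exp_pi_div_two_mul_I, Complex.inv_I]
  have hπ : (π : ℂ) ≠ 0 := by exact_mod_cast Real.pi_ne_zero
  push_cast
  field_simp
  ring_nf
  rw [Complex.I_sq]
  ring

/-- Negative integer values of the Hurwitz zeta function, including the argument `0`. -/
lemma hurwitzZeta_one_sub_nat {k : ℕ} (hk : 1 ≤ k) {x : ℝ} (hx0 : 0 < x) (hx1 : x ≤ 1) :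
    hurwitzZeta x (1 - k) =
      -(((Polynomial.bernoulli k).map (algebraMap ℚ ℂ)).eval (x : ℂ) / k) := by
  by_cases h1 : k = 1
  · subst h1
    rw [Polynomial.bernoulli_one]
    simp only [Nat.cast_one, sub_self, Polynomial.map_sub, Polynomial.map_X, Polynomial.map_C,
      Polynomial.eval_sub, Polynomial.eval_X, Polynomial.eval_C]
    rcases hx1.lt_or_eq with h | rfl
    · rw [hurwitzZeta_apply_zero hx0 h]
      simp
    · have : ((1 : ℝ) : UnitAddCircle) = 0 := AddCircle.coe_period 1
      rw [this, hurwitzZeta_zero, riemannZeta_zero]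
      norm_num
  · obtain ⟨l, rfl⟩ : ∃ l, k = l + 1 := ⟨k - 1, by omega⟩
    have := hurwitzZeta_neg_nat (k := l) (by omega) ⟨hx0.le, hx1⟩
    rw [show (1 - ((l + 1 : ℕ) : ℂ)) = -l by push_cast; ring, this]
    push_cast
    ring

/-- The class 0 is represented by `N` and not by 0, as in `chiBernoulli`. In weight 1 this matters:
`B₁(0) ≠ B₁(1)`, and `B₁(1) = 1/2` is the one matching `ζ(0) = -1/2`. -/
lemma sum_zmod_eq_sum_Icc {N : ℕ} [NeZero N] (f : ZMod N → ℂ) :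
    ∑ j, f j = ∑ a ∈ Finset.Icc 1 N, f (a : ZMod N) := by
  refine Finset.sum_bij' (s := Finset.univ) (t := Finset.Icc 1 N)
    (fun (j : ZMod N) _ => if j = 0 then N else j.val)
    (fun (a : ℕ) _ => (a : ZMod N)) ?_ (fun _ _ => Finset.mem_univ _) ?_ ?_ ?_
  · intro j _
    have := j.val_lt
    split_ifs with h
    · exact Finset.mem_Icc.mpr ⟨NeZero.one_le, le_rfl⟩
    · have := (ZMod.val_pos).mpr h
      rw [Finset.mem_Icc]; omega
  · intro j _
    split_ifs with h
    · simp [h]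
    · simp
  · intro a ha
    obtain ⟨h1, h2⟩ := Finset.mem_Icc.mp ha
    rcases h2.lt_or_eq with h | rfl
    · have : (a : ZMod N).val = a := ZMod.val_cast_of_lt h
      rw [if_neg, this]
      intro h0
      rw [h0, ZMod.val_zero] at this
      omega
    · simp
  · intro j _
    split_ifs with h
    · simp [h]
    · simp

lemma LFunction_one_sub_nat {N : ℕ} [NeZero N] {k : ℕ} (hk : 1 ≤ k) (Φ : ZMod N → ℂ) :
    ZMod.LFunction Φ (1 - k) = -((N : ℂ) ^ (k - 1) * ∑ a ∈ Finset.Icc 1 N, Φ (a : ZMod N) *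
      (((Polynomial.bernoulli k).eval ((a : ℚ) / (N : ℚ)) : ℚ) : ℂ) / k) := by
  have hN : (N : ℂ) ≠ 0 := by exact_mod_cast NeZero.ne N
  rw [ZMod.LFunction, sum_zmod_eq_sum_Icc, neg_sub,
    show (k : ℂ) - 1 = ((k - 1 : ℕ) : ℂ) by push_cast [hk]; ring, Complex.cpow_natCast,
    Finset.mul_sum, Finset.mul_sum, ← Finset.sum_neg_distrib]
  refine Finset.sum_congr rfl fun a ha => ?_
  obtain ⟨ha1, haN⟩ := Finset.mem_Icc.mp ha
  have hNpos : (0 : ℝ) < N := by exact_mod_cast Nat.pos_of_ne_zero (NeZero.ne N)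
  have e : ZMod.toAddCircle (a : ZMod N) = (((a : ℝ) / N : ℝ) : UnitAddCircle) := by
    have := ZMod.toAddCircle_intCast (N := N) (a : ℤ)
    simpa using this
  rw [e, hurwitzZeta_one_sub_nat hk (by positivity)
    (by rw [div_le_one hNpos]; exact_mod_cast haN)]
  have e2 : (((a : ℝ) / N : ℝ) : ℂ) = algebraMap ℚ ℂ ((a : ℚ) / N) := by simp
  rw [e2, Polynomial.eval_map_algebraMap, Polynomial.aeval_algebraMap_apply, ← Polynomial.coe_aeval_eq_eval]
  simp only [eq_ratCast]
  ring

lemma LFunction_eq_chiBernoulli {N : ℕ} [NeZero N] {k : ℕ} (hk : 1 ≤ k)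
    (χ : DirichletCharacter ℂ N) : χ.LFunction (1 - k) = -(chiBernoulli k χ / k) := by
  rw [DirichletCharacter.LFunction, LFunction_one_sub_nat hk, chiBernoulli, ← Finset.sum_div,
    mul_div_assoc]

lemma chiBernoulli_star {N : ℕ} [NeZero N] (k : ℕ) (χ : DirichletCharacter ℂ N) :
    chiBernoulli k (star χ) = starRingEnd ℂ (chiBernoulli k χ) := by
  simp [chiBernoulli, map_sum]

end CuspEisenstein
end

/-! ### Finite Fourier transforms, functional equations and `S_k` -/

noncomputable section
namespace CuspEisenstein
open Filter Topology
open Complex (I exp)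
open HurwitzZeta ZMod
open scoped Real Nat ZMod

/-- The finite Fourier transform with kernel `e(m d / L)`. -/
def fourierSum {L : ℕ} [NeZero L] (f : ZMod L → ℂ) (d : ZMod L) : ℂ :=
  ∑ m, f m * stdAddChar (m * d)

lemma fourierSum_eq_dft {L : ℕ} [NeZero L] (f : ZMod L → ℂ) :
    fourierSum f = 𝓕 fun x => f (-x) := by
  rw [dft_comp_neg]
  ext d
  simp [fourierSum, dft_apply, mul_comm]

lemma fourierSum_neg {L : ℕ} [NeZero L] (f : ZMod L → ℂ) :
    (fun x => fourierSum f (-x)) = 𝓕 f := by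
  ext d
  simp [fourierSum, dft_apply, mul_comm]

lemma LFunction_const_mul {L : ℕ} [NeZero L] (c : ℂ) (f : ZMod L → ℂ) (s : ℂ) :
    LFunction (fun x => c * f x) s = c * LFunction f s := by
  simp only [LFunction, Finset.mul_sum]
  exact Finset.sum_congr rfl fun _ _ => by ring

lemma exp_pi_mul_I_mul_natCast_div_two (k : ℕ) : exp (π * I * k / 2) = I ^ k := by
  rw [show (π * I * k / 2 : ℂ) = k * (π / 2 * I) by ring, Complex.exp_nat_mul,
    Complex.exp_pi_div_two_mul_I]

lemma exp_neg_pi_mul_I_mul_natCast_div_two (k : ℕ) : exp (-π * I * k / 2) = (-I) ^ k := by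
  rw [show (-π * I * k / 2 : ℂ) = k * (-(π / 2 * I)) by ring, Complex.exp_nat_mul,
    Complex.exp_neg, Complex.exp_pi_div_two_mul_I, Complex.inv_I]

lemma Gamma_natCast {k : ℕ} (hk : 1 ≤ k) : Complex.Gamma k = (k - 1)! := by
  obtain ⟨l, rfl⟩ : ∃ l, k = l + 1 := ⟨k - 1, by omega⟩
  simpa using Complex.Gamma_nat_eq_factorial l

lemma natCast_ne_neg {k : ℕ} (hk : 1 ≤ k) (n : ℕ) : (k : ℂ) ≠ -n := by
  intro h
  have : (k : ℝ) = -n := by exact_mod_cast h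
  have hn : (0 : ℝ) ≤ n := n.cast_nonneg
  have : (1 : ℝ) ≤ k := by exact_mod_cast hk
  linarith

/-- The functional equation at `1 - k` for functions of the parity of `k`. -/
lemma LFunction_fourierSum {L : ℕ} [NeZero L] {k : ℕ} (hk : 1 ≤ k) {f : ZMod L → ℂ}
    (hf : ∀ x, f (-x) = (-1) ^ k * f x) :
    LFunction (fourierSum f) (1 - k) =
      2 * I ^ k * (L : ℂ) ^ k * ((2 * π : ℂ) ^ k)⁻¹ * (k - 1)! * LFunction f k := by
  have hL : (L : ℂ) ≠ 0 := by exact_mod_cast NeZero.ne L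
  have h1 : 𝓕 (fourierSum f) = fun x => (L : ℂ) * f x := by
    rw [fourierSum_eq_dft, dft_dft]; simp
  have h2 : (𝓕 fun x => fourierSum f (-x)) = fun x => ((L : ℂ) * (-1) ^ k) * f x := by
    rw [fourierSum_neg, dft_dft]
    ext x
    simp [hf, mul_assoc]
  rw [LFunction_one_sub _ (natCast_ne_neg hk), h1, h2, LFunction_const_mul, LFunction_const_mul,
    exp_pi_mul_I_mul_natCast_div_two, exp_neg_pi_mul_I_mul_natCast_div_two, Gamma_natCast hk,
    Complex.cpow_neg, Complex.cpow_natCast, Complex.cpow_sub _ _ hL, Complex.cpow_one,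
    Complex.cpow_natCast]
  · have : (-I) ^ k * (-1) ^ k = I ^ k := by rw [← mul_pow]; simp
    field_simp
    linear_combination ((k - 1)! : ℂ) * LFunction f k * this
  -- For `k = 1` the functional equation is used at the possible pole `s = 1`, so `fourierSum f` has
  -- to vanish at 0; it does, since `f` is then odd.
  · rcases eq_or_ne k 1 with rfl | h
    · left
      have : 𝓕 (fun x => f (-x)) 0 = 0 := by
        rw [dft_apply_zero]
        have : ∑ x, f (-x) = ∑ x, f x := Equiv.sum_comp (Equiv.neg (ZMod L)) f
        have h' : ∑ x, f (-x) = - ∑ x, f x := by simp [hf]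
        have := this.symm.trans h'
        rw [h']
        linear_combination (-1 / 2 : ℂ) * this
      rw [fourierSum_eq_dft, this]
    · right; exact_mod_cast h

lemma fourierSum_eq_gauss {N : ℕ} [NeZero N] {ψ : DirichletCharacter ℂ N} (hψ : ψ.IsPrimitive)
    (d : ZMod N) : fourierSum ψ d = star ψ d * gauss ψ := by
  have := gaussSum_mulShift_of_isPrimitive stdAddChar hψ d
  rw [← MulChar.star_eq_inv] at this
  rw [gauss, ← this]
  simp [fourierSum, gaussSum, AddChar.mulShift_apply, mul_comm]

lemma changeLevel_neg_one {M L : ℕ} (h : M ∣ L) (χ : DirichletCharacter ℂ M) :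
    DirichletCharacter.changeLevel h χ (-1) = χ (-1) := by
  have := DirichletCharacter.changeLevel_eq_cast_of_dvd χ h (-1 : (ZMod L)ˣ)
  simpa [ZMod.cast_neg h, ZMod.cast_one h] using this

lemma apply_neg {N : ℕ} (χ : DirichletCharacter ℂ N) {c : ℂ} (h : χ (-1) = c) (x : ZMod N) :
    χ (-x) = c * χ x := by
  rw [← h, ← map_mul, neg_one_mul]

/-- The functional equation at level `L` leads to the L-value at `k`, which differs from that of the
primitive character by Euler factors. The functional equation of the primitive character leads back
to `1 - k`, where a Gauss sum and a Bernoulli number appear. Equality of the sets of primes makes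
the Euler factors those of `S k χ`. -/
lemma LFunction_fourierSum_changeLevel {M L : ℕ} [NeZero M] [NeZero L] {k : ℕ} (hk : 1 ≤ k)
    (h : M ∣ L) (hp : M.primeFactors = L.primeFactors) (χ : DirichletCharacter ℂ M)
    (hχ : χ (-1) = (-1) ^ k) :
    LFunction (fourierSum (DirichletCharacter.changeLevel h χ)) (1 - k) =
      -((L / M : ℂ) ^ k * S k χ) := by
  have hL : (L : ℂ) ≠ 0 := by exact_mod_cast NeZero.ne L
  have hM : (M : ℂ) ≠ 0 := by exact_mod_cast NeZero.ne M
  have hc : (χ.conductor : ℂ) ≠ 0 := by exact_mod_cast NeZero.ne χ.conductor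
  set ψ := χ.primitiveCharacter with hψ
  have e1 : χ = DirichletCharacter.changeLevel χ.conductor_dvd_level ψ :=
    χ.changeLevel_primitiveCharacter.symm
  have e2 : DirichletCharacter.changeLevel h χ =
      DirichletCharacter.changeLevel (χ.conductor_dvd_level.trans h) ψ := by
    rw [DirichletCharacter.changeLevel_trans _ χ.conductor_dvd_level h, ← e1]
  have hψ1 : ψ (-1) = (-1) ^ k := by
    rw [← changeLevel_neg_one χ.conductor_dvd_level, ← e1, hχ]
  have h1 := LFunction_fourierSum hk (f := ψ) (apply_neg ψ hψ1)
  have h2 := LFunction_fourierSum hk (f := DirichletCharacter.changeLevel h χ)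
    (apply_neg _ (by rw [changeLevel_neg_one, hχ]))
  have h3 : LFunction (DirichletCharacter.changeLevel h χ) k =
      LFunction ψ k * ∏ p ∈ L.primeFactors, (1 - ψ p * (p : ℂ) ^ (-(k : ℂ))) := by
    rw [e2]
    refine DirichletCharacter.LFunction_changeLevel _ ψ ?_
    rcases eq_or_ne k 1 with rfl | h'
    · left
      intro h0
      rw [h0] at hψ1
      norm_num [MulChar.one_apply] at hψ1
    · right; exact_mod_cast h'
  have h4 : LFunction (fourierSum ψ) (1 - k) =
      -(gauss ψ * (starRingEnd ℂ (chiBernoulli k ψ) / k)) := by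
    have : fourierSum ψ = fun d => gauss ψ * star ψ d := by
      ext d; rw [fourierSum_eq_gauss χ.primitiveCharacter_isPrimitive, mul_comm]
    rw [this, LFunction_const_mul]
    have := LFunction_eq_chiBernoulli hk (star ψ)
    rw [DirichletCharacter.LFunction, chiBernoulli_star] at this
    rw [this]; ring
  rw [h4] at h1
  rw [h2, h3, S, hp]
  have h5 : ∏ p ∈ L.primeFactors, (1 - ψ p * (p : ℂ) ^ (-(k : ℂ))) =
      ∏ p ∈ L.primeFactors, (1 - ψ p / (p : ℂ) ^ k) := by
    refine Finset.prod_congr rfl fun p _ => ?_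
    rw [Complex.cpow_neg, Complex.cpow_natCast, div_eq_mul_inv]
  rw [h5, ← hψ]
  generalize ∏ p ∈ L.primeFactors, (1 - ψ p / (p : ℂ) ^ k) = P at *
  have h6 : (L : ℂ) ^ k = (L / M : ℂ) ^ k * ((M : ℂ) / χ.conductor) ^ k * (χ.conductor : ℂ) ^ k := by
    rw [← mul_pow, ← mul_pow]; field_simp
  rw [h6]
  linear_combination (-(L / M : ℂ) ^ k * ((M : ℂ) / χ.conductor) ^ k * P) * h1

/-- By primitivity the Fourier transform of `ψ` is a multiple of its Gauss sum; if that were 0,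
injectivity of the transform would give `ψ = 0`. -/
lemma gauss_ne_zero {N : ℕ} [NeZero N] {ψ : DirichletCharacter ℂ N} (hψ : ψ.IsPrimitive) :
    gauss ψ ≠ 0 := by
  intro h0
  have h : 𝓕 (fun x => ψ (-x)) = 0 := by
    rw [← fourierSum_eq_dft]
    ext d
    rw [fourierSum_eq_gauss hψ, h0, mul_zero]; rfl
  have h' := congrFun ((map_eq_zero_iff _ (dft (N := N) (E := ℂ)).injective).mp h) (-1)
  simp at h'

lemma isPrimitive_star {N : ℕ} [NeZero N] {χ : DirichletCharacter ℂ N} (h : χ.IsPrimitive) :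
    (star χ).IsPrimitive := by
  rw [DirichletCharacter.isPrimitive_def, MulChar.star_eq_inv, DirichletCharacter.conductor_inv]
  exact h

lemma lsum_eq_hurwitzZeta {k : ℕ} (hk : 2 ≤ k) {x : ℝ} (hx0 : 0 ≤ x) (hx1 : x ≤ 1) :
    lsum k x = hurwitzZeta x k + (-1) ^ k * hurwitzZeta (-(x : UnitAddCircle)) k := by
  have hre : 1 < (k : ℂ).re := by rw [Complex.natCast_re]; exact_mod_cast hk
  have hneg : -(x : UnitAddCircle) = ((1 - x : ℝ) : UnitAddCircle) := by
    rw [AddCircle.coe_sub, AddCircle.coe_period, zero_sub]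
  have h1 := hasSum_hurwitzZeta_of_one_lt_re (a := x) ⟨hx0, hx1⟩ hre
  have h2 := hasSum_hurwitzZeta_of_one_lt_re (a := 1 - x) ⟨by linarith, by linarith⟩ hre
  rw [← hneg] at h2
  refine (hasSum_lsum hk x).unique (HasSum.of_nat_of_neg_add_one (f := fun n : ℤ => 1 / ((x : ℂ) + n) ^ k) ?_ ?_)
  · refine h1.congr_fun fun n => ?_
    rw [Complex.cpow_natCast, add_comm]; simp
  · refine (h2.mul_left ((-1) ^ k)).congr_fun fun n => ?_
    rw [Complex.cpow_natCast]
    push_cast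
    rw [show (x : ℂ) + -(n + 1) = (-1) * (n + (1 - x)) by ring, mul_pow]
    rcases neg_one_pow_eq_or ℂ k with h | h <;> rw [h] <;> simp [div_eq_mul_inv, inv_neg]

lemma lsum_eq_expZeta {k : ℕ} (hk : 2 ≤ k) {x : ℝ} (hx0 : 0 ≤ x) (hx1 : x ≤ 1) :
    lsum k x = (-2 * π * I) ^ k / (k - 1)! * expZeta x (1 - k) := by
  have hπ : (π : ℂ) ≠ 0 := by exact_mod_cast Real.pi_ne_zero
  have hf : ((k - 1)! : ℂ) ≠ 0 := by exact_mod_cast Nat.factorial_ne_zero _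
  have hk' (n : ℕ) : (k : ℂ) ≠ 1 - n := by
    intro h
    have h : (k : ℂ) + n = 1 := by rw [h]; ring
    have : k + n = 1 := by exact_mod_cast h
    omega
  rw [expZeta_one_sub _ hk', exp_pi_mul_I_mul_natCast_div_two,
    exp_neg_pi_mul_I_mul_natCast_div_two, Gamma_natCast (by omega), Complex.cpow_neg,
    Complex.cpow_natCast, lsum_eq_hurwitzZeta hk hx0 hx1]
  have e1 : (-2 * π * I : ℂ) ^ k = (2 * π) ^ k * (-I) ^ k := by rw [← mul_pow]; ring
  have e2 : (-I) ^ k * I ^ k = 1 := by rw [← mul_pow]; simp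
  have e3 : (-I) ^ k * (-I) ^ k = (-1) ^ k := by rw [← mul_pow]; simp
  have h2 : (2 * π : ℂ) ^ k ≠ 0 := pow_ne_zero _ (mul_ne_zero two_ne_zero hπ)
  rw [e1]
  generalize (2 * π : ℂ) ^ k = c at *
  field_simp
  linear_combination (-hurwitzZeta x k) * e2 - hurwitzZeta (-(x : UnitAddCircle)) k * e3

lemma stdAddChar_natCast {L : ℕ} [NeZero L] (n : ℕ) :
    stdAddChar (n : ZMod L) = exp (2 * π * I * (n / L)) := by
  have := stdAddChar_coe (N := L) n
  rw [Int.cast_natCast, Int.cast_natCast] at this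
  rw [this]; congr 1; ring

lemma stdAddChar_eq_exp {L : ℕ} [NeZero L] (s : ZMod L) :
    stdAddChar s = exp (2 * π * I * (s.val / L)) := by
  rw [← stdAddChar_natCast, ZMod.natCast_zmod_val]

lemma sum_Icc_mul_pow {N : ℕ} {ζ : ℂ} (h : ζ ^ N = 1) (h1 : ζ ≠ 1) :
    ∑ a ∈ Finset.Icc 1 N, (a : ℂ) * ζ ^ a = N * ζ / (ζ - 1) := by
  have key (n : ℕ) : ∑ a ∈ Finset.Icc 1 n, (a : ℂ) * ζ ^ a * (ζ - 1) ^ 2 =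
      (n * ζ ^ (n + 1)) * (ζ - 1) - (ζ ^ n - 1) * ζ := by
    induction n with
    | zero => simp
    | succ n ih => rw [Finset.sum_Icc_succ_top (by omega), ih]; push_cast; ring
  have h2 := key N
  rw [← Finset.sum_mul, pow_succ ζ N, h] at h2
  have h3 : ζ - 1 ≠ 0 := sub_ne_zero.mpr h1
  rw [eq_div_iff h3]
  refine mul_right_cancel₀ h3 ?_
  linear_combination h2

/-- The values of `lsum` at torsion points are Fourier dual to the values at `1 - k` of congruence
zeta functions. -/
lemma sum_mul_lsum {L : ℕ} [NeZero L] {k : ℕ} (hk : 1 ≤ k) {f : ZMod L → ℂ}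
    (hf : ∀ x, f (-x) = (-1) ^ k * f x) :
    ∑ s, f s * lsum k ((s.val / L : ℝ) : ℂ) =
      (-2 * π * I) ^ k / (k - 1)! * LFunction (fourierSum f) (1 - k) := by
  have hL : (L : ℂ) ≠ 0 := by exact_mod_cast NeZero.ne L
  have hLpos : (0 : ℝ) < L := by exact_mod_cast Nat.pos_of_ne_zero (NeZero.ne L)
  rcases eq_or_ne k 1 with rfl | h1
  · have hf0 : f 0 = 0 := by
      have := hf 0
      simp only [neg_zero, pow_one] at this
      linear_combination (1 / 2 : ℂ) * this
    have hfs : ∑ s, f s = 0 := by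
      have h : ∑ x, f (-x) = ∑ x, f x := Equiv.sum_comp (Equiv.neg (ZMod L)) f
      simp only [hf, ← Finset.mul_sum] at h
      linear_combination (-1 / 2 : ℂ) * h
    rw [LFunction_one_sub_nat le_rfl]
    simp only [fourierSum, Finset.sum_mul, Nat.cast_one, div_one]
    rw [Finset.sum_comm]
    -- This is the finite expansion of the cotangent in sawtooth values. The extra `πi f(s)`
    -- disappears on summation over `s` because `f` is odd.
    have key (s : ZMod L) : f s * lsum 1 ((s.val / L : ℝ) : ℂ) + π * I * f s =
        2 * π * I * ∑ a ∈ Finset.Icc 1 L, f s * stdAddChar (s * (a : ZMod L)) *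
          (((Polynomial.bernoulli 1).eval ((a : ℚ) / (L : ℚ)) : ℚ) : ℂ) := by
      by_cases hs : s = 0
      · simp [hs, hf0]
      have hpow (a : ℕ) : stdAddChar (s * (a : ZMod L)) = (stdAddChar s : ℂ) ^ a := by
        rw [← AddChar.map_nsmul_eq_pow, nsmul_eq_mul, mul_comm]
      have hζL : (stdAddChar s : ℂ) ^ L = 1 := by rw [← hpow]; simp
      have hζ1 : (stdAddChar s : ℂ) ≠ 1 := by
        rw [← AddChar.map_zero_eq_one (stdAddChar (N := L))]
        exact fun h => hs (injective_stdAddChar h)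
      have hgeom : ∑ a ∈ Finset.Icc 1 L, (stdAddChar s : ℂ) ^ a = 0 := by
        have h := geom_sum_eq hζ1 L
        rw [hζL, sub_self, zero_div] at h
        have h' := Finset.sum_range_succ (fun a => (stdAddChar s : ℂ) ^ a) L
        rw [Finset.sum_range_succ', h, hζL] at h'
        simp only [pow_zero, zero_add] at h'
        rw [Finset.range_eq_Ico, Finset.sum_Ico_add' (fun a => (stdAddChar s : ℂ) ^ a) 0 L 1] at h'
        simpa [← Finset.Ico_succ_right_eq_Icc] using h'
      have hB (a : ℕ) : (((Polynomial.bernoulli 1).eval ((a : ℚ) / (L : ℚ)) : ℚ) : ℂ) =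
          a / L - 1 / 2 := by
        rw [Polynomial.bernoulli_one]; simp
      have e : ∑ a ∈ Finset.Icc 1 L, f s * stdAddChar (s * (a : ZMod L)) *
          (((Polynomial.bernoulli 1).eval ((a : ℚ) / (L : ℚ)) : ℚ) : ℂ) =
          f s / L * ∑ a ∈ Finset.Icc 1 L, (a : ℂ) * (stdAddChar s : ℂ) ^ a -
            f s / 2 * ∑ a ∈ Finset.Icc 1 L, (stdAddChar s : ℂ) ^ a := by
        rw [Finset.mul_sum, Finset.mul_sum, ← Finset.sum_sub_distrib]
        refine Finset.sum_congr rfl fun a _ => ?_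
        rw [hB, hpow]; ring
      rw [e, hgeom, sum_Icc_mul_pow hζL hζ1, lsum_one, Complex.cot_eq_exp_ratio]
      have h3 : (stdAddChar s : ℂ) - 1 ≠ 0 := sub_ne_zero.mpr hζ1
      have h4 : exp (2 * I * (π * ((s.val / L : ℝ) : ℂ))) = stdAddChar s := by
        rw [stdAddChar_eq_exp]; congr 1; push_cast; ring
      rw [h4]
      have h5 : 1 - (stdAddChar s : ℂ) ≠ 0 := by
        rw [← neg_sub]; exact neg_ne_zero.mpr h3
      have h6 : I * (1 - (stdAddChar s : ℂ)) ≠ 0 := mul_ne_zero Complex.I_ne_zero h5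
      have h7 : ((stdAddChar s : ℂ) + 1) / (I * (1 - stdAddChar s)) =
          I * (stdAddChar s + 1) / (stdAddChar s - 1) := by
        rw [div_eq_div_iff h6 h3]
        linear_combination ((stdAddChar s : ℂ) + 1) * (stdAddChar s - 1) * Complex.I_sq
      rw [h7]
      field_simp
      ring
    have hsum := Finset.sum_congr rfl fun s (_ : s ∈ Finset.univ) => key s
    rw [Finset.sum_add_distrib, ← Finset.mul_sum, ← Finset.mul_sum, hfs] at hsum
    simp only [mul_zero, add_zero] at hsum
    rw [hsum]
    simp
  · have hk2 : 2 ≤ k := by omega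
    rw [fourierSum_eq_dft, LFunction_dft _ (Or.inr _), ← Equiv.sum_comp (Equiv.neg (ZMod L)),
      Finset.mul_sum]
    · refine Finset.sum_congr rfl fun s _ => ?_
      have hs : ((-s).val : ℝ) ≤ L := by exact_mod_cast (-s).val_lt.le
      rw [Equiv.neg_apply, lsum_eq_expZeta hk2 (by positivity)
        ((div_le_one hLpos).mpr hs), toAddCircle_apply]
      ring
    · intro h
      have : (k : ℂ) = 0 := by linear_combination -h
      norm_cast at this
      omega

end CuspEisenstein
end

/-! ### Eisenstein series with periodic coefficients -/

noncomputable section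
namespace CuspEisenstein
open Filter Topology
open UpperHalfPlane hiding I
open Complex (I exp)
open ZMod
open scoped Real Nat ZMod

/-- A term of the double series of an Eisenstein series with coefficients periodic modulo `L`. -/
def eisTerm {L : ℕ} (k : ℕ) (Φ : ZMod L → ZMod L → ℂ) (τ : ℂ) (p : ℕ+ × ℕ+) : ℂ :=
  (p.1 : ℂ) ^ (k - 1) * Φ (p.1 : ℕ) (p.2 : ℕ) * exp (2 * π * I * (p.1 * p.2 * τ / L))

/-- The Eisenstein series with coefficients `Φ` periodic modulo `L`. -/
def eis {L : ℕ} [NeZero L] (k : ℕ) (Φ : ZMod L → ZMod L → ℂ) (τ : ℂ) : ℂ :=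
  LFunction (fun d => Φ d 0) (1 - k) + (if k = 1 then LFunction (Φ 0) 0 else 0) +
    2 * ∑' p : ℕ+ × ℕ+, eisTerm k Φ τ p

lemma summable_eisTerm {L : ℕ} [NeZero L] (k : ℕ) (Φ : ZMod L → ZMod L → ℂ) {τ : ℂ}
    (hτ : 0 < τ.im) : Summable (eisTerm k Φ τ) := by
  have hL : (0 : ℝ) < L := by exact_mod_cast Nat.pos_of_ne_zero (NeZero.ne L)
  obtain ⟨M, hM⟩ := Finite.exists_le fun p : ZMod L × ZMod L => ‖Φ p.1 p.2‖
  have hr := exp_neg_lt_one (div_pos hτ hL)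
  have hs := (summable_prod_mul_pow (𝕜 := ℝ) (k - 1) (r := Real.exp (-2 * π * (τ.im / L)))
    (by rwa [Real.norm_of_nonneg (Real.exp_nonneg _)])).prod_symm.mul_left M
  refine hs.of_norm_bounded fun p => ?_
  have e : ‖exp (2 * π * I * (p.1 * p.2 * τ / L))‖ =
      Real.exp (-2 * π * (τ.im / L)) ^ (p.2 * p.1 : ℕ) := by
    rw [norm_exp_two_pi_I, ← Real.exp_nat_mul]
    congr 1
    have : ((p.1 : ℂ) * p.2 * τ / L).im = (p.1 : ℝ) * p.2 * (τ.im / L) := by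
      rw [show ((p.1 : ℂ) * p.2 * τ / L) = (((p.1 : ℝ) * p.2 / L : ℝ) : ℂ) * τ by push_cast; ring,
        Complex.im_ofReal_mul]
      ring
    rw [this]
    push_cast
    ring
  rw [eisTerm, norm_mul, norm_mul, e, norm_pow, Complex.norm_natCast]
  have := hM ((p.1 : ℕ), (p.2 : ℕ))
  have h0 : (0 : ℝ) ≤ (p.1 : ℝ) ^ (k - 1) * Real.exp (-2 * π * (τ.im / L)) ^ (p.2 * p.1 : ℕ) := by
    positivity
  simp only [Prod.fst_swap, Prod.snd_swap]
  nlinarith [mul_le_mul_of_nonneg_right this h0]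

/-- A series over `ℤ` is the sum of its parts in the residue classes. -/
lemma hasSum_int_of_residues (L : ℕ) [NeZero L] {u : ℤ → ℂ} {S : ZMod L → ℂ}
    (h : ∀ r : ZMod L, HasSum (fun i : ℤ => u (r.val + L * i)) (S r)) :
    HasSum u (∑ r, S r) := by
  have hL : (L : ℤ) ≠ 0 := by exact_mod_cast NeZero.ne L
  have h1 (r : ZMod L) : HasSum (fun n : ℤ => if (n : ZMod L) = r then u n else 0) (S r) := by
    have hinj : Function.Injective fun i : ℤ => (r.val : ℤ) + L * i := by
      intro i j hij
      exact mul_left_cancel₀ hL (add_left_cancel hij)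
    refine (hinj.hasSum_iff fun n hn => ?_).mp ((h r).congr_fun fun i => ?_)
    · rw [if_neg]
      intro hr
      refine hn ?_
      have : ((r.val : ℤ) : ZMod L) = (n : ZMod L) := by simp [hr]
      obtain ⟨i, hi⟩ := (ZMod.intCast_eq_intCast_iff_dvd_sub _ _ _).mp this
      exact ⟨i, by simp only; omega⟩
    · simp
  have h2 := hasSum_sum (s := Finset.univ) fun r _ => h1 r
  refine h2.congr_fun fun n => ?_
  simp

/-- The contribution of the rows in a residue class. -/
def rowPairing {L : ℕ} [NeZero L] (k : ℕ) (θ : ZMod L → ZMod L → ℂ) (τ : ℂ) (n : ℤ) : ℂ :=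
  ∑ s, θ n s * row k τ (n / L) (s.val / L)

variable {L : ℕ} [NeZero L] {k : ℕ} {θ : ZMod L → ZMod L → ℂ}

lemma exists_val_neg_div (s : ZMod L) :
    ∃ m : ℤ, ((-s).val / L : ℝ) = -(s.val / L : ℝ) + m := by
  have hL : (L : ℝ) ≠ 0 := by exact_mod_cast NeZero.ne L
  have : (((-s).val : ℤ) : ZMod L) = ((-(s.val : ℤ) : ℤ) : ZMod L) := by simp
  obtain ⟨i, hi⟩ := (ZMod.intCast_eq_intCast_iff_dvd_sub _ _ _).mp this
  have hi' : -(s.val : ℝ) - (-s).val = L * i := by exact_mod_cast hi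
  refine ⟨-i, ?_⟩
  push_cast
  field_simp
  linarith

lemma row_neg (k : ℕ) (τ : ℂ) (x b : ℝ) (hx : x ≠ 0) :
    row k τ (-x) (-b) = (-1) ^ k * row k τ x b := by
  have h1 : (-1 : ℂ) ^ k * (-1) ^ k = 1 := by rw [← mul_pow]; simp
  rcases lt_or_gt_of_ne hx with h | h
  · rw [row, if_pos (by linarith), row, if_neg (by linarith), if_pos h, ← mul_assoc, h1]
    push_cast
    ring_nf
  · rw [row, if_neg (by linarith), if_pos (by linarith), row, if_pos h]
    push_cast
    ring_nf

lemma rowPairing_neg (hθ : ∀ x m, θ (-x) (-m) = (-1) ^ k * θ x m) (τ : ℂ) (n : ℤ) :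
    rowPairing k θ τ (-n) = rowPairing k θ τ n := by
  have h1 : (-1 : ℂ) ^ k * (-1) ^ k = 1 := by rw [← mul_pow]; simp
  rcases eq_or_ne n 0 with rfl | hn
  · simp
  have hL : (L : ℝ) ≠ 0 := by exact_mod_cast NeZero.ne L
  have hx : (n / L : ℝ) ≠ 0 := div_ne_zero (by exact_mod_cast hn) hL
  rw [rowPairing, ← Equiv.sum_comp (Equiv.neg (ZMod L))]
  refine Finset.sum_congr rfl fun s _ => ?_
  obtain ⟨m, hm⟩ := exists_val_neg_div s
  rw [Equiv.neg_apply, hm, row_add_int]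
  push_cast
  rw [hθ, neg_div, row_neg _ _ _ _ hx]
  linear_combination θ n s * row k τ (n / L) (s.val / L) * h1

lemma rowPairing_zero (hk : 1 ≤ k) (hθ : ∀ x m, θ (-x) (-m) = (-1) ^ k * θ x m) (τ : ℂ) :
    rowPairing k θ τ 0 = (-2 * π * I) ^ k / (k - 1)! * LFunction (fourierSum (θ 0)) (1 - k) := by
  rw [← sum_mul_lsum hk fun x => by simpa using hθ 0 x]
  simp [rowPairing, row]

/-- In the Lipschitz series of the row `x`, the shift by `s/L` enters only through `e(ds/L)`;
summation over `s` against `θ` produces the Fourier transform in the second variable. -/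
lemma rowPairing_pnat {τ : ℂ} (hτ : 0 < τ.im) (x : ℕ+) :
    rowPairing k θ τ x = (-2 * π * I) ^ k / (k - 1)! *
      ∑' d : ℕ+, eisTerm k (fun d x => fourierSum (θ x) d) τ (d, x) := by
  have hL : (0 : ℝ) < L := by exact_mod_cast Nat.pos_of_ne_zero (NeZero.ne L)
  have hx : (0 : ℝ) < ((x : ℕ) : ℤ) / L := div_pos (by exact_mod_cast x.pos) hL
  have hs (s : ZMod L) : Summable fun d : ℕ+ => θ x s * ((d : ℂ) ^ (k - 1) *
      exp (2 * π * I * (((((x : ℕ) : ℤ) / L : ℝ) : ℂ) * τ + ((s.val / L : ℝ) : ℂ))) ^ (d : ℕ)) := by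
    refine Summable.mul_left _ (Summable.of_norm ?_)
    simp only [norm_mul, norm_pow, Complex.norm_natCast, norm_exp_two_pi_I]
    refine summable_pnat_pow_mul_pow _ (Real.exp_nonneg _) (exp_neg_lt_one ?_)
    rw [Complex.add_im, Complex.im_ofReal_mul, Complex.ofReal_im, add_zero]
    positivity
  have key (s : ZMod L) : θ x s * row k τ (((x : ℕ) : ℤ) / L) (s.val / L) =
      (-2 * π * I) ^ k / (k - 1)! * ∑' d : ℕ+, θ x s * ((d : ℂ) ^ (k - 1) *
      exp (2 * π * I * (((((x : ℕ) : ℤ) / L : ℝ) : ℂ) * τ + ((s.val / L : ℝ) : ℂ))) ^ (d : ℕ)) := by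
    rw [row, if_pos hx, lip, tsum_mul_left]
    ring
  rw [rowPairing]
  simp only [Int.cast_natCast] at key hs ⊢
  rw [Finset.sum_congr rfl fun s _ => key s, ← Finset.mul_sum, ← Summable.tsum_finsetSum fun s _ => hs s]
  congr 1
  refine tsum_congr fun d => ?_
  rw [eisTerm, fourierSum, Finset.mul_sum, Finset.sum_mul]
  refine Finset.sum_congr rfl fun s _ => ?_
  rw [← Complex.exp_nat_mul]
  have e : (stdAddChar (s * ((d : ℕ) : ZMod L)) : ℂ) = exp (d * (2 * π * I * (s.val / L))) := by
    rw [mul_comm, ← nsmul_eq_mul, AddChar.map_nsmul_eq_pow, stdAddChar_eq_exp, Complex.exp_nat_mul]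
  have e2 : exp (d * (2 * π * I * ((((x : ℕ) / L : ℝ) : ℂ) * τ + ((s.val / L : ℝ) : ℂ)))) =
      exp (d * (2 * π * I * (s.val / L))) * exp (2 * π * I * (d * x * τ / L)) := by
    rw [← Complex.exp_add]
    congr 1
    push_cast
    ring
  rw [e, e2]
  ring

/-- Rows `n` and `-n` contribute equally by parity, which explains the 2 in `eis`. The row 0 gives
the first constant term through `sum_mul_lsum`, and in weight 1 the correction in `rowSumReg`,
essentially `B₁(r/L)`, gives the second. -/
lemma sum_rowSumReg (hk : 1 ≤ k) (hθ : ∀ x m, θ (-x) (-m) = (-1) ^ k * θ x m) (τ : ℍ) :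
    ∑ r, ∑ s, θ r s * rowSumReg k τ (r.val / L) (s.val / L) =
      (-2 * π * I) ^ k / (k - 1)! * eis k (fun d x => fourierSum (θ x) d) τ := by
  have hL : (0 : ℝ) < L := by exact_mod_cast Nat.pos_of_ne_zero (NeZero.ne L)
  have hsum : HasSum (rowPairing k θ τ)
      (∑ r, ∑ s, θ r s * rowSum k τ (r.val / L) (s.val / L)) := by
    refine hasSum_int_of_residues L fun r => ?_
    have hr : (r.val / L : ℝ) < 1 := by
      rw [div_lt_one hL]; exact_mod_cast r.val_lt
    have h := hasSum_sum (s := Finset.univ) fun (s : ZMod L) _ =>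
      ((summable_row k τ (by positivity) hr (s.val / L)).hasSum).mul_left (θ r s)
    refine h.congr_fun fun i => ?_
    rw [rowPairing]
    refine Finset.sum_congr rfl fun s _ => ?_
    congr 2
    · simp
    · push_cast
      field_simp
  have hE := summable_eisTerm k (fun d x => fourierSum (θ x) d) τ.im_pos
  have hT := tsum_int_eq_zero_add_two_mul_tsum_pnat
    (fun n => rowPairing_neg hθ τ n) hsum.summable
  have hP : ∑' n : ℕ+, rowPairing k θ τ n = (-2 * π * I) ^ k / (k - 1)! *
      ∑' p, eisTerm k (fun d x => fourierSum (θ x) d) τ p := by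
    rw [← (Equiv.prodComm ℕ+ ℕ+).tsum_eq, ← tsum_mul_left]
    refine Eq.trans ?_ (((Equiv.prodComm ℕ+ ℕ+).summable_iff.mpr hE).mul_left _).tsum_prod.symm
    refine tsum_congr fun x => ?_
    rw [rowPairing_pnat τ.im_pos, tsum_mul_left]
    rfl
  rw [hsum.tsum_eq, rowPairing_zero hk hθ, hP] at hT
  have hreg : ∑ r, ∑ s, θ r s * (if k = 1 then
      2 * π * I * (((r.val / L : ℝ) : ℂ) - if 0 < (r.val / L : ℝ) then 1 / 2 else 0) else 0 : ℂ) =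
      (-2 * π * I) ^ k / (k - 1)! *
        if k = 1 then LFunction (fun x => fourierSum (θ x) 0) 0 else 0 := by
    split_ifs with h1
    · subst h1
      have hφ (x : ZMod L) : fourierSum (θ x) 0 = ∑ s, θ x s := by simp [fourierSum]
      -- At the class 0 the correction in `rowSumReg` is 0 while `B₁(1) = 1/2`; the mismatch is
      -- harmless because the coefficient there vanishes by parity.
      have h0 : fourierSum (θ 0) 0 = 0 := by
        have h : ∑ s, θ 0 (-s) = ∑ s, θ 0 s := Equiv.sum_comp (Equiv.neg (ZMod L)) (θ 0)
        have h' (s : ZMod L) : θ 0 (-s) = - θ 0 s := by simpa using hθ 0 s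
        simp only [h', Finset.sum_neg_distrib] at h
        rw [hφ]
        linear_combination (-1 / 2 : ℂ) * h
      have hLF := LFunction_one_sub_nat le_rfl fun x : ZMod L => fourierSum (θ x) 0
      have hsum' : ∑ a ∈ Finset.Icc 1 L, fourierSum (θ (a : ZMod L)) 0 *
          (((Polynomial.bernoulli 1).eval ((a : ℚ) / (L : ℚ)) : ℚ) : ℂ) =
          ∑ r : ZMod L, fourierSum (θ r) 0 * ((r.val : ℂ) / L - 1 / 2) := by
        rw [sum_zmod_eq_sum_Icc]
        refine Finset.sum_congr rfl fun a ha => ?_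
        obtain ⟨ha1, ha2⟩ := Finset.mem_Icc.mp ha
        rcases ha2.lt_or_eq with h | rfl
        · rw [ZMod.val_cast_of_lt h, Polynomial.bernoulli_one]
          simp
        · simp [h0]
      simp only [Nat.cast_one, sub_self, div_one] at hLF
      rw [hLF, hsum']
      simp only [← Finset.sum_mul, pow_one, Nat.sub_self, Nat.factorial_zero, Nat.cast_one, div_one,
        mul_neg, neg_mul, Finset.mul_sum, ← Finset.sum_neg_distrib, neg_neg]
      refine Finset.sum_congr rfl fun r _ => ?_
      rw [hφ]
      by_cases hr : r = 0
      · rw [hr, ← hφ, h0]; simp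
      · have : 0 < (r.val / L : ℝ) := div_pos (by exact_mod_cast ZMod.val_pos.mpr hr) hL
        rw [if_pos this]
        push_cast
        ring
    · simp
  simp only [rowSumReg, mul_add, Finset.sum_add_distrib, eis]
  rw [hT, hreg]
  ring

/-- Transformation of the Eisenstein series attached to a function on `(ℤ/L)²` under `τ ↦ -1/τ`,
which exchanges the two variables. -/
theorem eis_neg_inv (hk : 1 ≤ k) (hθ : ∀ x m, θ (-x) (-m) = (-1) ^ k * θ x m)
    (h2 : k = 2 → ∑ x, ∑ m, θ x m = 0) (τ : ℍ) :
    eis k (fun d m => fourierSum (fun x => θ (-x) m) d) (-1 / (τ : ℂ)) =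
      (-(τ : ℂ)) ^ k * eis k (fun d x => fourierSum (θ x) d) τ := by
  have hL : (0 : ℝ) < L := by exact_mod_cast Nat.pos_of_ne_zero (NeZero.ne L)
  have hlt (r : ZMod L) : (r.val / L : ℝ) < 1 := by
    rw [div_lt_one hL]; exact_mod_cast r.val_lt
  have hC : (-2 * π * I : ℂ) ^ k / (k - 1)! ≠ 0 := by
    have hπ : (π : ℂ) ≠ 0 := by exact_mod_cast Real.pi_ne_zero
    have hf : ((k - 1)! : ℂ) ≠ 0 := by exact_mod_cast Nat.factorial_ne_zero _
    exact div_ne_zero (pow_ne_zero _ (mul_ne_zero (mul_ne_zero (by norm_num) hπ) Complex.I_ne_zero)) hf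
  have hS (r s : ZMod L) := rowSumReg_S hk τ (a := r.val / L) (b := s.val / L)
    (by positivity) (hlt r) (by positivity) (hlt s)
  have e1 := sum_rowSumReg hk hθ τ
  have hτ' : ((ModularGroup.S • τ : ℍ) : ℂ) = -1 / (τ : ℂ) := by
    rw [UpperHalfPlane.modular_S_smul, neg_div, one_div, ← inv_neg]
  have e2 := sum_rowSumReg (θ := fun m x => θ (-x) m) hk
    (fun m x => by simpa using hθ (-x) m) (ModularGroup.S • τ)
  rw [hτ'] at e2
  -- The coordinate `-r/L` is moved into `[0, 1)` by an integer translation, which leaves rows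
  -- unchanged; this is the origin of `θ (-x) m`.
  have e3 : ∑ r, ∑ s, θ r s * rowSumReg k (-1 / (τ : ℂ)) (s.val / L) (-(r.val / L)) =
      ∑ m, ∑ x, θ (-x) m * rowSumReg k (-1 / (τ : ℂ)) (m.val / L) (x.val / L) := by
    rw [Finset.sum_comm]
    refine Finset.sum_congr rfl fun m _ => ?_
    rw [← Equiv.sum_comp (Equiv.neg (ZMod L))]
    refine Finset.sum_congr rfl fun x _ => ?_
    obtain ⟨n, hn⟩ := exists_val_neg_div x
    rw [Equiv.neg_apply, hn, show (-(-(x.val / L : ℝ) + n)) = x.val / L + ((-n : ℤ) : ℝ) by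
      push_cast; ring]
    congr 1
    simp only [rowSumReg, rowSum, row_add_int]
  -- The defect in `rowSumReg_S` is independent of `r` and `s`, so in weight 2 it is multiplied by
  -- the total sum of `θ`.
  have e4 : ∑ r, ∑ s, θ r s * ((-(τ : ℂ)) ^ k * rowSumReg k τ (r.val / L) (s.val / L) -
      rowSumReg k (-1 / (τ : ℂ)) (s.val / L) (-(r.val / L))) = 0 := by
    simp only [hS, ← Finset.sum_mul]
    split_ifs with h
    · rw [h2 h, zero_mul]
    · simp
  simp only [mul_sub, Finset.sum_sub_distrib] at e4
  rw [e3, e2] at e4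
  simp only [mul_left_comm (θ _ _) ((-(τ : ℂ)) ^ k), ← Finset.mul_sum] at e4
  rw [e1] at e4
  refine mul_left_cancel₀ hC ?_
  linear_combination -e4

end CuspEisenstein
end

/-! ### The kernel attached to two characters and its two partial Fourier transforms -/

noncomputable section
namespace CuspEisenstein
open Filter Topology
open Complex (I exp)
open ZMod
open scoped Real Nat ZMod

/-- The multiplication by `L / N` from `ℤ/N` to `ℤ/L`. -/
def scale (N L : ℕ) (a : ZMod N) : ZMod L := ((a.val * (L / N) : ℕ) : ZMod L)

section scale

variable {N L : ℕ} [NeZero N] (h : N ∣ L)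
include h

lemma scale_intCast (n : ℤ) : scale N L (n : ZMod N) = ((n * (L / N : ℕ) : ℤ) : ZMod L) := by
  have h1 : (((n : ZMod N).val : ℤ) : ZMod N) = n := by simp
  obtain ⟨i, hi⟩ := (ZMod.intCast_eq_intCast_iff_dvd_sub _ _ _).mp h1
  have h2 : ((n : ZMod N).val : ℤ) = n - N * i := by omega
  have h3 : (N : ℤ) * (L / N : ℕ) = L := by exact_mod_cast Nat.mul_div_cancel' h
  rw [scale, ← Int.cast_natCast, Nat.cast_mul, h2, sub_mul,
    show (N : ℤ) * i * (L / N : ℕ) = i * (N * (L / N : ℕ)) by ring, h3]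
  simp

lemma scale_neg (a : ZMod N) : scale N L (-a) = -scale N L a := by
  obtain ⟨n, rfl⟩ := ZMod.intCast_surjective a
  rw [← Int.cast_neg, scale_intCast h, scale_intCast h]
  push_cast
  ring

lemma stdAddChar_scale [NeZero L] (a : ZMod N) (d : ZMod L) :
    (stdAddChar (scale N L a * d) : ℂ) = stdAddChar (a * ZMod.castHom h (ZMod N) d) := by
  have hN : (N : ℂ) ≠ 0 := by exact_mod_cast NeZero.ne N
  have hL : (L : ℂ) ≠ 0 := by exact_mod_cast NeZero.ne L
  have e1 : scale N L a * d = ((a.val * (L / N) * d.val : ℕ) : ZMod L) := by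
    rw [Nat.cast_mul, ZMod.natCast_zmod_val d, scale]
  have e2 : a * ZMod.castHom h (ZMod N) d = ((a.val * d.val : ℕ) : ZMod N) := by
    conv_lhs => rw [← ZMod.natCast_zmod_val d, ← ZMod.natCast_zmod_val a]
    rw [map_natCast, Nat.cast_mul]
  rw [e1, e2, stdAddChar_natCast, stdAddChar_natCast]
  congr 2
  push_cast [Nat.cast_div h hN]
  field_simp

end scale

/-- The sum of `χ̄(a)` over the solutions of `x ≡ a L / N + s L / C` modulo `L`. -/
def charFiber {N C L : ℕ} [NeZero N] (χ : DirichletCharacter ℂ N) (s : ZMod C) (x : ZMod L) : ℂ :=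
  ∑ a : ZMod N, if x = scale N L a + scale C L s then star χ a else 0

lemma sum_charFiber {N C L : ℕ} [NeZero N] [NeZero L] (χ : DirichletCharacter ℂ N) (s : ZMod C) : ∑ x : ZMod L, charFiber χ s x = ∑ a, star χ a := by
  simp only [charFiber]
  rw [Finset.sum_comm]
  simp

section charFiber

variable {N C L : ℕ} [NeZero N] [NeZero C] [NeZero L] (hN : N ∣ L) (hC : C ∣ L)
  (χ : DirichletCharacter ℂ N)
include hN hC

omit [NeZero L] in
lemma charFiber_neg (s : ZMod C) (x : ZMod L) :
    charFiber χ (-s) (-x) = χ (-1) * charFiber χ s x := by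
  have h1 : star χ (-1) = χ (-1) := by
    rw [MulChar.star_apply]
    rcases χ.even_or_odd with h | h <;> rw [h] <;> simp
  rw [charFiber, ← Equiv.sum_comp (Equiv.neg (ZMod N)), charFiber, Finset.mul_sum]
  refine Finset.sum_congr rfl fun a _ => ?_
  rw [Equiv.neg_apply, scale_neg hN, scale_neg hC, ← neg_add, apply_neg (star χ) h1]
  simp only [neg_inj, mul_ite, mul_zero]

/-- The scaled copy of `χ̄` transforms into `χ` times a Gauss sum, by primitivity, and the
translation by `s L/C` becomes the additive twist. -/
lemma fourierSum_charFiber (hχ : χ.IsPrimitive) (s : ZMod C) (d : ZMod L) :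
    fourierSum (charFiber χ s) d = gauss (star χ) * χ (ZMod.castHom hN (ZMod N) d) *
      stdAddChar (s * ZMod.castHom hC (ZMod C) d) := by
  have h := fourierSum_eq_gauss (isPrimitive_star hχ) (ZMod.castHom hN (ZMod N) d)
  rw [star_star] at h
  rw [mul_comm (gauss _), ← h]
  simp only [fourierSum, charFiber, Finset.sum_mul]
  rw [Finset.sum_comm]
  refine Finset.sum_congr rfl fun a _ => ?_
  simp only [ite_mul, zero_mul, Finset.sum_ite_eq', Finset.mem_univ, if_true]
  rw [add_mul, AddChar.map_add_eq_mul, stdAddChar_scale hN, stdAddChar_scale hC, mul_assoc]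

lemma charFiber_eq (hχ : χ.IsPrimitive) (s : ZMod C) (x : ZMod L) :
    (L : ℂ) * charFiber χ s x = gauss (star χ) * ∑ m, χ (ZMod.castHom hN (ZMod N) m) *
      stdAddChar (s * ZMod.castHom hC (ZMod C) m) * stdAddChar (-(m * x)) := by
  have h := congrFun (dft_dft fun x : ZMod L => charFiber χ s (-x)) x
  rw [← fourierSum_eq_dft, dft_apply] at h
  simp only [neg_neg, smul_eq_mul] at h
  rw [← h, Finset.mul_sum]
  refine Finset.sum_congr rfl fun m _ => ?_
  rw [fourierSum_charFiber hN hC χ hχ]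
  ring

end charFiber

lemma sum_stdAddChar_mul {C : ℕ} [NeZero C] (t : ZMod C) :
    ∑ s : ZMod C, (stdAddChar (s * t) : ℂ) = if t = 0 then (C : ℂ) else 0 := by
  have := AddChar.sum_mulShift (R' := ℂ) t (isPrimitive_stdAddChar C)
  rw [this]
  simp

/-- The kernel of the coefficients of the transformed Eisenstein series. -/
def dualKernel {N₁ N₂ C L : ℕ} [NeZero N₁] [NeZero N₂] [NeZero C]
    (χ₁ : DirichletCharacter ℂ N₁) (χ₂ : DirichletCharacter ℂ N₂) (u : ZMod C)
    (d x : ZMod L) : ℂ :=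
  ∑ s₁ : ZMod C, ∑ s₂ : ZMod C,
    charFiber χ₁ s₁ x * charFiber χ₂ s₂ d * stdAddChar (-(u⁻¹ * s₁ * s₂))

/-- The function on `(ℤ/L)²` whose partial Fourier transforms are the coefficients of the
Eisenstein series with characters `χ₁, χ₂` twisted by `e(u d m / C)`, and `dualKernel`. -/
def kernel {N₁ N₂ C L : ℕ} [NeZero N₁] [NeZero N₂] [NeZero C] (hN₂ : N₂ ∣ L) (hC : C ∣ L)
    (χ₁ : DirichletCharacter ℂ N₁) (χ₂ : DirichletCharacter ℂ N₂) (u : ZMod C)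
    (x m : ZMod L) : ℂ :=
  χ₂ (ZMod.castHom hN₂ (ZMod N₂) m) * charFiber χ₁ (u * ZMod.castHom hC (ZMod C) m) (-x)

section kernel

variable {N₁ N₂ C L : ℕ} [NeZero N₁] [NeZero N₂] [NeZero C] [NeZero L]
  (hN₁ : N₁ ∣ L) (hN₂ : N₂ ∣ L) (hC : C ∣ L)
  (χ₁ : DirichletCharacter ℂ N₁) (χ₂ : DirichletCharacter ℂ N₂) (u : ZMod C)

omit [NeZero L] in
lemma dualKernel_swap (d x : ZMod L) :
    dualKernel χ₁ χ₂ u d x = dualKernel χ₂ χ₁ u x d := by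
  rw [dualKernel, dualKernel, Finset.sum_comm]
  refine Finset.sum_congr rfl fun s _ => Finset.sum_congr rfl fun t _ => ?_
  rw [mul_right_comm u⁻¹, mul_comm (charFiber χ₁ _ _)]

omit [NeZero L] in
include hN₁ hN₂ hC in
lemma dualKernel_neg (d x : ZMod L) :
    dualKernel χ₁ χ₂ u (-d) (-x) = χ₁ (-1) * χ₂ (-1) * dualKernel χ₁ χ₂ u d x := by
  rw [dualKernel, dualKernel, ← Equiv.sum_comp (Equiv.neg (ZMod C)), Finset.mul_sum]
  refine Finset.sum_congr rfl fun s _ => ?_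
  rw [← Equiv.sum_comp (Equiv.neg (ZMod C)), Finset.mul_sum]
  refine Finset.sum_congr rfl fun t _ => ?_
  rw [Equiv.neg_apply, charFiber_neg hN₁ hC, charFiber_neg hN₂ hC,
    show u⁻¹ * -s * -t = u⁻¹ * s * t by ring]
  ring

omit [NeZero L] in
include hN₁ in
lemma kernel_neg (x m : ZMod L) :
    kernel hN₂ hC χ₁ χ₂ u (-x) (-m) = χ₁ (-1) * χ₂ (-1) * kernel hN₂ hC χ₁ χ₂ u x m := by
  rw [kernel, kernel, map_neg (ZMod.castHom _ _), map_neg (ZMod.castHom _ _), mul_neg,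
    charFiber_neg hN₁ hC, apply_neg χ₂ rfl (ZMod.castHom hN₂ (ZMod N₂) m)]
  ring

include hN₁ in
lemma fourierSum_kernel_left (hχ₁ : χ₁.IsPrimitive) (d m : ZMod L) :
    fourierSum (fun x => kernel hN₂ hC χ₁ χ₂ u (-x) m) d =
      gauss (star χ₁) * (χ₁ (ZMod.castHom hN₁ (ZMod N₁) d) * χ₂ (ZMod.castHom hN₂ (ZMod N₂) m) *
        stdAddChar (u * ZMod.castHom hC (ZMod C) (d * m))) := by
  have := fourierSum_charFiber hN₁ hC χ₁ hχ₁ (u * ZMod.castHom hC (ZMod C) m) d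
  simp only [kernel, neg_neg, fourierSum, mul_assoc, ← Finset.mul_sum]
  rw [fourierSum] at this
  rw [this, map_mul (ZMod.castHom _ _), mul_assoc u, mul_comm (ZMod.castHom hC (ZMod C) m)]
  ring

include hN₁ in
-- In `dualKernel`, the factor `charFiber χ₂ s₂ d` is expanded by Fourier inversion
-- (`charFiber_eq`). The sum over `s₂` is then an orthogonality relation that forces `s₁ = u m`, and
-- what is left is the transform of `kernel` in `m`, up to `m ↦ -m`.
lemma fourierSum_kernel_right (hχ₂ : χ₂.IsPrimitive) (hu : IsUnit u) (hL : L = N₁ * N₂ * C)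
    (d x : ZMod L) :
    gauss (star χ₂) * fourierSum (kernel hN₂ hC χ₁ χ₂ u x) d =
      χ₁ (-1) * χ₂ (-1) * (N₁ * N₂) * dualKernel χ₁ χ₂ u d x := by
  have hC0 : (C : ℂ) ≠ 0 := by exact_mod_cast NeZero.ne C
  have huu : u⁻¹ * u = 1 := ZMod.inv_mul_of_unit u hu
  have hLC : (L : ℂ) = N₁ * N₂ * C := by rw [hL]; push_cast; rfl
  have key : (L : ℂ) * dualKernel χ₁ χ₂ u d x = gauss (star χ₂) * C *
      ∑ m, χ₂ (ZMod.castHom hN₂ (ZMod N₂) m) *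
        charFiber χ₁ (u * ZMod.castHom hC (ZMod C) m) x * stdAddChar (-(m * d)) := by
    have e (s₁ s₂ : ZMod C) : (L : ℂ) *
        (charFiber χ₁ s₁ x * charFiber χ₂ s₂ d * stdAddChar (-(u⁻¹ * s₁ * s₂))) =
        ∑ m, gauss (star χ₂) * χ₂ (ZMod.castHom hN₂ (ZMod N₂) m) * stdAddChar (-(m * d)) *
          charFiber χ₁ s₁ x * stdAddChar (s₂ * (ZMod.castHom hC (ZMod C) m - u⁻¹ * s₁)) := by
      have h1 := charFiber_eq hN₂ hC χ₂ hχ₂ s₂ d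
      calc _ = charFiber χ₁ s₁ x * stdAddChar (-(u⁻¹ * s₁ * s₂)) * ((L : ℂ) * charFiber χ₂ s₂ d) := by
            ring
        _ = _ := by
            rw [h1, Finset.mul_sum, Finset.mul_sum]
            refine Finset.sum_congr rfl fun m _ => ?_
            rw [mul_sub, sub_eq_add_neg, AddChar.map_add_eq_mul,
              show s₂ * (u⁻¹ * s₁) = u⁻¹ * s₁ * s₂ by ring]
            ring
    rw [dualKernel, Finset.mul_sum]
    simp only [Finset.mul_sum, e]
    rw [Finset.sum_congr rfl fun s₁ _ => Finset.sum_comm, Finset.sum_comm]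
    refine Finset.sum_congr rfl fun m _ => ?_
    simp only [← Finset.mul_sum, sum_stdAddChar_mul]
    rw [Finset.sum_eq_single (u * ZMod.castHom hC (ZMod C) m)]
    · rw [if_pos (by rw [← mul_assoc, huu, one_mul, sub_self])]
      ring
    · intro s₁ _ hs
      rw [if_neg, mul_zero]
      intro h0
      refine hs ?_
      rw [sub_eq_zero.mp h0, ← mul_assoc, mul_comm u, huu, one_mul]
    · simp
  rw [hLC] at key
  have key2 : (N₁ * N₂ : ℂ) * dualKernel χ₁ χ₂ u d x = gauss (star χ₂) *
      ∑ m, χ₂ (ZMod.castHom hN₂ (ZMod N₂) m) *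
        charFiber χ₁ (u * ZMod.castHom hC (ZMod C) m) x * stdAddChar (-(m * d)) :=
    mul_left_cancel₀ hC0 (by linear_combination key)
  rw [mul_assoc (χ₁ (-1) * χ₂ (-1)), key2, ← Equiv.sum_comp (Equiv.neg (ZMod L)), mul_left_comm]
  congr 1
  rw [fourierSum, Finset.mul_sum]
  refine Finset.sum_congr rfl fun m _ => ?_
  have h2 := charFiber_neg hN₁ hC χ₁ (u * ZMod.castHom hC (ZMod C) m) (-x)
  rw [neg_neg] at h2
  have h3 : χ₁ (-1) * χ₁ (-1) = 1 := by
    rw [← map_mul]; simp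
  have h4 : χ₂ (-1) * χ₂ (-1) = 1 := by
    rw [← map_mul]; simp
  rw [Equiv.neg_apply, map_neg (ZMod.castHom _ _), map_neg (ZMod.castHom _ _), mul_neg, h2,
    apply_neg χ₂ rfl (ZMod.castHom hN₂ (ZMod N₂) m), neg_mul, neg_neg, kernel]
  linear_combination (-(χ₂ (ZMod.castHom hN₂ (ZMod N₂) m) *
    charFiber χ₁ (u * ZMod.castHom hC (ZMod C) m) (-x) * stdAddChar (m * d))) * ((χ₁ (-1)) ^ 2 * h4 + h3)

omit [NeZero N₂] in
lemma sum_character_castHom {χ : DirichletCharacter ℂ N₂} (hχ : χ ≠ 1) :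
    ∑ m : ZMod L, χ (ZMod.castHom hN₂ (ZMod N₂) m) = 0 := by
  obtain ⟨v, hv⟩ := MulChar.ne_one_iff.mp hχ
  obtain ⟨v', hv'⟩ := ZMod.unitsMap_surjective hN₂ v
  have h : ZMod.castHom hN₂ (ZMod N₂) (v' : ZMod L) = v := by
    rw [← hv']; rfl
  have h1 : ∑ m : ZMod L, χ (ZMod.castHom hN₂ (ZMod N₂) (v' * m)) =
      ∑ m : ZMod L, χ (ZMod.castHom hN₂ (ZMod N₂) m) :=
    Equiv.sum_comp (Units.mulLeft v') fun m => χ (ZMod.castHom hN₂ (ZMod N₂) m)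
  simp only [map_mul, h, ← Finset.mul_sum] at h1
  have h2 : (χ v - 1) * ∑ m : ZMod L, χ (ZMod.castHom hN₂ (ZMod N₂) m) = 0 := by
    linear_combination h1
  exact (mul_eq_zero.mp h2).resolve_left (sub_ne_zero.mpr hv)

/-- The total sum factors into a sum of `χ̄₁` and a sum of `χ₂`, one of which is over a nontrivial
character. This is the condition that weight 2 requires in `eis_neg_inv`. -/
lemma sum_kernel (h : ¬(χ₁ = 1 ∧ χ₂ = 1)) :
    ∑ x, ∑ m, kernel hN₂ hC χ₁ χ₂ u x m = 0 := by
  rw [Finset.sum_comm]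
  simp only [kernel, ← Finset.mul_sum]
  have e (s : ZMod C) : ∑ x : ZMod L, charFiber χ₁ s (-x) = ∑ a, star χ₁ a := by
    rw [← sum_charFiber (L := L) χ₁ s]
    exact Equiv.sum_comp (Equiv.neg (ZMod L)) (charFiber χ₁ s)
  simp only [e, ← Finset.sum_mul]
  by_cases h2 : χ₂ = 1
  · have h1 : star χ₁ ≠ 1 := by
      rw [MulChar.star_eq_inv]
      exact fun h1 => h ⟨inv_eq_one.mp h1, h2⟩
    rw [MulChar.sum_eq_zero_of_ne_one h1, mul_zero]
  · rw [sum_character_castHom hN₂ h2, zero_mul]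

end kernel

end CuspEisenstein
end

/-! ### Behaviour at the cusp `U / C` and the constant term there -/

noncomputable section
namespace CuspEisenstein
open Filter Topology
open UpperHalfPlane hiding I
open Complex (I exp)
open ZMod
open scoped Real Nat ZMod

/-- Both sides have the same Dirichlet series for `Re s > 1`; the identity theorem on the complement
of 1 does the rest. -/
lemma LFunction_comp_castHom {N L : ℕ} [NeZero N] [NeZero L] (h : N ∣ L) (f : ZMod N → ℂ) {s : ℂ}
    (hs : s ≠ 1) : LFunction (fun d : ZMod L => f (ZMod.castHom h (ZMod N) d)) s = LFunction f s := by
  have hpc : IsPreconnected ({1}ᶜ : Set ℂ) :=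
    (isConnected_compl_singleton_of_one_lt_rank (Complex.rank_real_complex ▸ Nat.one_lt_ofNat) _)
      |>.isPreconnected
  have hne : (2 : ℂ) ∈ ({1}ᶜ : Set ℂ) := by simp
  have hd {M : ℕ} [NeZero M] (Φ : ZMod M → ℂ) : AnalyticOnNhd ℂ (LFunction Φ) {1}ᶜ :=
    DifferentiableOn.analyticOnNhd (fun s hs =>
      (differentiableAt_LFunction _ _ (.inl hs)).differentiableWithinAt) isOpen_compl_singleton
  refine AnalyticOnNhd.eqOn_of_preconnected_of_eventuallyEq (hd _) (hd _) hpc hne ?_ hs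
  refine eventually_of_mem ((Complex.continuous_re.isOpen_preimage _ isOpen_Ioi).mem_nhds
    (by simp : 1 < (2 : ℂ).re)) fun t (ht : 1 < t.re) => ?_
  rw [LFunction_eq_LSeries _ ht, LFunction_eq_LSeries _ ht]
  simp

/-- Regrouping a double series by the product of the indices. -/
lemma hasSum_divisors {G : ℕ → ℕ → ℂ} (h : Summable fun p : ℕ+ × ℕ+ => G p.1 p.2) :
    HasSum (fun n : ℕ+ => ∑ d ∈ (n : ℕ).divisors, G d (n / d)) (∑' p : ℕ+ × ℕ+, G p.1 p.2) := by
  have h1 := (sigmaAntidiagonalEquivProd.hasSum_iff).mpr h.hasSum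
  refine (h1.sigma fun n => hasSum_fintype _).congr_fun fun n => ?_
  rw [← Nat.sum_divisorsAntidiagonal fun d e => G d e,
    ← Finset.sum_coe_sort]
  rfl

lemma apply_zero_eq {N : ℕ} (χ : DirichletCharacter ℂ N) : χ 0 = if N = 1 then 1 else 0 := by
  split_ifs with h
  · subst h
    rw [Subsingleton.elim (0 : ZMod 1) 1, map_one]
  · exact χ.map_zero' h

lemma stdAddChar_intCast_mul_natCast {C : ℕ} [NeZero C] (U : ℤ) (n : ℕ) :
    (stdAddChar ((U : ZMod C) * (n : ZMod C)) : ℂ) = exp (2 * π * I * (U * n / C)) := by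
  have := stdAddChar_coe (N := C) (U * n)
  push_cast at this
  rw [this]
  congr 1
  ring

/-- The Eisenstein series `F_k(χ₁, χ₂)`, translated by a rational number, as a series with
periodic coefficients. -/
lemma eis_twist_eq_F {N₁ N₂ C L : ℕ} [NeZero N₁] [NeZero N₂] [NeZero C] [NeZero L]
    (hN₁ : N₁ ∣ L) (hN₂ : N₂ ∣ L) (hC : C ∣ L) {k : ℕ} (hk : 1 ≤ k)
    (χ₁ : DirichletCharacter ℂ N₁) (χ₂ : DirichletCharacter ℂ N₂) (U : ℤ) (c : ℂ) {τ : ℂ}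
    (hτ : 0 < τ.im) :
    eis k (fun d m : ZMod L => c * (χ₁ (ZMod.castHom hN₁ (ZMod N₁) d) *
      χ₂ (ZMod.castHom hN₂ (ZMod N₂) m) *
        stdAddChar ((U : ZMod C) * ZMod.castHom hC (ZMod C) (d * m)))) τ =
      2 * c * F k χ₁ χ₂ (U / C + τ / L) := by
  have hs : (1 - (k : ℂ)) ≠ 1 := by
    intro h
    have : (k : ℂ) = 0 := by linear_combination -h
    norm_cast at this
    omega
  set Φ : ZMod L → ZMod L → ℂ := fun d m => c * (χ₁ (ZMod.castHom hN₁ (ZMod N₁) d) *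
      χ₂ (ZMod.castHom hN₂ (ZMod N₂) m) *
        stdAddChar ((U : ZMod C) * ZMod.castHom hC (ZMod C) (d * m))) with hΦ
  have e1 : LFunction (fun d => Φ d 0) (1 - k) =
      2 * c * if N₂ = 1 then χ₁.LFunction (1 - (k : ℂ)) / 2 else 0 := by
    have : (fun d => Φ d 0) = fun d => (c * χ₂ 0) * χ₁ (ZMod.castHom hN₁ (ZMod N₁) d) := by
      ext d
      simp only [hΦ, mul_zero, map_zero, AddChar.map_zero_eq_one]
      ring
    rw [this, LFunction_const_mul, LFunction_comp_castHom hN₁ _ hs, apply_zero_eq]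
    split_ifs <;> simp [DirichletCharacter.LFunction]
    ring
  have e2 : (if k = 1 then LFunction (Φ 0) 0 else 0) =
      2 * c * if k = 1 ∧ N₁ = 1 then χ₂.LFunction 0 / 2 else 0 := by
    have : Φ 0 = fun d => (c * χ₁ 0) * χ₂ (ZMod.castHom hN₂ (ZMod N₂) d) := by
      ext d
      simp only [hΦ, zero_mul, mul_zero, map_zero, AddChar.map_zero_eq_one]
      ring
    rw [this, LFunction_const_mul, LFunction_comp_castHom hN₂ _ zero_ne_one, apply_zero_eq]
    by_cases h1 : k = 1 <;> by_cases h2 : N₁ = 1 <;> simp [h1, h2, DirichletCharacter.LFunction]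
    ring
  have hterm (p : ℕ+ × ℕ+) : eisTerm k Φ τ p = c * (((p.1 : ℕ) : ℂ) ^ (k - 1) *
      χ₁ ((p.1 : ℕ) : ZMod N₁) * χ₂ ((p.2 : ℕ) : ZMod N₂) *
      qPow (U / C + τ / L) (((p.1 : ℕ) * (p.2 : ℕ) : ℕ) : ℚ)) := by
    rw [eisTerm, hΦ]
    simp only [map_mul, map_natCast]
    rw [← Nat.cast_mul, stdAddChar_intCast_mul_natCast, qPow,
      show (2 * π * I * (U / C + τ / L) * (((((p.1 : ℕ) * (p.2 : ℕ) : ℕ) : ℚ)) : ℂ)) =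
        2 * π * I * (U * ((p.1 * p.2 : ℕ) : ℂ) / C) + 2 * π * I * (p.1 * p.2 * τ / L) by
        push_cast; ring, Complex.exp_add]
    ring
  have e3 : ∑' p, eisTerm k Φ τ p =
      c * ∑' n : ℕ+, sigma k χ₁ χ₂ n * qPow (U / C + τ / L) ((n : ℕ) : ℚ) := by
    have hsum := (summable_eisTerm k Φ hτ).congr fun p => hterm p
    rw [tsum_congr hterm]
    have := hasSum_divisors (G := fun d m => c * ((d : ℂ) ^ (k - 1) * χ₁ (d : ZMod N₁) *
      χ₂ (m : ZMod N₂) * qPow (U / C + τ / L) ((d * m : ℕ) : ℚ))) hsum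
    rw [← this.tsum_eq, ← tsum_mul_left]
    refine tsum_congr fun n => ?_
    rw [sigma, Finset.sum_mul, Finset.mul_sum]
    refine Finset.sum_congr rfl fun d hd => ?_
    rw [Nat.mul_div_cancel' (Nat.dvd_of_mem_divisors hd)]
  rw [eis, e1, e2, e3, F, constTerm]
  ring

/-- The behaviour of `F_k(χ₁, χ₂)` near the cusp `U / C`. -/
theorem F_near_cusp {N₁ N₂ C L : ℕ} [NeZero N₁] [NeZero N₂] [NeZero C] [NeZero L]
    (hL : L = N₁ * N₂ * C) {k : ℕ} (hk : 1 ≤ k)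
    {χ₁ : DirichletCharacter ℂ N₁} {χ₂ : DirichletCharacter ℂ N₂}
    (hχ₁ : χ₁.IsPrimitive) (hχ₂ : χ₂.IsPrimitive) (hparity : χ₁ (-1) * χ₂ (-1) = (-1) ^ k)
    (hne : ¬(k = 2 ∧ χ₁ = 1 ∧ χ₂ = 1)) {U : ℤ} (hU : IsUnit (U : ZMod C)) (τ : ℍ) :
    2 * gauss (star χ₁) * gauss (star χ₂) * F k χ₁ χ₂ (U / C + (-1 / (τ : ℂ)) / L) =
      (τ : ℂ) ^ k * (N₁ * N₂) * eis k (dualKernel (L := L) χ₁ χ₂ (U : ZMod C)) τ := by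
  have hN₁ : N₁ ∣ L := ⟨N₂ * C, by rw [hL]; ring⟩
  have hN₂ : N₂ ∣ L := ⟨N₁ * C, by rw [hL]; ring⟩
  have hC : C ∣ L := ⟨N₁ * N₂, by rw [hL]; ring⟩
  have h1 : (-1 : ℂ) ^ k * (-1) ^ k = 1 := by rw [← mul_pow]; simp
  -- For this `θ`, the side at `-1/τ` is the translated `F` and the side at `τ` is `dualKernel`, up
  -- to Gauss sums.
  have hT := eis_neg_inv hk (θ := kernel hN₂ hC χ₁ χ₂ (U : ZMod C))
    (fun x m => by rw [kernel_neg hN₁, hparity])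
    (fun h2 => sum_kernel hN₂ hC χ₁ χ₂ _ fun h => hne ⟨h2, h⟩) τ
  have him : 0 < (-1 / (τ : ℂ)).im := by
    have : ((ModularGroup.S • τ : ℍ) : ℂ) = -1 / (τ : ℂ) := by
      rw [UpperHalfPlane.modular_S_smul, neg_div, one_div, ← inv_neg]
    rw [← this]
    exact (ModularGroup.S • τ).im_pos
  simp only [fourierSum_kernel_left hN₁ hN₂ hC χ₁ χ₂ _ hχ₁] at hT
  rw [eis_twist_eq_F hN₁ hN₂ hC hk χ₁ χ₂ U _ him] at hT
  have hlin (c : ℂ) (Φ : ZMod L → ZMod L → ℂ) :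
      c * eis k Φ τ = eis k (fun d x => c * Φ d x) τ := by
    have hterm (p : ℕ+ × ℕ+) : eisTerm k (fun d x => c * Φ d x) τ p = c * eisTerm k Φ τ p := by
      simp only [eisTerm]; ring
    simp only [eis, hterm, LFunction_const_mul, tsum_mul_left]
    split_ifs <;> ring
  have hR : gauss (star χ₂) * eis k (fun d x => fourierSum (kernel hN₂ hC χ₁ χ₂ (U : ZMod C) x) d) τ =
      (-1) ^ k * (N₁ * N₂) * eis k (dualKernel (L := L) χ₁ χ₂ (U : ZMod C)) τ := by
    rw [hlin, hlin]
    congr 1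
    ext d x
    rw [fourierSum_kernel_right hN₁ hN₂ hC χ₁ χ₂ _ hχ₂ hU hL, hparity]
  have h3 : (-(τ : ℂ)) ^ k = (-1) ^ k * (τ : ℂ) ^ k := by rw [← mul_pow]; simp
  rw [h3] at hT
  linear_combination gauss (star χ₂) * hT + (-1) ^ k * (τ : ℂ) ^ k * hR +
    (τ : ℂ) ^ k * (N₁ * N₂) * eis k (dualKernel (L := L) χ₁ χ₂ (U : ZMod C)) τ * h1

lemma scale_injective {N L : ℕ} [NeZero N] [NeZero L] (h : N ∣ L) :
    Function.Injective (scale N L) := by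
  have hpos : 0 < L / N := Nat.div_pos (Nat.le_of_dvd (NeZero.pos L) h) (NeZero.pos N)
  have key (a : ZMod N) : (scale N L a).val = a.val * (L / N) := by
    refine ZMod.val_cast_of_lt ?_
    calc a.val * (L / N) < N * (L / N) := Nat.mul_lt_mul_of_pos_right a.val_lt hpos
      _ = L := Nat.mul_div_cancel' h
  intro a b hab
  have := congrArg ZMod.val hab
  rw [key, key] at this
  exact ZMod.val_injective N (Nat.eq_of_mul_eq_mul_right hpos this)

lemma charFiber_zero {N L : ℕ} [NeZero N] [NeZero L] (h : N ∣ L) (χ : DirichletCharacter ℂ N)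
    (s : ZMod N) : charFiber χ s (0 : ZMod L) = star χ (-s) := by
  rw [charFiber, Finset.sum_eq_single (-s)]
  · rw [if_pos]
    rw [scale_neg h, neg_add_cancel]
  · intro a _ ha
    rw [if_neg]
    intro h0
    refine ha (scale_injective h ?_)
    rw [scale_neg h]
    linear_combination -h0
  · simp

lemma isCoprime_of_apply_ne_zero {N : ℕ} {χ : DirichletCharacter ℂ N} {n : ℤ}
    (h : χ (n : ZMod N) ≠ 0) : IsCoprime n (N : ℤ) := (χ.apply_ne_zero_iff n).mp h

/-- The row `0` of `kernel` vanishes unless `C = N₁`. -/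
lemma kernel_zero_eq_zero {N₁ N₂ C L : ℕ} [NeZero N₁] [NeZero N₂] [NeZero C] [NeZero L]
    (hL : L = N₁ * N₂ * C) (hN₂ : N₂ ∣ L) (hC : C ∣ L) (hC' : C ∣ N₁ * N₂) (hCN : C ≠ N₁)
    (χ₁ : DirichletCharacter ℂ N₁) (χ₂ : DirichletCharacter ℂ N₂) {U : ℤ}
    (hU : IsCoprime U (C : ℤ)) (m : ZMod L) :
    kernel hN₂ hC χ₁ χ₂ (U : ZMod C) 0 m = 0 := by
  have hN₁ : N₁ ∣ L := ⟨N₂ * C, by rw [hL]; ring⟩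
  have hN₁0 : (N₁ : ℤ) ≠ 0 := by exact_mod_cast NeZero.ne N₁
  have hN₂0 : (N₂ : ℤ) ≠ 0 := by exact_mod_cast NeZero.ne N₂
  have hN₁p := NeZero.pos N₁
  have hN₂p := NeZero.pos N₂
  have hCp := NeZero.pos C
  obtain ⟨n, rfl⟩ := ZMod.intCast_surjective m
  rw [kernel, map_intCast (ZMod.castHom hN₂ (ZMod N₂)), map_intCast (ZMod.castHom hC (ZMod C)),
    neg_zero, ← Int.cast_mul]
  by_contra hne
  obtain ⟨h1, h2⟩ := mul_ne_zero_iff.mp hne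
  obtain ⟨a, -, ha⟩ := Finset.exists_ne_zero_of_sum_ne_zero h2
  obtain ⟨b, rfl⟩ := ZMod.intCast_surjective a
  split_ifs at ha with h0
  · have hb : IsCoprime b (N₁ : ℤ) := isCoprime_of_apply_ne_zero ha
    have hn : IsCoprime n (N₂ : ℤ) := isCoprime_of_apply_ne_zero h1
    have d1 : L / N₁ = N₂ * C := by
      rw [hL, mul_assoc]; exact Nat.mul_div_cancel_left _ hN₁p
    have d2 : L / C = N₁ * N₂ := by rw [hL]; exact Nat.mul_div_cancel _ hCp
    rw [scale_intCast hN₁, scale_intCast hC, d1, d2, ← Int.cast_add, eq_comm,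
      ZMod.intCast_zmod_eq_zero_iff_dvd, hL] at h0
    -- A nonzero term has `b` prime to `N₁` and `n` prime to `N₂`. The divisibility then gives `N₁ ∣
    -- C`; writing `C = N₁ t`, coprimality of `U` and `C` gives `t ∣ n`, while `C ∣ N₁N₂` gives `t ∣
    -- N₂`. Hence `t = 1`.
    have h3 : (N₁ * C : ℤ) ∣ b * C + U * n * N₁ := by
      refine (mul_dvd_mul_iff_left hN₂0).mp ?_
      have e1 : (N₂ : ℤ) * (N₁ * C) = ((N₁ * N₂ * C : ℕ) : ℤ) := by push_cast; ring
      have e2 : (N₂ : ℤ) * (b * C + U * n * N₁) =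
          b * ((N₂ * C : ℕ) : ℤ) + U * n * ((N₁ * N₂ : ℕ) : ℤ) := by push_cast; ring
      rw [e1, e2]
      exact h0
    have h4 : (N₁ : ℤ) ∣ C := by
      refine hb.symm.dvd_of_dvd_mul_left ?_
      have h5 : (N₁ : ℤ) ∣ b * C + U * n * N₁ := (dvd_mul_right _ _).trans h3
      exact (dvd_add_left (dvd_mul_left _ _)).mp h5
    obtain ⟨t, ht⟩ := Int.natCast_dvd_natCast.mp h4
    have h6 : (C : ℤ) ∣ b * t + U * n := by
      refine (mul_dvd_mul_iff_left hN₁0).mp ?_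
      have e : (N₁ : ℤ) * (b * t + U * n) = b * C + U * n * N₁ := by rw [ht]; push_cast; ring
      rw [e]
      exact h3
    have htC : (t : ℤ) ∣ C := ⟨N₁, by rw [ht]; push_cast; ring⟩
    have h7 : (t : ℤ) ∣ n := by
      have h8 : (t : ℤ) ∣ U * n := (dvd_add_right (dvd_mul_left _ _)).mp (htC.trans h6)
      exact (hU.of_isCoprime_of_dvd_right htC).symm.dvd_of_dvd_mul_left h8
    have h9 : (t : ℤ) ∣ N₂ := by
      have : N₁ * t ∣ N₁ * N₂ := ht ▸ hC'
      exact_mod_cast Nat.dvd_of_mul_dvd_mul_left hN₁p this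
    have h10 : IsUnit (t : ℤ) := hn.isUnit_of_dvd' h7 h9
    have h11 : t = 1 := by
      have := Int.natAbs_of_isUnit h10
      simpa using this
    exact hCN (by rw [ht, h11, mul_one])
  · exact ha rfl

/-- For `C = N₁` the fibre over 0 is the single point `a = -s`. A unit test on `m` is needed since
the product of the two characters has to be compared with a character modulo `L`. -/
lemma kernel_zero_eq {N₁ N₂ L : ℕ} [NeZero N₁] [NeZero N₂] [NeZero L]
    (hL : L = N₁ * N₂ * N₁) (hN₂ : N₂ ∣ L) (hC : N₁ ∣ L) (hM : N₁ * N₂ ∣ L)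
    (χ₁ : DirichletCharacter ℂ N₁) (χ₂ : DirichletCharacter ℂ N₂) (u : ZMod N₁) (m : ZMod L) :
    kernel hN₂ hC χ₁ χ₂ u 0 m =
      star χ₁ (-u) * DirichletCharacter.changeLevel hM (conjMul χ₁ χ₂) m := by
  rw [kernel, neg_zero, charFiber_zero hC, ← neg_mul, map_mul, conjMul, map_mul,
    ← DirichletCharacter.changeLevel_trans, ← DirichletCharacter.changeLevel_trans, MulChar.mul_apply]
  by_cases hm : IsUnit m
  · obtain ⟨v, rfl⟩ := hm
    rw [DirichletCharacter.changeLevel_eq_cast_of_dvd, DirichletCharacter.changeLevel_eq_cast_of_dvd,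
      ZMod.castHom_apply, ZMod.castHom_apply]
    ring
  · rw [MulChar.map_nonunit _ hm, zero_mul, mul_zero]
    by_contra hne
    have h1 : χ₂ (ZMod.castHom hN₂ (ZMod N₂) m) ≠ 0 := left_ne_zero_of_mul hne
    have h2 : star χ₁ (ZMod.castHom hC (ZMod N₁) m) ≠ 0 :=
      right_ne_zero_of_mul (right_ne_zero_of_mul hne)
    obtain ⟨n, rfl⟩ := ZMod.intCast_surjective m
    rw [map_intCast] at h1 h2
    have c1 := isCoprime_of_apply_ne_zero h1
    have c2 := isCoprime_of_apply_ne_zero h2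
    refine hm ((ZMod.coe_int_isUnit_iff_isCoprime _ _).mpr ?_)
    rw [hL]
    push_cast
    exact ((c2.mul_right c1).mul_right c2).symm

/-- The constant term of the series with coefficients `dualKernel`. -/
theorem LFunction_dualKernel {N₁ N₂ C L : ℕ} [NeZero N₁] [NeZero N₂] [NeZero C] [NeZero L]
    (hL : L = N₁ * N₂ * C) (hC' : C ∣ N₁ * N₂) {k : ℕ} (hk : 1 ≤ k)
    {χ₁ : DirichletCharacter ℂ N₁} {χ₂ : DirichletCharacter ℂ N₂}
    (hχ₂ : χ₂.IsPrimitive) (hparity : χ₁ (-1) * χ₂ (-1) = (-1) ^ k)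
    {U : ℤ} (hU : IsCoprime U (C : ℤ)) :
    LFunction (fun d : ZMod L => dualKernel χ₁ χ₂ (U : ZMod C) d 0) (1 - k) =
      if C = N₁ then (-1) ^ (k - 1) * (gauss (star χ₂) / N₂) * (N₁ : ℂ) ^ (k - 1) *
        star χ₁ ((-U : ℤ) : ZMod N₁) * S k (conjMul χ₁ χ₂) else 0 := by
  have hN₁ : N₁ ∣ L := ⟨N₂ * C, by rw [hL]; ring⟩
  have hN₂ : N₂ ∣ L := ⟨N₁ * C, by rw [hL]; ring⟩
  have hC : C ∣ L := ⟨N₁ * N₂, by rw [hL]; ring⟩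
  have hM : N₁ * N₂ ∣ L := ⟨C, by rw [hL]⟩
  have hN₁0 : (N₁ : ℂ) ≠ 0 := by exact_mod_cast NeZero.ne N₁
  have hN₂0 : (N₂ : ℂ) ≠ 0 := by exact_mod_cast NeZero.ne N₂
  have h1 : (-1 : ℂ) ^ k * (-1) ^ k = 1 := by rw [← mul_pow]; simp
  have hu : IsUnit (U : ZMod C) := (ZMod.coe_int_isUnit_iff_isCoprime _ _).mpr hU.symm
  have e : (fun d : ZMod L => dualKernel χ₁ χ₂ (U : ZMod C) d 0) = fun d =>
      ((-1) ^ k * gauss (star χ₂) / (N₁ * N₂)) *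
        fourierSum (kernel hN₂ hC χ₁ χ₂ (U : ZMod C) 0) d := by
    ext d
    have := fourierSum_kernel_right hN₁ hN₂ hC χ₁ χ₂ _ hχ₂ hu hL d 0
    rw [hparity] at this
    field_simp
    linear_combination (-(-1) ^ k) * this - N₁ * N₂ * dualKernel χ₁ χ₂ (U : ZMod C) d 0 * h1
  rw [e, LFunction_const_mul]
  split_ifs with hCN
  · subst hCN
    have hp : (C * N₂).primeFactors = L.primeFactors := by
      rw [hL, Nat.primeFactors_mul (mul_ne_zero (NeZero.ne C) (NeZero.ne N₂)) (NeZero.ne C),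
        Nat.primeFactors_mul (NeZero.ne C) (NeZero.ne N₂)]
      ext p
      simp only [Finset.mem_union]
      tauto
    have hpar : conjMul χ₁ χ₂ (-1) = (-1) ^ k := by
      have hs : star χ₁ (-1) = χ₁ (-1) := by
        rw [MulChar.star_apply]
        rcases χ₁.even_or_odd with h | h <;> rw [h] <;> simp
      rw [conjMul, MulChar.mul_apply, changeLevel_neg_one, changeLevel_neg_one, hs, hparity]
    have h2 := LFunction_fourierSum_changeLevel hk hM hp (conjMul χ₁ χ₂) hpar
    have h3 : fourierSum (kernel hN₂ hC χ₁ χ₂ (U : ZMod C) 0) = fun d =>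
        star χ₁ (-(U : ZMod C)) *
          fourierSum (DirichletCharacter.changeLevel hM (conjMul χ₁ χ₂)) d := by
      ext d
      simp only [fourierSum, kernel_zero_eq hL hN₂ hC hM, Finset.mul_sum, mul_assoc]
    -- The level ratio is `C = N₁`, so its `k`-th power against the denominator `N₁N₂` leaves
    -- `N₁^(k-1)/N₂`.
    have h4 : (L : ℂ) / ((C * N₂ : ℕ) : ℂ) = C := by
      rw [hL]; push_cast; field_simp
    obtain ⟨l, rfl⟩ : ∃ l, k = l + 1 := ⟨k - 1, by omega⟩
    rw [h3, LFunction_const_mul, h2, h4]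
    push_cast
    rw [pow_succ, pow_succ]
    field_simp
  · have h3 : fourierSum (kernel hN₂ hC χ₁ χ₂ (U : ZMod C) 0) = fun d => 0 * (0 : ZMod L → ℂ) d := by
      ext d
      simp [fourierSum, kernel_zero_eq_zero hL hN₂ hC hC' hCN χ₁ χ₂ hU]
    rw [h3, LFunction_const_mul, zero_mul, mul_zero]

end CuspEisenstein
end

/-! ### The support of `dualKernel` and the double sum `c(n, m)` -/

noncomputable section
namespace CuspEisenstein
open Filter Topology
open UpperHalfPlane hiding I
open Complex (I exp)
open ZMod
open scoped Real Nat ZMod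

lemma sum_zmod_eq_sum_range {N : ℕ} [NeZero N] (f : ZMod N → ℂ) :
    ∑ j, f j = ∑ i ∈ Finset.range N, f (i : ZMod N) := by
  refine Finset.sum_bij' (s := Finset.univ) (t := Finset.range N)
    (fun (j : ZMod N) _ => j.val) (fun (i : ℕ) _ => (i : ZMod N))
    (fun j _ => Finset.mem_range.mpr j.val_lt) (fun _ _ => Finset.mem_univ _) ?_ ?_ ?_
  · intro j _; simp
  · intro i hi; exact ZMod.val_cast_of_lt (Finset.mem_range.mp hi)
  · intro j _; simp

section charFiber

variable {N M C L : ℕ} [NeZero N] [NeZero M] [NeZero C]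

/-- The two scales are `L/N = MC` and `L/C = NM`, with greatest common divisor `M · gcd(N, C)`; the
congruence modulo `L` is divided by it. -/
lemma mem_fiber_iff (hL : L = N * M * C) (r s b : ℤ) :
    (((M * N.gcd C * r : ℤ) : ZMod L) = scale N L (b : ZMod N) + scale C L (s : ZMod C)) ↔
      ((N * (C / N.gcd C : ℕ) : ℕ) : ℤ) ∣
        r - ((N / N.gcd C : ℕ) : ℤ) * s - b * ((C / N.gcd C : ℕ) : ℤ) := by
  have hN : N ∣ L := ⟨M * C, by rw [hL]; ring⟩
  have hC : C ∣ L := ⟨N * M, by rw [hL]; ring⟩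
  have d1 : L / N = M * C := by
    rw [hL, mul_assoc]; exact Nat.mul_div_cancel_left _ (NeZero.pos N)
  have d2 : L / C = N * M := by rw [hL]; exact Nat.mul_div_cancel _ (NeZero.pos C)
  have hh : 0 < N.gcd C := Nat.gcd_pos_of_pos_left _ (NeZero.pos N)
  have eN : N.gcd C * (N / N.gcd C) = N := Nat.mul_div_cancel' (Nat.gcd_dvd_left _ _)
  have eC : N.gcd C * (C / N.gcd C) = C := Nat.mul_div_cancel' (Nat.gcd_dvd_right _ _)
  have hM0 : ((M * N.gcd C : ℕ) : ℤ) ≠ 0 := by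
    exact_mod_cast mul_ne_zero (NeZero.ne M) hh.ne'
  rw [scale_intCast hN, scale_intCast hC, d1, d2, ← Int.cast_add, eq_comm,
    ZMod.intCast_eq_intCast_iff_dvd_sub]
  refine Iff.trans ?_ (mul_dvd_mul_iff_left hM0)
  generalize N / N.gcd C = N' at *
  generalize C / N.gcd C = C' at *
  generalize N.gcd C = h at *
  have e1 : ((M * h : ℕ) : ℤ) * ((N * C' : ℕ) : ℤ) = L := by
    rw [hL, ← eC]; push_cast; ring
  have e2 : ((M * h : ℕ) : ℤ) * (r - N' * s - b * C') =
      M * h * r - (b * ((M * C : ℕ) : ℤ) + s * ((N * M : ℕ) : ℤ)) := by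
    have eN' : (h : ℤ) * N' = N := by exact_mod_cast eN
    have eC' : (h : ℤ) * C' = C := by exact_mod_cast eC
    push_cast
    rw [← eN', ← eC']; ring
  rw [e1, e2]

/-- The value of `charFiber` in terms of integers. -/
lemma charFiber_intCast (hL : L = N * M * C) (χ : DirichletCharacter ℂ N) (r s : ℤ) :
    charFiber χ (s : ZMod C) ((M * N.gcd C * r : ℤ) : ZMod L) =
      if ((N / N.gcd C : ℕ) : ℤ) * s ≡ r [ZMOD ((C / N.gcd C : ℕ) : ℤ)] then
        star χ (((r - ((N / N.gcd C : ℕ) : ℤ) * s) / ((C / N.gcd C : ℕ) : ℤ) : ℤ) : ZMod N)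
      else 0 := by
  have hC'0 : ((C / N.gcd C : ℕ) : ℤ) ≠ 0 := by
    exact_mod_cast (Nat.div_pos (Nat.gcd_le_right _ (NeZero.pos C))
      (Nat.gcd_pos_of_pos_left _ (NeZero.pos N))).ne'
  rw [charFiber]
  split_ifs with h
  · obtain ⟨q, hq⟩ := h.dvd
    have hq' : (r - ((N / N.gcd C : ℕ) : ℤ) * s) / ((C / N.gcd C : ℕ) : ℤ) = q := by
      rw [hq]; exact Int.mul_ediv_cancel_left _ hC'0
    rw [hq']
    have key (b : ℤ) : (((M * N.gcd C * r : ℤ) : ZMod L) =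
        scale N L (b : ZMod N) + scale C L (s : ZMod C)) ↔ (b : ZMod N) = (q : ZMod N) := by
      rw [mem_fiber_iff hL, hq, ZMod.intCast_eq_intCast_iff_dvd_sub,
        show ((C / N.gcd C : ℕ) : ℤ) * q - b * ((C / N.gcd C : ℕ) : ℤ) =
          (q - b) * ((C / N.gcd C : ℕ) : ℤ) by ring, Nat.cast_mul, mul_dvd_mul_iff_right hC'0]
    rw [Finset.sum_eq_single (q : ZMod N)]
    · rw [if_pos ((key q).mpr rfl)]
    · intro a _ ha
      obtain ⟨b, rfl⟩ := ZMod.intCast_surjective a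
      rw [if_neg fun h0 => ha ((key b).mp h0)]
    · simp
  · refine Finset.sum_eq_zero fun a _ => ?_
    obtain ⟨b, rfl⟩ := ZMod.intCast_surjective a
    rw [if_neg]
    rw [mem_fiber_iff hL]
    intro h0
    refine h (Int.modEq_iff_dvd.mpr ?_)
    have h1 : ((C / N.gcd C : ℕ) : ℤ) ∣ _ := (Dvd.intro_left (N : ℤ) (by push_cast; rfl)).trans h0
    exact (dvd_sub_left (dvd_mul_left _ _)).mp h1

omit [NeZero M] in
-- Both scales `L/N = MC` and `L/C = MN` are multiples of `M · gcd(N, C)`. This support condition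
-- determines the exponents of `q` in the expansion.
lemma dvd_of_charFiber_ne_zero (hL : L = N * M * C) {χ : DirichletCharacter ℂ N} {s : ZMod C}
    {n : ℕ} (h : charFiber χ s (n : ZMod L) ≠ 0) : M * N.gcd C ∣ n := by
  have hN : N ∣ L := ⟨M * C, by rw [hL]; ring⟩
  have hC : C ∣ L := ⟨N * M, by rw [hL]; ring⟩
  have d1 : L / N = M * C := by
    rw [hL, mul_assoc]; exact Nat.mul_div_cancel_left _ (NeZero.pos N)
  have d2 : L / C = M * N := by
    rw [hL, mul_comm N M]; exact Nat.mul_div_cancel _ (NeZero.pos C)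
  obtain ⟨a, -, ha⟩ := Finset.exists_ne_zero_of_sum_ne_zero h
  split_ifs at ha with h0
  · rw [scale, scale, d1, d2, ← Nat.cast_add, ZMod.natCast_eq_natCast_iff] at h0
    have h1 : M * N.gcd C ∣ L := by
      rw [hL, mul_comm N M]
      exact (mul_dvd_mul_left M (Nat.gcd_dvd_left N C)).trans (dvd_mul_right _ _)
    refine ((h0.of_dvd h1).dvd_iff dvd_rfl).mpr (dvd_add ?_ ?_)
    · exact (mul_dvd_mul_left M (Nat.gcd_dvd_right N C)).trans (dvd_mul_left _ _)
    · exact (mul_dvd_mul_left M (Nat.gcd_dvd_left N C)).trans (dvd_mul_left _ _)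
  · exact absurd rfl ha

end charFiber

lemma dvd_of_dualKernel_ne_zero {N₁ N₂ C L : ℕ} [NeZero N₁] [NeZero N₂] [NeZero C]
    (hL : L = N₁ * N₂ * C) {χ₁ : DirichletCharacter ℂ N₁} {χ₂ : DirichletCharacter ℂ N₂}
    {u : ZMod C} {d x : ℕ} (h : dualKernel χ₁ χ₂ u (d : ZMod L) (x : ZMod L) ≠ 0) :
    N₁ * N₂.gcd C ∣ d ∧ N₂ * N₁.gcd C ∣ x := by
  obtain ⟨s, -, hs⟩ := Finset.exists_ne_zero_of_sum_ne_zero h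
  obtain ⟨t, -, ht⟩ := Finset.exists_ne_zero_of_sum_ne_zero hs
  have h1 := left_ne_zero_of_mul ht
  exact ⟨dvd_of_charFiber_ne_zero (by rw [hL]; ring) (right_ne_zero_of_mul h1),
    dvd_of_charFiber_ne_zero hL (left_ne_zero_of_mul h1)⟩

lemma gi_mul (N : ℕ) {e C g : ℕ} (h : e.Coprime C) : gi N (e * g) (C * g) = N.gcd C * g := by
  rw [gi, Nat.gcd_mul_right, h.gcd_eq_one, one_mul, Nat.gcd_mul_right]

lemma zeta_zpow (C : ℕ) [NeZero C] (n : ℤ) : zeta C ^ n = stdAddChar (n : ZMod C) := by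
  rw [stdAddChar_coe, zeta, ← Complex.exp_int_mul]
  congr 1
  ring

/-- The double sum `c` is a value of `dualKernel`. -/
lemma c_eq_dualKernel {N₁ N₂ C L e g : ℕ} [NeZero N₁] [NeZero N₂] [NeZero C] (hg : 0 < g)
    (heC : e.Coprime C) (hL : L = N₁ * N₂ * C)
    (χ₁ : DirichletCharacter ℂ N₁) (χ₂ : DirichletCharacter ℂ N₂) (A r m : ℤ) :
    c χ₁ χ₂ (e * g) A (C * g) r m = dualKernel χ₁ χ₂ ((A * e : ℤ) : ZMod C)
      ((N₁ * N₂.gcd C * m : ℤ) : ZMod L) ((N₂ * N₁.gcd C * r : ℤ) : ZMod L) := by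
  have hgcd : Nat.gcd (e * g) (C * g) = g := by
    rw [Nat.gcd_mul_right, heC.gcd_eq_one, one_mul]
  have hval (s : ℕ) : ((s : ℤ) : ZMod C) = (s : ZMod C) := Int.cast_natCast s
  rw [dualKernel, c]
  simp only [gi_mul _ heC, hgcd, Nat.mul_div_mul_right _ _ hg, Nat.mul_div_cancel _ hg,
    sum_zmod_eq_sum_range, ← hval]
  simp only [charFiber_intCast (N := N₁) (M := N₂) hL,
    charFiber_intCast (N := N₂) (M := N₁) (by rw [hL]; ring : L = N₂ * N₁ * C), Finset.sum_filter]
  refine Finset.sum_congr rfl fun s _ => ?_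
  split_ifs with hs
  · rw [Finset.mul_sum]
    refine Finset.sum_congr rfl fun t _ => ?_
    split_ifs with ht
    · rw [zeta_zpow, ← mul_assoc]
      congr 2
      rw [invMod]
      push_cast
      rw [ZMod.natCast_zmod_val]
    · simp
  · simp

lemma sum_int_divisors (n : ℕ) (f : ℤ → ℂ) :
    ∑ m ∈ Int.divisors (n : ℤ), f m = ∑ d ∈ n.divisors, (f d + f (-d)) := by
  rw [Int.divisors, Finset.sum_disjUnion, Finset.sum_map, Finset.sum_map, Int.natAbs_natCast,
    Finset.sum_add_distrib]
  rfl

/-- The sum over all the divisors in a Fourier coefficient is twice the sum over the positive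
ones. -/
lemma sum_int_divisors_c {N₁ N₂ C e g k : ℕ} [NeZero N₁] [NeZero N₂] [NeZero C] (hk : 1 ≤ k)
    (hg : 0 < g) (heC : e.Coprime C)
    {χ₁ : DirichletCharacter ℂ N₁} {χ₂ : DirichletCharacter ℂ N₂}
    (hparity : χ₁ (-1) * χ₂ (-1) = (-1) ^ k) (A : ℤ) (n : ℕ) :
    ∑ m ∈ Int.divisors (n : ℤ), (Int.sign m : ℂ) * (m : ℂ) ^ (k - 1) *
        c χ₁ χ₂ (e * g) A (C * g) ((n : ℤ) / m) m =
      2 * ∑ d ∈ n.divisors, (d : ℂ) ^ (k - 1) *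
        c χ₁ χ₂ (e * g) A (C * g) ((n / d : ℕ) : ℤ) d := by
  -- Under `m ↦ -m` the sign, the power and `c` contribute `-1`, `(-1)^(k-1)` and `(-1)^k`, with
  -- product 1.
  have hneg (r m : ℤ) : c χ₁ χ₂ (e * g) A (C * g) (-r) (-m) =
      (-1) ^ k * c χ₁ χ₂ (e * g) A (C * g) r m := by
    rw [c_eq_dualKernel hg heC rfl, c_eq_dualKernel hg heC rfl, mul_neg, mul_neg, Int.cast_neg,
      Int.cast_neg, dualKernel_neg ⟨N₂ * C, by ring⟩ ⟨N₁ * C, by ring⟩ ⟨N₁ * N₂, by ring⟩, hparity]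
  rw [sum_int_divisors, Finset.mul_sum]
  refine Finset.sum_congr rfl fun d hd => ?_
  have hd0 : 0 < d := Nat.pos_of_mem_divisors hd
  obtain ⟨l, rfl⟩ : ∃ l, k = l + 1 := ⟨k - 1, by omega⟩
  have h1 : (-1 : ℂ) ^ l * (-1) ^ l = 1 := by rw [← mul_pow]; simp
  rw [Int.ediv_neg, hneg, Int.sign_neg, Int.sign_natCast_of_ne_zero hd0.ne', Nat.add_sub_cancel,
    ← Int.natCast_div]
  push_cast
  rw [neg_pow (d : ℂ) l, pow_succ]
  linear_combination ((d : ℂ) ^ l * c χ₁ χ₂ (e * g) A (C * g) (n / d) d) * h1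

end CuspEisenstein
end

/-! ### The Fourier expansion in the original variable -/

noncomputable section
namespace CuspEisenstein
open Filter Topology
open UpperHalfPlane hiding I
open Complex (I exp)
open ZMod
open scoped Real Nat ZMod

section expansion

variable {N₁ N₂ C L e g k : ℕ} [NeZero N₁] [NeZero N₂] [NeZero C] [NeZero L]
  {χ₁ : DirichletCharacter ℂ N₁} {χ₂ : DirichletCharacter ℂ N₂}

/-- The factor `(N₁ gcd(N₂, C))^(k-1)` is the one by which `d^(k-1)` grows when `d` is restricted to
the support of `dualKernel`, so that all coefficients carry the same normalization. -/
lemma T_eq_LFunction (hg : 0 < g) (heC : e.Coprime C) (hL : L = N₁ * N₂ * C)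
    (hC' : C ∣ N₁ * N₂) (hk : 1 ≤ k) (hχ₂ : χ₂.IsPrimitive)
    (hparity : χ₁ (-1) * χ₂ (-1) = (-1) ^ k) {A : ℤ} (hU : IsCoprime (A * e) (C : ℤ)) :
    ((N₁ * N₂.gcd C : ℕ) : ℂ) ^ (k - 1) * T k χ₁ χ₂ (e * g) A (C * g) =
      LFunction (fun d : ZMod L => dualKernel χ₁ χ₂ ((A * e : ℤ) : ZMod C) d 0) (1 - k) := by
  have hgcd : Nat.gcd (e * g) (C * g) = g := by
    rw [Nat.gcd_mul_right, heC.gcd_eq_one, one_mul]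
  have hg0 : (g : ℂ) ≠ 0 := by exact_mod_cast hg.ne'
  have hN₂0 : (N₂ : ℂ) ≠ 0 := by exact_mod_cast NeZero.ne N₂
  have hh : (N₂.gcd C : ℂ) ≠ 0 := by
    exact_mod_cast (Nat.gcd_pos_of_pos_left _ (NeZero.pos N₂)).ne'
  rw [LFunction_dualKernel hL hC' hk hχ₂ hparity hU, T]
  simp only [gi_mul _ heC, hgcd, Nat.mul_div_cancel _ hg]
  split_ifs with h
  · push_cast
    rw [mul_div_cancel_right₀ _ hg0, mul_pow]
    field_simp
  · simp

lemma a_zero (hg : 0 < g) (heC : e.Coprime C) (hL : L = N₁ * N₂ * C)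
    (hC' : C ∣ N₁ * N₂) (hk : 1 ≤ k) (hχ₁ : χ₁.IsPrimitive) (hχ₂ : χ₂.IsPrimitive)
    (hparity : χ₁ (-1) * χ₂ (-1) = (-1) ^ k) {A : ℤ} (hU : IsCoprime (A * e) (C : ℤ)) :
    ((N₁ * N₂.gcd C : ℕ) : ℂ) ^ (k - 1) * a k χ₁ χ₂ (e * g) A (C * g) 0 =
      LFunction (fun d : ZMod L => dualKernel χ₁ χ₂ ((A * e : ℤ) : ZMod C) d 0) (1 - k) +
      if k = 1 then LFunction (dualKernel (L := L) χ₁ χ₂ ((A * e : ℤ) : ZMod C) 0) 0 else 0 := by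
  rw [← T_eq_LFunction hg heC hL hC' hk hχ₂ hparity hU, a, if_pos rfl]
  split_ifs with h1
  · subst h1
    have := T_eq_LFunction (L := L) (χ₁ := χ₂) (χ₂ := χ₁) hg heC (by rw [hL]; ring)
      (by rwa [mul_comm N₂]) le_rfl hχ₁ (by rw [mul_comm, hparity]) hU
    simp only [Nat.cast_one, sub_self, Nat.sub_self, pow_zero, one_mul] at this ⊢
    rw [this]
    congr 2
    ext x
    rw [dualKernel_swap]
  · rw [add_zero]

/-- The factor `ζ_N ^ (A⁻¹ (g₁ g₂ / C) n)` turns `τ` into `(C τ + D) / C`. -/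
lemma zeta_mul_qPow (hg : 0 < g) (he : 0 < e) (heC : e.Coprime C) (hC' : C ∣ N₁ * N₂) {A D : ℤ}
    (hAD : ((e * g * N₁ * N₂ : ℕ) : ℤ) ∣ A * D - 1) {τ₀ τ : ℂ}
    (hτ : τ = ((C * g : ℕ) * τ₀ + D) / (e * N₁ * N₂)) (n : ℕ) :
    zeta (e * g * N₁ * N₂) ^ (invMod A (e * g * N₁ * N₂) *
        (gi N₁ (e * g) (C * g) * gi N₂ (e * g) (C * g) / (C * g)) * n) *
      qPow τ₀ ((gi N₁ (e * g) (C * g) * gi N₂ (e * g) (C * g) * n : ℚ) /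
        ((e * g : ℕ) * N₁ * N₂ : ℚ)) =
      exp (2 * π * I * (N₁.gcd C * N₂.gcd C * n * τ / C)) := by
  have hg0 : (g : ℂ) ≠ 0 := by exact_mod_cast hg.ne'
  have he0 : (e : ℂ) ≠ 0 := by exact_mod_cast he.ne'
  have hN₁0 : (N₁ : ℂ) ≠ 0 := by exact_mod_cast NeZero.ne N₁
  have hN₂0 : (N₂ : ℂ) ≠ 0 := by exact_mod_cast NeZero.ne N₂
  have hC0 : (C : ℂ) ≠ 0 := by exact_mod_cast NeZero.ne C
  have : NeZero g := ⟨hg.ne'⟩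
  have : NeZero e := ⟨he.ne'⟩
  -- In general `gcd(C, N₁N₂)` divides `gcd(C, N₁) gcd(C, N₂)`, and here it equals `C`.
  obtain ⟨t, ht⟩ : C ∣ N₁.gcd C * N₂.gcd C := by
    have h := Nat.gcd_mul_left_dvd_mul_gcd C N₁ N₂
    rwa [Nat.gcd_eq_right hC'] at h
  have hdiv : gi N₁ (e * g) (C * g) * gi N₂ (e * g) (C * g) / (C * g) = g * t := by
    rw [gi_mul _ heC, gi_mul _ heC, show N₁.gcd C * g * (N₂.gcd C * g) =
      (C * g) * (g * t) by rw [show N₁.gcd C * g * (N₂.gcd C * g) =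
        (N₁.gcd C * N₂.gcd C) * g * g by ring, ht]; ring]
    exact Nat.mul_div_cancel_left _ (Nat.mul_pos (NeZero.pos C) hg)
  have htC : (N₁.gcd C * N₂.gcd C : ℂ) = C * t := by exact_mod_cast ht
  -- Since `AD ≡ 1` modulo the level, the inverse of `A` is `D` up to a multiple of the level; that
  -- multiple adds only an integer to the phase.
  obtain ⟨i, hi⟩ : ∃ i : ℤ, (invMod A (e * g * N₁ * N₂) : ℤ) = D + (e * g * N₁ * N₂ : ℕ) * i := by
    have hA1 : ((A : ZMod (e * g * N₁ * N₂)) * (D : ZMod (e * g * N₁ * N₂))) = 1 := by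
      have := (ZMod.intCast_zmod_eq_zero_iff_dvd _ _).mpr hAD
      push_cast at this
      exact sub_eq_zero.mp this
    have hinv : ((invMod A (e * g * N₁ * N₂) : ℤ) : ZMod (e * g * N₁ * N₂)) = (D : ℤ) := by
      rw [Int.cast_natCast, invMod, ZMod.natCast_zmod_val]
      exact ZMod.inv_eq_of_mul_eq_one _ _ _ hA1
    obtain ⟨i, hi⟩ := (ZMod.intCast_eq_intCast_iff_dvd_sub _ _ _).mp hinv
    exact ⟨-i, by linear_combination -hi⟩
  have hi' : (invMod A (e * g * N₁ * N₂) : ℂ) = D + e * g * N₁ * N₂ * i := by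
    exact_mod_cast congrArg (Int.cast : ℤ → ℂ) hi
  rw [hdiv, zeta, qPow, ← Complex.exp_nat_mul, ← Complex.exp_add, gi_mul _ heC, gi_mul _ heC, hτ,
    Complex.exp_eq_exp_iff_exists_int]
  refine ⟨g * i * t * n, ?_⟩
  push_cast
  rw [hi', htC, show (N₁.gcd C * g * (N₂.gcd C * g) : ℂ) = (N₁.gcd C * N₂.gcd C) * g * g by ring, htC]
  field_simp
  ring

/-- The Fourier expansion of the transformed Eisenstein series. -/
theorem hasSum_expansion (hg : 0 < g) (he : 0 < e) (heC : e.Coprime C) (hL : L = N₁ * N₂ * C)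
    (hC' : C ∣ N₁ * N₂) (hk : 1 ≤ k) (hχ₁ : χ₁.IsPrimitive) (hχ₂ : χ₂.IsPrimitive)
    (hparity : χ₁ (-1) * χ₂ (-1) = (-1) ^ k) {A D : ℤ} (hU : IsCoprime (A * e) (C : ℤ))
    (hAD : ((e * g * N₁ * N₂ : ℕ) : ℤ) ∣ A * D - 1) {τ₀ τ : ℂ} (him : 0 < τ.im)
    (hτ : τ = ((C * g : ℕ) * τ₀ + D) / (e * N₁ * N₂)) :
    HasSum (fun n : ℕ => a k χ₁ χ₂ (e * g) A (C * g) n *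
      qPow τ₀ ((gi N₁ (e * g) (C * g) * gi N₂ (e * g) (C * g) * n : ℚ) /
        ((e * g : ℕ) * N₁ * N₂ : ℚ)))
      ((((N₁ * N₂.gcd C : ℕ) : ℂ) ^ (k - 1))⁻¹ *
        eis k (dualKernel (L := L) χ₁ χ₂ ((A * e : ℤ) : ZMod C)) τ) := by
  set u : ZMod C := ((A * e : ℤ) : ZMod C) with hu
  have hC0 : (C : ℂ) ≠ 0 := by exact_mod_cast NeZero.ne C
  have hN₁0 : (N₁ : ℂ) ≠ 0 := by exact_mod_cast NeZero.ne N₁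
  have hN₂0 : (N₂ : ℂ) ≠ 0 := by exact_mod_cast NeZero.ne N₂
  have p₁ : 0 < N₁ * N₂.gcd C := Nat.mul_pos (NeZero.pos _) (Nat.gcd_pos_of_pos_left _ (NeZero.pos _))
  have p₂ : 0 < N₂ * N₁.gcd C := Nat.mul_pos (NeZero.pos _) (Nat.gcd_pos_of_pos_left _ (NeZero.pos _))
  have hK : ((N₁ * N₂.gcd C : ℕ) : ℂ) ^ (k - 1) ≠ 0 :=
    pow_ne_zero _ (by exact_mod_cast p₁.ne')
  -- The image of `j` contains the support of `dualKernel` on positive pairs. Along it `d x / L`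
  -- becomes `gcd(N₁, C) gcd(N₂, C) y r / C`.
  let j : ℕ+ × ℕ+ → ℕ+ × ℕ+ := fun p => (⟨N₁ * N₂.gcd C, p₁⟩ * p.1, ⟨N₂ * N₁.gcd C, p₂⟩ * p.2)
  have hj : Function.Injective j := by
    rintro ⟨y, r⟩ ⟨y', r'⟩ h
    exact Prod.ext (mul_left_cancel (congrArg Prod.fst h)) (mul_left_cancel (congrArg Prod.snd h))
  let G : ℕ → ℕ → ℂ := fun y r => (y : ℂ) ^ (k - 1) * c χ₁ χ₂ (e * g) A (C * g) r y *
    exp (2 * π * I * (N₁.gcd C * N₂.gcd C * (y * r : ℕ) * τ / C))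
  have hG (p : ℕ+ × ℕ+) : eisTerm k (dualKernel (L := L) χ₁ χ₂ u) τ (j p) =
      ((N₁ * N₂.gcd C : ℕ) : ℂ) ^ (k - 1) * G p.1 p.2 := by
    have hc := c_eq_dualKernel hg heC hL χ₁ χ₂ A p.2 p.1
    have e1 : ((j p).1 : ℕ) = N₁ * N₂.gcd C * p.1 := rfl
    have e2 : ((j p).2 : ℕ) = N₂ * N₁.gcd C * p.2 := rfl
    simp only [G]
    rw [eisTerm, e1, e2, hc, ← hu, show (2 * π * I * ((((N₁ * N₂.gcd C * p.1 : ℕ) : ℂ)) *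
      ((N₂ * N₁.gcd C * p.2 : ℕ) : ℂ) * τ / L) : ℂ) =
        2 * π * I * (N₁.gcd C * N₂.gcd C * ((p.1 * p.2 : ℕ) : ℂ) * τ / C) by
      rw [hL]; push_cast; field_simp]
    push_cast
    rw [mul_pow _ (p.1 : ℂ)]
    ring
  have hE := (summable_eisTerm k (dualKernel (L := L) χ₁ χ₂ u) him).hasSum
  rw [← hj.hasSum_iff fun p hp => ?_] at hE
  swap
  · by_contra h0
    obtain ⟨⟨y, hy⟩, ⟨r, hr⟩⟩ := dvd_of_dualKernel_ne_zero (L := L) hL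
      (right_ne_zero_of_mul (left_ne_zero_of_mul h0))
    have hy0 : 0 < y := Nat.pos_of_ne_zero fun h => p.1.ne_zero (by rw [hy, h, mul_zero])
    have hr0 : 0 < r := Nat.pos_of_ne_zero fun h => p.2.ne_zero (by rw [hr, h, mul_zero])
    exact hp ⟨(⟨y, hy0⟩, ⟨r, hr0⟩), Prod.ext (PNat.eq hy.symm) (PNat.eq hr.symm)⟩
  have hGs : HasSum (fun p : ℕ+ × ℕ+ => G p.1 p.2) ((((N₁ * N₂.gcd C : ℕ) : ℂ) ^ (k - 1))⁻¹ *
      ∑' p, eisTerm k (dualKernel (L := L) χ₁ χ₂ u) τ p) := by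
    refine (hE.mul_left _).congr_fun fun p => ?_
    rw [Function.comp_apply, hG, inv_mul_cancel_left₀ hK]
  have hdiv := (hasSum_divisors hGs.summable).mul_left 2
  rw [hGs.tsum_eq] at hdiv
  have hcoef (n : ℕ+) : a k χ₁ χ₂ (e * g) A (C * g) n *
      qPow τ₀ ((gi N₁ (e * g) (C * g) * gi N₂ (e * g) (C * g) * (n : ℕ) : ℚ) /
        ((e * g : ℕ) * N₁ * N₂ : ℚ)) = 2 * ∑ d ∈ (n : ℕ).divisors, G d (n / d) := by
    rw [a, if_neg n.ne_zero, sum_int_divisors_c hk hg heC hparity, mul_right_comm,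
      zeta_mul_qPow hg he heC hC' hAD hτ, mul_left_comm, Finset.mul_sum]
    congr 1
    refine Finset.sum_congr rfl fun d hd => ?_
    simp only [G]
    rw [Nat.mul_div_cancel' (Nat.dvd_of_mem_divisors hd)]
    ring
  have hS := (hasSum_pnat_iff (f := fun n : ℕ => a k χ₁ χ₂ (e * g) A (C * g) n *
      qPow τ₀ ((gi N₁ (e * g) (C * g) * gi N₂ (e * g) (C * g) * n : ℚ) /
        ((e * g : ℕ) * N₁ * N₂ : ℚ)))).mp (hdiv.congr_fun hcoef)
  have h0 := a_zero (L := L) hg heC hL hC' hk hχ₁ hχ₂ hparity hU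
  have hq : qPow τ₀ ((gi N₁ (e * g) (C * g) * gi N₂ (e * g) (C * g) * (0 : ℕ) : ℚ) /
        ((e * g : ℕ) * N₁ * N₂ : ℚ)) = 1 := by simp [qPow]
  rw [hq, mul_one] at hS
  rw [eis, ← h0, mul_add, inv_mul_cancel_left₀ hK, mul_left_comm, add_comm]
  exact hS

end expansion

end CuspEisenstein
end

/-! ### The slash action and the conclusion -/

noncomputable section
namespace CuspEisenstein
open Filter Topology
open UpperHalfPlane hiding I
open Complex (I exp)
open ZMod
open scoped Real Nat ZMod

section slash

variable {N₁ N₂ C e g k : ℕ} [NeZero N₁] [NeZero N₂] [NeZero C]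
  {χ₁ : DirichletCharacter ℂ N₁} {χ₂ : DirichletCharacter ℂ N₂}

omit [NeZero C] in
lemma z_eq (hg : 0 < g) (heC : e.Coprime C) :
    z k χ₁ χ₂ (e * g) (C * g) = 2 * ((N₂ : ℂ) * e / (N₂.gcd C : ℂ)) ^ (k - 1) * e *
      gauss (star χ₁) * gauss (star χ₂) := by
  have hgcd : Nat.gcd (e * g) (C * g) = g := by
    rw [Nat.gcd_mul_right, heC.gcd_eq_one, one_mul]
  have hg0 : (g : ℂ) ≠ 0 := by exact_mod_cast hg.ne'
  rw [z, hgcd, gi_mul _ heC]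
  push_cast
  rw [mul_div_cancel_right₀ _ hg0, ← mul_assoc, mul_div_mul_right _ _ hg0]

omit [NeZero C] in
lemma z_ne_zero (hg : 0 < g) (he : 0 < e) (heC : e.Coprime C) (hχ₁ : χ₁.IsPrimitive)
    (hχ₂ : χ₂.IsPrimitive) : z k χ₁ χ₂ (e * g) (C * g) ≠ 0 := by
  have he0 : (e : ℂ) ≠ 0 := by exact_mod_cast he.ne'
  have hN₂0 : (N₂ : ℂ) ≠ 0 := by exact_mod_cast NeZero.ne N₂
  have hh : (N₂.gcd C : ℂ) ≠ 0 := by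
    exact_mod_cast (Nat.gcd_pos_of_pos_left _ (NeZero.pos N₂)).ne'
  rw [z_eq hg heC]
  have h1 := gauss_ne_zero (isPrimitive_star hχ₁)
  have h2 := gauss_ne_zero (isPrimitive_star hχ₂)
  exact mul_ne_zero (mul_ne_zero (mul_ne_zero (mul_ne_zero two_ne_zero
    (pow_ne_zero _ (div_ne_zero (mul_ne_zero hN₂0 he0) hh))) he0) h1) h2

/-- The Fourier expansion of `F_k(χ₁, χ₂, e g)` at the cusp `γ ∞`. -/
theorem slash_eq (hg : 0 < g) (he : 0 < e) (heC : e.Coprime C) (hC' : C ∣ N₁ * N₂) (hk : 1 ≤ k)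
    (hχ₁ : χ₁.IsPrimitive) (hχ₂ : χ₂.IsPrimitive) (hparity : χ₁ (-1) * χ₂ (-1) = (-1) ^ k)
    (hne : ¬(k = 2 ∧ χ₁ = 1 ∧ χ₂ = 1)) (γ : SL(2, ℤ)) (hγC : γ 1 0 = ((C * g : ℕ) : ℤ))
    (hdet : γ 0 0 * γ 1 1 - γ 0 1 * γ 1 0 = 1) (hU : IsCoprime (γ 0 0 * (e : ℤ)) (C : ℤ))
    (hAD : ((e * g * N₁ * N₂ : ℕ) : ℤ) ∣ γ 0 0 * γ 1 1 - 1) (τ₀ : ℍ) :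
    Summable (fun n : ℕ => a k χ₁ χ₂ (e * g) (γ 0 0) (C * g) n *
      qPow τ₀ ((gi N₁ (e * g) (C * g) * gi N₂ (e * g) (C * g) * n : ℚ) /
        ((e * g : ℕ) * N₁ * N₂ : ℚ))) ∧
    (Fe k χ₁ χ₂ (e * g) ∣[(k : ℤ)] γ) τ₀ = 1 / z k χ₁ χ₂ (e * g) (C * g) *
      ∑' n : ℕ, a k χ₁ χ₂ (e * g) (γ 0 0) (C * g) n *
        qPow τ₀ ((gi N₁ (e * g) (C * g) * gi N₂ (e * g) (C * g) * n : ℚ) /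
          ((e * g : ℕ) * N₁ * N₂ : ℚ)) := by
  have hg0 : (g : ℂ) ≠ 0 := by exact_mod_cast hg.ne'
  have he0 : (e : ℂ) ≠ 0 := by exact_mod_cast he.ne'
  have hN₁0 : (N₁ : ℂ) ≠ 0 := by exact_mod_cast NeZero.ne N₁
  have hN₂0 : (N₂ : ℂ) ≠ 0 := by exact_mod_cast NeZero.ne N₂
  have hC0 : (C : ℂ) ≠ 0 := by exact_mod_cast NeZero.ne C
  have hh : (N₂.gcd C : ℂ) ≠ 0 := by
    exact_mod_cast (Nat.gcd_pos_of_pos_left _ (NeZero.pos N₂)).ne'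
  have h1 := gauss_ne_zero (isPrimitive_star hχ₁)
  have h2 := gauss_ne_zero (isPrimitive_star hχ₂)
  set w : ℂ := ((C * g : ℕ) : ℂ) * τ₀ + γ 1 1 with hw
  have hdenom : denom γ τ₀ = w := by
    rw [ModularGroup.denom_apply, hγC, hw]
    simp
  have hw0 : w ≠ 0 := hdenom ▸ denom_ne_zero γ τ₀
  have hpos : (0 : ℝ) < C * g / (e * N₁ * N₂) := by
    have := NeZero.pos N₁
    have := NeZero.pos N₂
    have := NeZero.pos C
    positivity
  have him : 0 < (w / (e * N₁ * N₂)).im := by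
    have e1 : w / (e * N₁ * N₂) = ((C * g / (e * N₁ * N₂) : ℝ) : ℂ) * τ₀ +
        ((γ 1 1 / (e * N₁ * N₂) : ℝ) : ℂ) := by
      rw [hw]; push_cast; field_simp
    rw [e1, Complex.add_im, Complex.im_ofReal_mul, Complex.ofReal_im, add_zero]
    exact mul_pos hpos τ₀.im_pos
  -- From `γτ₀ = (A w - 1)/(C g w)` one gets `e g · γτ₀ = Ae/C - e/(C w)`; this `τ` makes the last
  -- term `-1/(N₁N₂C τ)`.
  set τ : ℍ := ⟨w / (e * N₁ * N₂), him⟩ with hτ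
  have hτw : (τ : ℂ) = w / (e * N₁ * N₂) := rfl
  have hS := hasSum_expansion (L := N₁ * N₂ * C) hg he heC rfl hC' hk hχ₁ hχ₂ hparity hU hAD
    τ.im_pos hτw
  refine ⟨hS.summable, ?_⟩
  have hu : IsUnit ((γ 0 0 * (e : ℤ) : ℤ) : ZMod C) :=
    (ZMod.coe_int_isUnit_iff_isCoprime _ _).mpr hU.symm
  have hF := F_near_cusp (L := N₁ * N₂ * C) rfl hk hχ₁ hχ₂ hparity hne hu τ
  have hdetC : (γ 0 0 : ℂ) * γ 1 1 - γ 0 1 * (C * g) = 1 := by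
    rw [hγC] at hdet
    exact_mod_cast congrArg (Int.cast : ℤ → ℂ) hdet
  have harg : ((e * g : ℕ) : ℂ) * ((γ • τ₀ : ℍ) : ℂ) =
      ((γ 0 0 * (e : ℤ) : ℤ) : ℂ) / C + (-1 / (τ : ℂ)) / ((N₁ * N₂ * C : ℕ) : ℂ) := by
    have e1 : ((γ • τ₀ : ℍ) : ℂ) = (γ 0 0 * τ₀ + γ 0 1) / w := by
      rw [coe_specialLinearGroup_apply, hγC, hw]
      simp
    have e2 : (C * g : ℂ) * (γ 0 0 * τ₀ + γ 0 1) = γ 0 0 * w - 1 := by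
      rw [hw]; push_cast; linear_combination -hdetC
    have e3 : (γ 0 0 * τ₀ + γ 0 1 : ℂ) = (γ 0 0 * w - 1) / (C * g) := by
      rw [← e2]; field_simp
    rw [e1, hτw, e3]
    push_cast
    field_simp
    ring
  rw [hS.tsum_eq, ModularForm.SL_slash_apply, hdenom, Fe, harg, z_eq hg heC]
  generalize F k χ₁ χ₂ (((γ 0 0 * (e : ℤ) : ℤ) : ℂ) / C +
    (-1 / (τ : ℂ)) / ((N₁ * N₂ * C : ℕ) : ℂ)) = X at hF ⊢
  generalize eis k (dualKernel (L := N₁ * N₂ * C) χ₁ χ₂ ((γ 0 0 * (e : ℤ) : ℤ) : ZMod C)) τ = Y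
    at hF ⊢
  rw [hτw] at hF
  obtain ⟨l, rfl⟩ : ∃ l, k = l + 1 := ⟨k - 1, by omega⟩
  rw [zpow_neg, zpow_natCast]
  have hX : X = (w / (e * N₁ * N₂)) ^ (l + 1) * (N₁ * N₂) * Y /
      (2 * gauss (star χ₁) * gauss (star χ₂)) := by
    rw [eq_div_iff (mul_ne_zero (mul_ne_zero two_ne_zero h1) h2)]
    linear_combination hF
  rw [hX]
  push_cast
  simp only [div_pow, mul_pow, pow_succ]
  field_simp

end slash

end CuspEisenstein
end

theorem mainTheorem1 (k : ℕ) (hk : 1 ≤ k) (e : ℕ) (he : 0 < e)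
    {N₁ N₂ : ℕ} [NeZero N₁] [NeZero N₂]
    (χ₁ : DirichletCharacter ℂ N₁) (χ₂ : DirichletCharacter ℂ N₂)
    (hχ₁ : χ₁.IsPrimitive) (hχ₂ : χ₂.IsPrimitive)
    (hparity : χ₁ (-1) * χ₂ (-1) = (-1) ^ k)
    (hne : ¬ (k = 2 ∧ χ₁ = 1 ∧ χ₂ = 1))
    (γ : SL(2, ℤ)) (C : ℕ) (hγC : γ 1 0 = (C : ℤ)) (hC : 0 < C)
    (hCN : C ∣ e * N₁ * N₂) (hB : ((e * N₁ * N₂ : ℕ) : ℤ) ∣ γ 0 1) :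
    CuspEisenstein.z k χ₁ χ₂ e C ≠ 0 ∧
    ∀ τ : UpperHalfPlane,
      Summable (fun n : ℕ => CuspEisenstein.a k χ₁ χ₂ e (γ 0 0) C n *
        CuspEisenstein.qPow τ
          ((CuspEisenstein.gi N₁ e C * CuspEisenstein.gi N₂ e C * n : ℚ) / (e * N₁ * N₂ : ℚ))) ∧
      (CuspEisenstein.Fe k χ₁ χ₂ e ∣[(k : ℤ)] γ) τ =
        1 / CuspEisenstein.z k χ₁ χ₂ e C *
          ∑' n : ℕ, CuspEisenstein.a k χ₁ χ₂ e (γ 0 0) C n *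
            CuspEisenstein.qPow τ
              ((CuspEisenstein.gi N₁ e C * CuspEisenstein.gi N₂ e C * n : ℚ) /
                (e * N₁ * N₂ : ℚ)) := by
  -- Dividing `e` and `C` by `g` gives coprime `e'` and `C'`, and then `C ∣ eN₁N₂` becomes `C' ∣
  -- N₁N₂`.
  obtain ⟨e', C', heC, he', hC'⟩ := Nat.exists_coprime e C
  have hg : 0 < e.gcd C := Nat.gcd_pos_of_pos_left _ he
  generalize e.gcd C = g at *
  subst he' hC'
  have he0 : 0 < e' := Nat.pos_of_mul_pos_right he
  have : NeZero C' := ⟨(Nat.pos_of_mul_pos_right hC).ne'⟩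
  have hdet : γ 0 0 * γ 1 1 - γ 0 1 * γ 1 0 = 1 := by
    have := γ.det_coe
    rwa [Matrix.det_fin_two] at this
  have hC'N : C' ∣ N₁ * N₂ := by
    have h : C' * g ∣ e' * (N₁ * N₂) * g := by
      convert hCN using 1; ring
    exact heC.symm.dvd_of_dvd_mul_left (Nat.dvd_of_mul_dvd_mul_right hg h)
  have hAC : IsCoprime (γ 0 0) (C' : ℤ) := by
    refine ⟨γ 1 1, -(γ 0 1 * g), ?_⟩
    rw [hγC] at hdet
    push_cast at hdet
    linear_combination hdet
  have hU : IsCoprime (γ 0 0 * (e' : ℤ)) (C' : ℤ) :=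
    hAC.mul_left (Nat.isCoprime_iff_coprime.mpr heC)
  -- `AD - 1 = BC`, and `N ∣ B`: thus `D` represents the inverse of `A` modulo `N`.
  have hAD : ((e' * g * N₁ * N₂ : ℕ) : ℤ) ∣ γ 0 0 * γ 1 1 - 1 := by
    rw [show γ 0 0 * γ 1 1 - 1 = γ 0 1 * γ 1 0 by linear_combination hdet]
    exact hB.mul_right _
  have hz := CuspEisenstein.z_ne_zero hg he0 heC hχ₁ hχ₂ (k := k)
  refine ⟨hz, fun τ₀ => ?_⟩
  exact CuspEisenstein.slash_eq hg he0 heC hC'N hk hχ₁ hχ₂ hparity hne γ hγC hdet hU hAD τ₀
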